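/- **Setting.** Let $(\mathcal X,\to)$ be a countable directed graph with arc set $\mathcal A$ that is symmetric, connected, of bounded degree and without loops. Let $\Omega$ be the set of càdlàg piecewise constant paths $\omega:[0,1]\to\mathcal X$ with finitely many jumps, all along arcs and none at time $1$, with canonical process $X=(X_t)_{0\le t\le 1}$ and the $\sigma$-field generated by $X$. A random walk is a probability measure $P$ on $\Omega$; put $P_{01}=P((X_0,X_1)\in\cdot)$, and $P^{xy}=P(\,\cdot\mid X_0=x,X_1=y)$ for $(x,y)\in\operatorname{supp}P_{01}$. A random walk $P$ has the intensity $k:[0,1)\times\mathcal A\to[0,\infty)$ if for each finitely supported $u:\mathcal X\to\mathbb R$ the process $u(X_t)-\int_0^t\sum_{z':X_s\to z'}k(s,X_s\to z')\,(u(z')-u(X_s))\,ds$, $0\le t<1$, is a local $P$-martingale for the canonical filtration. Write $\bar k(t,z)=\sum_{z':z\to z'}k(t,z\to z')$. Let $j:[0,1]\times\mathcal A\to(0,\infty)$ be such that $\sup_{t,z}\bar j(t,z)<\infty$ and $t\mapsto j(t,z\to z')$ is continuously differentiable on $[0,1]$ for each arc, and let $R$ be a random walk with intensity $j$ such that $R(X_0=x)>0$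 for all $x\in\mathcal X$. The reciprocal class of $j$ is $$\mathcal R(j)=\Big\{\sum_{x,y}\pi(x,y)R^{xy}:\ \pi \text{ a probability measure on }\mathcal X^2,\ \operatorname{supp}\pi\subset\operatorname{supp}R_{01}\Big\}.$$ A random walk $P$ is reciprocal if for all $0\le u\le v\le1$, $P(X_{[u,v]}\in\cdot\mid X_{[0,u]},X_{[v,1]})=P(X_{[u,v]}\in\cdot\mid X_u,X_v)$. For $t\in(0,1)$ and $(z\to z')\in\mathcal A$ put $\chi_a[j](t,z\to z')=\partial_t\log j(t,z\to z')+\bar j(t,z')-\bar j(t,z)$; for $t\in[0,1)$ and a closed walk $\mathbf c=(x_0\to x_1\to\cdots\to x_n=x_0)$ put $|\mathbf c|=n$ and $\chi_c[j](t,\mathbf c)=\prod_{i=0}^{n-1}j(t,x_i\to x_{i+1})$. Let $T^t_k$ be the $k$-th jump time after time $t$ ($+\infty$ if there is none). A *tree* $\mathcal T$ is a spanning tree of $(\mathcal X,\to)$, with both orientations of its edges. For an arc $(x\to y)\notin\mathcal T$, let $\mathbf f_{x\to y}$ be the closed walk made of $x\to y$ followed by the only simple walk from $y$ to $x$ in $\mathcal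 T$. A *$\mathcal T$-basis of closed walks* is a set $\mathcal C=\mathcal C_0\cup\mathcal E$, where $\mathcal E=\{(x\to y\to x):(x\to y)\in\mathcal A\}$ and $\mathcal C_0$ consists of exactly one of $\mathbf f_{x\to y}$, $\mathbf f_{y\to x}$ for each edge $\{x,y\}$ outside $\mathcal T$. **Corollary 2.8 (res-12, "Short-time expansions characterize $\mathcal R(j)$").** A random walk $P$ belongs to $\mathcal R(j)$ if and only if the following three assertions hold. (i) $P$ is reciprocal and, for every $(x,y)\in\operatorname{supp}P_{01}$, $P^{xy}\ll R^{xy}$ and $P^{xy}$ has an intensity $k^{xy}:[0,1)\times\mathcal A\to[0,\infty)$ such that $t\mapsto k^{xy}(t,z\to z')$ is continuously differentiable on $[0,1)$ for each arc. (ii) There is a tree $\mathcal T$ such that for all $t\in(0,1)$ and all $(z\to z')\in\mathcal T$, as $h\to0^+$, $$P\big(T^t_1\le t+h/2\mid X_t=z,\ X_{t+h}=z',\ T^t_2>t+h\big)=\tfrac12-\tfrac h8\,\chi_a[j](t,z\to z')+o(h).$$ (iii) There is a $\mathcal T$-basis $\mathcal C$ of closed walks, with $\mathcal T$ the tree of (ii),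 such that for all $\mathbf c=(x_0\to\cdots\to x_n=x_0)\in\mathcal C$ and all $t\in(0,1)$, and also for $t=0$ if $P(X_0=x_0)>0$, as $h\to0^+$, $$P\big((X_t\to X_{T^t_1}\to\cdots\to X_{T^t_n})=\mathbf c,\ T^t_n<t+h<T^t_{n+1}\mid X_t=X_{t+h}=x_0\big)=\chi_c[j](t,\mathbf c)\,\frac{h^n}{n!}+o(h^n).$$ The expansions in (ii) and (iii) include that the conditioning events have positive probability for all small $h>0$. -/

import Mathlib

open MeasureTheory ProbabilityTheory Filter Topology Asymptotics

noncomputable section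

namespace RandomWalk

variable {V : Type*}

/-! ## Graphs: trees and bases of closed walks

A symmetric directed graph without loops is a `SimpleGraph`: its arcs are the ordered
pairs `(z, z')` with `G.Adj z z'`, and its directed walks are the walks of `G`. -/

/-- A closed walk of `G`, with its starting vertex. -/
abbrev ClosedWalk (G : SimpleGraph V) := Σ x : V, G.Walk x x

/-- The set of all closed walks `(x → y → x)`, one for each arc `x → y` of `G`. -/
def edgeWalks (G : SimpleGraph V) : Set (ClosedWalk G) :=
  {c | ∃ (x y : V) (h : G.Adj x y), c = ⟨x, .cons h (.cons h.symm .nil)⟩}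

/-- For a spanning tree `T` of `G` and an arc `x → y` of `G`: the arc `x → y` followed by the only
simple walk of `T` from `y` to `x`. -/
def treeClosedWalk {G T : SimpleGraph V} (hle : T ≤ G) (hT : T.IsTree) {x y : V}
    (h : G.Adj x y) : ClosedWalk G :=
  ⟨x, .cons h ((hT.existsUnique_path y x).choose.mapLe hle)⟩

/-- `C` is a `T`-basis of the closed walks of `G`: the closed walks `(x → y → x)`, together with
exactly one of `treeClosedWalk` of `x → y` and of `y → x` for each edge of `G` outside `T`. -/
def IsTreeBasis {G T : SimpleGraph V} (hle : T ≤ G) (hT : T.IsTree)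
    (C : Set (ClosedWalk G)) : Prop :=
  ∃ C₀ : Set (ClosedWalk G), C = C₀ ∪ edgeWalks G ∧
    (∀ c ∈ C₀, ∃ (x y : V) (h : G.Adj x y), ¬ T.Adj x y ∧ c = treeClosedWalk hle hT h) ∧
    ∀ (x y : V) (h : G.Adj x y), ¬ T.Adj x y →
      Xor (treeClosedWalk hle hT h ∈ C₀) (treeClosedWalk hle hT h.symm ∈ C₀)

/-! ## Path space -/

/-- Càdlàg (for the discrete topology of `V`) piecewise constant paths on `[0, 1]` with finitely
many jumps, which jump along arcs of `G` and do not jump at time `1`. -/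
structure IsStepPath (G : SimpleGraph V) (ω : unitInterval → V) : Prop where
  right_cont : ∀ t, ∀ᶠ s in 𝓝[>] t, ω s = ω t
  left_lim : ∀ t, 0 < t →
    ∃ a, (∀ᶠ s in 𝓝[<] t, ω s = a) ∧ (a = ω t ∨ (t < 1 ∧ G.Adj a (ω t)))
  finite_jumps : {t | ¬ ∀ᶠ s in 𝓝[<] t, ω s = ω t}.Finite

/-- The path space, with the σ-field generated by the canonical process (this is the
subspace σ-field of the product σ-field, found by instance search). -/
abbrev PathSpace (G : SimpleGraph V) := {ω : unitInterval → V // IsStepPath G ω}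

/-- The canonical process `X t`, for `t ∈ [0, 1]` (real times outside `[0, 1]` are projected to
`[0, 1]`). -/
def X {G : SimpleGraph V} (t : ℝ) (ω : PathSpace G) : V :=
  ω.1 (Set.projIcc 0 1 zero_le_one t)

section Sigma

variable [MeasurableSpace V] {G : SimpleGraph V}

/-- The σ-field generated by `X t`, `t ∈ I`. -/
abbrev sigmaX (G : SimpleGraph V) (I : Set ℝ) : MeasurableSpace (PathSpace G) :=
  ⨆ t ∈ I, MeasurableSpace.comap (X t) inferInstance

theorem measurable_X (t : ℝ) : Measurable (X (G := G) t) :=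
  (measurable_pi_apply _).comp measurable_subtype_coe

theorem sigmaX_le (I : Set ℝ) : sigmaX G I ≤ Subtype.instMeasurableSpace :=
  iSup₂_le fun t _ => (measurable_X t).comap_le

theorem sigmaX_mono {I J : Set ℝ} (h : I ⊆ J) : sigmaX G I ≤ sigmaX G J :=
  biSup_mono fun _ ht => h ht

/-- The canonical filtration on `[0, 1)`. -/
def canonicalFiltration (G : SimpleGraph V) :
    Filtration (Set.Ico (0 : ℝ) 1) (inferInstance : MeasurableSpace (PathSpace G)) where
  seq t := sigmaX G (Set.Icc 0 (t : ℝ))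
  mono' _ _ h := sigmaX_mono (Set.Icc_subset_Icc_right h)
  le' _ := sigmaX_le _

/-! ## Bridges, reciprocal walks -/

/-- The event `{X 0 = x, X 1 = y}`. -/
def endpoints (G : SimpleGraph V) (x y : V) : Set (PathSpace G) := {ω | X 0 ω = x ∧ X 1 ω = y}

/-- The bridge `P^{xy} = P(· | X 0 = x, X 1 = y)`; it is only meaningful when
`P (endpoints G x y) ≠ 0`. -/
def bridge (P : Measure (PathSpace G)) (x y : V) : Measure (PathSpace G) :=
  P[|endpoints G x y]

/-- The reciprocal class: all mixtures `∑ π(x, y) R^{xy}` of bridges of `R`, where the probability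
measure `π` on `V × V` has its support in the support of the law of `(X 0, X 1)` under `R`. -/
def reciprocalClass (R : Measure (PathSpace G)) : Set (Measure (PathSpace G)) :=
  {P | ∃ π : PMF (V × V), (∀ p ∈ π.support, R (endpoints G p.1 p.2) ≠ 0) ∧
    P = Measure.sum fun p : V × V => π p • bridge R p.1 p.2}

/-- Reciprocal walks: for `0 ≤ u ≤ v ≤ 1`, the conditional law of `X_{[u,v]}` given `X_{[0,u]}` and
`X_{[v,1]}` is its conditional law given `X_u` and `X_v`. -/
def IsReciprocal (P : Measure (PathSpace G)) : Prop :=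
  ∀ u v : ℝ, 0 ≤ u → u ≤ v → v ≤ 1 → ∀ B, MeasurableSet[sigmaX G (Set.Icc u v)] B →
    P⟦B | sigmaX G (Set.Icc 0 u ∪ Set.Icc v 1)⟧ =ᵐ[P] P⟦B | sigmaX G {u, v}⟧

end Sigma

/-! ## Intensities of jumps

An intensity is a function `k : ℝ → V → V → ℝ`, where `k t z z'` is the rate of the jump
`z → z'` at time `t`. Only its values at times in `[0, 1)` (in `[0, 1]` for the reference
intensity) and at the arcs of the graph matter. -/

section Intensity

variable (G : SimpleGraph V) [G.LocallyFinite]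

/-- `k̄(t, z) = ∑_{z' : z → z'} k(t, z → z')`. -/
def totalRate (k : ℝ → V → V → ℝ) (t : ℝ) (z : V) : ℝ :=
  ∑ z' ∈ G.neighborFinset z, k t z z'

/-- The generator `K_t u(z) = ∑_{z' : z → z'} k(t, z → z') (u(z') - u(z))`. -/
def generator (k : ℝ → V → V → ℝ) (t : ℝ) (u : V → ℝ) (z : V) : ℝ :=
  ∑ z' ∈ G.neighborFinset z, k t z z' * (u z' - u z)

variable {G} in
/-- The random walk `P` has the intensity of jumps `k`: for every finitely supported `u`, the
process `u(X_t) - ∫₀ᵗ K_s u(X_s) ds`, `0 ≤ t < 1`, is a `P`-martingale for the canonical filtration.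
This is used for intensities `t ↦ k t z z'` that are continuous on `[0, 1)`. For these the process
is bounded on each `[0, t]`, `t < 1`, so that it is a martingale as soon as it is a local
martingale. -/
def HasIntensity [MeasurableSpace V] (P : Measure (PathSpace G)) (k : ℝ → V → V → ℝ) : Prop :=
  ∀ u : V →₀ ℝ, Martingale
    (fun (t : Set.Ico (0 : ℝ) 1) (ω : PathSpace G) =>
      u (X (t : ℝ) ω) - ∫ s in (0 : ℝ)..(t : ℝ), generator G k s u (X s ω))
    (canonicalFiltration G) P

/-- The requirements on the reference intensity `j`: bounded total rate, continuous
differentiability in time on `[0, 1]`, positivity. -/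
structure IsReferenceIntensity (j : ℝ → V → V → ℝ) : Prop where
  bounded : ∃ M : ℝ, ∀ t ∈ Set.Icc (0 : ℝ) 1, ∀ z, totalRate G j t z ≤ M
  contDiffOn : ∀ z z', G.Adj z z' → ContDiffOn ℝ 1 (fun t => j t z z') (Set.Icc 0 1)
  pos : ∀ t ∈ Set.Icc (0 : ℝ) 1, ∀ z z', G.Adj z z' → 0 < j t z z'

/-- The arc characteristic
`χ_a[k](t, z → z') = ∂_t log k(t, z → z') + k̄(t, z') - k̄(t, z)`, for `0 < t < 1`. -/
def arcChar (k : ℝ → V → V → ℝ) (t : ℝ) (z z' : V) : ℝ :=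
  deriv (fun s => Real.log (k s z z')) t + totalRate G k t z' - totalRate G k t z

end Intensity

/-! ## Jump times and short-time expansions -/

section Expansions

variable {G : SimpleGraph V}

/-- The closed walk characteristic `χ_c[k](t, c) = ∏ k(t, x_i → x_{i+1})` of the closed walk
`c = (x_0 → x_1 → ⋯ → x_n = x_0)`. -/
def walkChar (k : ℝ → V → V → ℝ) (t : ℝ) (c : ClosedWalk G) : ℝ :=
  ∏ i ∈ Finset.range c.2.length, k t (c.2.getVert i) (c.2.getVert (i + 1))

/-- `T^t_k`, the `k`-th time of jump after time `t`, with the convention `inf ∅ = +∞`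
(and `T^t_0 = t`). -/
def jumpTime (t : ℝ) : ℕ → PathSpace G → EReal
  | 0, _ => (t : EReal)
  | k + 1, ω => sInf {τ : EReal | ∃ s : ℝ, τ = s ∧ 0 < s ∧ s ≤ 1 ∧ jumpTime t k ω < s ∧
      ¬ ∀ᶠ r in 𝓝[<] s, X r ω = X s ω}

/-- The event that the first `n = |c|` jumps after time `t` make the walk follow
`c = (x_0 → ⋯ → x_n)` from time `t` on, and that `T^t_n < t + h < T^t_{n+1}`. -/
def followsWalk (t h : ℝ) (c : ClosedWalk G) : Set (PathSpace G) :=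
  {ω | (∀ i ≤ c.2.length, X (jumpTime t i ω).toReal ω = c.2.getVert i) ∧
    jumpTime t c.2.length ω < ((t + h : ℝ) : EReal) ∧
    ((t + h : ℝ) : EReal) < jumpTime t (c.2.length + 1) ω}

variable [MeasurableSpace V]

/-- The expansion, as `h → 0⁺`,
`P(T^t_1 ≤ t + h/2 | X_t = z, X_{t+h} = z', T^t_2 > t + h) = 1/2 - (h/8) χ_a[j](t, z → z') + o(h)`.
It fails if the conditioning events are null for arbitrarily small `h`, since the left-hand side is
then read as `0`. -/
def ArcExpansion [G.LocallyFinite] (P : Measure (PathSpace G)) (j : ℝ → V → V → ℝ)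
    (t : ℝ) (z z' : V) : Prop :=
  (fun h : ℝ =>
    (P[|{ω | X t ω = z ∧ X (t + h) ω = z' ∧ ((t + h : ℝ) : EReal) < jumpTime t 2 ω}]).real
        {ω | jumpTime t 1 ω ≤ ((t + h / 2 : ℝ) : EReal)}
      - (1 / 2 - h / 8 * arcChar G j t z z')) =o[𝓝[>] 0] fun h : ℝ => h

/-- The expansion, as `h → 0⁺`, for the closed walk `c` of length `n` that starts at `x_0`,
`P((X_t → X_{T^t_1} → ⋯ → X_{T^t_n}) = c, T^t_n < t + h < T^t_{n+1} | X_t = X_{t+h} = x_0)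
  = χ_c[j](t, c) h^n / n! + o(h^n)`.
For positive `j`, it fails if the conditioning events are null for arbitrarily small `h`, since the
left-hand side is then read as `0`. -/
def WalkExpansion (P : Measure (PathSpace G)) (j : ℝ → V → V → ℝ)
    (t : ℝ) (c : ClosedWalk G) : Prop :=
  (fun h : ℝ =>
    (P[|{ω | X t ω = c.1 ∧ X (t + h) ω = c.1}]).real (followsWalk t h c)
      - walkChar j t c * h ^ c.2.length / (c.2.length.factorial : ℝ))
    =o[𝓝[>] 0] fun h : ℝ => h ^ c.2.length

end Expansions

end RandomWalk

end

open RandomWalk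

/-!
# Short-time expansions characterize the reciprocal class

The theorem rests on the fact that a walk with an intensity is determined by the probabilities of
the events `visits G t l s`, that the states visited during `[t, s]` form the list `l`. For an
intensity that is continuous in time these probabilities solve a triangular system of linear
differential equations (`HasIntensity.hasDerivWithinAt_visits_cons`), obtained from the martingale
property and from the bound `EntryBound.hit2`, which says that two jumps within a time `h` have a
probability of order `h ^ 2`. Three consequences carry the argument.

* Integrating the system from time `t` on gives the short-time expansions of a walk with intensity
  `k`, with the characteristics of `k`: `HasIntensity.walkExpansion`, `HasIntensity.arcExpansion`.
* If two intensities are related by a space-time transform, `k t z z' = j t z z' * g t z' / g t z`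
  with the corresponding relation between the total rates, then the solutions of the two systems are
  proportional (`visits_ratio`), and so are the transition probabilities
  (`transitionRatio_of_rates`). With `k = j` and `g = 1` this is the Markov property.
* By the Markov property, what happens inside and outside of a time interval is independent given
  the states at its ends (`HasIntensity.sameBridges`); being reciprocal has the same meaning
  (`isReciprocal_iff_sameBridges`).

If `P` is a mixture of bridges of `R`, then it has the same bridges as `R` over each time interval
(`SameBridges.of_mixture`). Hence `P` is reciprocal, and the expansions, which only involve bridges
over `[t, t + h]`, pass from `R` to `P`. The bridges of `R` ending in `y` have an intensity by Doob's
transform (`IsReferenceIntensity.hasIntensity_bridge`), with `g t z = R (X 1 = y | X t = z)`, a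
solution of the backward equation.

Conversely, let `Q` be a bridge of `P`, with the intensity `k`. As `P` is reciprocal, its expansions
pass to `Q`, so that the characteristics of `k` along the arcs of the tree and along the basis of
closed walks are those of `j` (`HasIntensity.sameCharacteristics`). The equality along the basis says
that `log (k / j)` derives from a potential `ψ` (`IsTreeBasis.eq_sub`). The equality along the arcs
says that `∂ₜ ψ + k̄ - j̄` takes the same value at the ends of each arc of the tree, hence only depends
on the time; subtracting from `ψ` its integral gives the logarithm of a space-time transform
(`SameCharacteristics.exists_transform`). So `Q` and `R` have the same bridges over each
`[t₀, S] ⊆ (0, 1)`, and letting `t₀ → 0` and `S → 1` shows that `Q` is a bridge of `R`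
(`SameCharacteristics.eq_bridge`).
-/

open MeasureTheory ProbabilityTheory Filter Topology Asymptotics

noncomputable section

set_option linter.unusedSectionVars false

namespace RandomWalk

variable {V : Type*} {G : SimpleGraph V}

/-! ### Regularity of the paths and hitting events -/

lemma X_right (ω : PathSpace G) {t : ℝ} (h0 : 0 ≤ t) (h1 : t < 1) :
    ∃ ε > 0, t + ε ≤ 1 ∧ ∀ s, t ≤ s → s < t + ε → X s ω = X t ω := by
  have h := ω.2.right_cont (Set.projIcc 0 1 zero_le_one t)
  have hlim : Tendsto (Set.projIcc (0 : ℝ) 1 zero_le_one) (𝓝[>] t)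
      (𝓝[>] (Set.projIcc 0 1 zero_le_one t)) := by
    refine tendsto_nhdsWithin_iff.2
      ⟨(continuous_projIcc.tendsto t).mono_left nhdsWithin_le_nhds, ?_⟩
    filter_upwards [self_mem_nhdsWithin] with s hs
    change Set.projIcc 0 1 _ t < Set.projIcc 0 1 _ s
    rw [← Subtype.coe_lt_coe, Set.coe_projIcc, Set.coe_projIcc]
    rw [Set.mem_Ioi] at hs
    have hs0 : 0 < s := h0.trans_lt hs
    rw [min_eq_right h1.le, max_eq_right h0, lt_max_iff, lt_min_iff]
    exact Or.inr ⟨h1, hs⟩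
  have h2 := hlim.eventually h
  rw [eventually_nhdsWithin_iff, Metric.eventually_nhds_iff] at h2
  obtain ⟨ε, hε, h2⟩ := h2
  refine ⟨min ε (1 - t), lt_min hε (by linarith), by linarith [min_le_right ε (1 - t)], ?_⟩
  intro s hs hs'
  rcases hs.eq_or_lt with rfl | hs
  · rfl
  · refine h2 ?_ hs
    rw [Real.dist_eq, abs_of_pos (by linarith)]
    linarith [min_le_left ε (1 - t)]

lemma X_left (ω : PathSpace G) {t : ℝ} (h0 : 0 < t) (h1 : t ≤ 1) :
    ∃ ε > 0, ε ≤ t ∧ ∃ a, (∀ s, t - ε ≤ s → s < t → X s ω = a) ∧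
      (a = X t ω ∨ (t < 1 ∧ G.Adj a (X t ω))) := by
  obtain ⟨a, h, ha⟩ := ω.2.left_lim (Set.projIcc 0 1 zero_le_one t) (by
    rw [← Subtype.coe_lt_coe, Set.coe_projIcc]
    simp [h0])
  have hlim : Tendsto (Set.projIcc (0 : ℝ) 1 zero_le_one) (𝓝[<] t)
      (𝓝[<] (Set.projIcc 0 1 zero_le_one t)) := by
    refine tendsto_nhdsWithin_iff.2
      ⟨(continuous_projIcc.tendsto t).mono_left nhdsWithin_le_nhds, ?_⟩
    filter_upwards [self_mem_nhdsWithin] with s hs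
    change Set.projIcc 0 1 _ s < Set.projIcc 0 1 _ t
    rw [← Subtype.coe_lt_coe, Set.coe_projIcc, Set.coe_projIcc]
    rw [Set.mem_Iio] at hs
    rw [min_eq_right h1, max_eq_right h0.le, max_lt_iff]
    exact ⟨h0, lt_of_le_of_lt (min_le_right _ _) hs⟩
  have h2 := hlim.eventually h
  rw [eventually_nhdsWithin_iff, Metric.eventually_nhds_iff] at h2
  obtain ⟨ε, hε, h2⟩ := h2
  refine ⟨min (ε / 2) t, lt_min (by linarith) h0, min_le_right _ _, a, ?_, ?_⟩
  · intro s hs hs'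
    refine h2 ?_ hs'
    rw [Real.dist_eq, abs_of_neg (by linarith)]
    linarith [min_le_left (ε / 2) t]
  · refine ha.imp id fun ha => ⟨?_, ha.2⟩
    have := ha.1
    rw [← Subtype.coe_lt_coe, Set.coe_projIcc, min_eq_right h1, max_eq_right h0.le] at this
    exact this

/-- The event that, within `[s, s']`, the path visits `U₁` and, at the same time or later, `U₂`. -/
def hit2 (G : SimpleGraph V) (U₁ U₂ : Set V) (s s' : ℝ) : Set (PathSpace G) :=
  {ω | ∃ r₁ r₂, s ≤ r₁ ∧ r₁ ≤ r₂ ∧ r₂ ≤ s' ∧ X r₁ ω ∈ U₁ ∧ X r₂ ω ∈ U₂}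

/-- The event that the path visits `U` within `[s, s']`. -/
def hit (G : SimpleGraph V) (U : Set V) (s s' : ℝ) : Set (PathSpace G) :=
  {ω | ∃ r, s ≤ r ∧ r ≤ s' ∧ X r ω ∈ U}

lemma hit_eq_hit2 (U : Set V) (s s' : ℝ) : hit G U s s' = hit2 G U U s s' := by
  ext ω
  constructor
  · rintro ⟨r, h1, h2, h3⟩
    exact ⟨r, r, h1, le_rfl, h2, h3, h3⟩
  · rintro ⟨r, r', h1, h2, h3, h4, -⟩
    exact ⟨r, h1, h2.trans h3, h4⟩

lemma hit2_mono {U₁ U₂ : Set V} {s s' r r' : ℝ} (h : r ≤ s) (h' : s' ≤ r') :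
    hit2 G U₁ U₂ s s' ⊆ hit2 G U₁ U₂ r r' := by
  rintro ω ⟨r₁, r₂, h1, h2, h3, h4⟩
  exact ⟨r₁, r₂, h.trans h1, h2, h3.trans h', h4⟩

lemma notMem_hit {U : Set V} {s s' : ℝ} {ω : PathSpace G} :
    ω ∉ hit G U s s' ↔ ∀ r, s ≤ r → r ≤ s' → X r ω ∉ U := by
  simp [hit]

/-- The rational times of `[s, s']`, together with `s'`: these times suffice to observe a
right-continuous path on `[s, s']`. -/
def rationalTimes (s s' : ℝ) : Set ℝ := insert s' (Set.range ((↑) : ℚ → ℝ) ∩ Set.Icc s s')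

lemma countable_rationalTimes (s s' : ℝ) : (rationalTimes s s').Countable :=
  ((Set.countable_range _).mono Set.inter_subset_left).insert _

lemma rationalTimes_subset {s s' : ℝ} (h : s ≤ s') : rationalTimes s s' ⊆ Set.Icc s s' :=
  Set.insert_subset ⟨h, le_rfl⟩ Set.inter_subset_right

lemma exists_rationalTimes (ω : PathSpace G) {s s' r m : ℝ} (hs : 0 ≤ s) (hs' : s' ≤ 1)
    (hr : s ≤ r) (hr' : r ≤ s') (hm : r < m) :
    ∃ q ∈ rationalTimes s s', r ≤ q ∧ q < m ∧ X q ω = X r ω := by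
  rcases hr'.eq_or_lt with rfl | hlt
  · exact ⟨r, Set.mem_insert _ _, le_rfl, hm, rfl⟩
  · obtain ⟨ε, hε, -, h⟩ := X_right ω (hs.trans hr) (hlt.trans_le hs')
    obtain ⟨q, hq, hq'⟩ := exists_rat_btwn
      (show r < min (min (r + ε) s') m from lt_min (lt_min (by linarith) hlt) hm)
    simp only [lt_min_iff] at hq'
    exact ⟨q, Or.inr ⟨⟨q, rfl⟩, hr.trans hq.le, hq'.1.2.le⟩, hq.le, hq'.2,
      h q hq.le hq'.1.1⟩

lemma mem_hit2_iff {U₁ U₂ : Set V} {s s' : ℝ} (hs : 0 ≤ s) (hs' : s' ≤ 1) (ω : PathSpace G)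
    (hss : s ≤ s') :
    ω ∈ hit2 G U₁ U₂ s s' ↔ ∃ r₁ ∈ rationalTimes s s', ∃ r₂ ∈ rationalTimes s s',
      r₁ ≤ r₂ ∧ X r₁ ω ∈ U₁ ∧ X r₂ ω ∈ U₂ := by
  constructor
  · rintro ⟨r₁, r₂, h1, h2, h3, h4, h5⟩
    obtain ⟨q₂, hq₂, hr₂, -, e₂⟩ :=
      exists_rationalTimes ω hs hs' (h1.trans h2) h3 (show r₂ < r₂ + 1 by linarith)
    rcases h2.eq_or_lt with rfl | h2
    · exact ⟨q₂, hq₂, q₂, hq₂, le_rfl, e₂ ▸ h4, e₂ ▸ h5⟩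
    · obtain ⟨q₁, hq₁, hr₁, hl, e₁⟩ := exists_rationalTimes ω hs hs' h1 (h2.le.trans h3) h2
      exact ⟨q₁, hq₁, q₂, hq₂, (hl.le.trans hr₂), e₁ ▸ h4, e₂ ▸ h5⟩
  · rintro ⟨r₁, hr₁, r₂, hr₂, h, h4, h5⟩
    exact ⟨r₁, r₂, (rationalTimes_subset hss hr₁).1, h, (rationalTimes_subset hss hr₂).2, h4, h5⟩

section Meas

variable [MeasurableSpace V] [DiscreteMeasurableSpace V]

lemma measurableSet_X_mem {I : Set ℝ} {r : ℝ} (hr : r ∈ I) (U : Set V) :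
    MeasurableSet[sigmaX G I] {ω | X r ω ∈ U} := by
  have : MeasurableSpace.comap (X (G := G) r) inferInstance ≤ sigmaX G I :=
    le_iSup₂ (f := fun t (_ : t ∈ I) => MeasurableSpace.comap (X (G := G) t) inferInstance) r hr
  exact this _ ⟨U, MeasurableSet.of_discrete, rfl⟩

lemma measurableSet_X_eq {I : Set ℝ} {r : ℝ} (hr : r ∈ I) (a : V) :
    MeasurableSet[sigmaX G I] {ω | X r ω = a} :=
  measurableSet_X_mem hr {a}

lemma measurableSet_X_mem' (r : ℝ) (U : Set V) : MeasurableSet {ω : PathSpace G | X r ω ∈ U} :=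
  measurable_X r MeasurableSet.of_discrete

lemma measurableSet_X_eq' (r : ℝ) (a : V) : MeasurableSet {ω : PathSpace G | X r ω = a} :=
  measurableSet_X_mem' r {a}

lemma measurableSet_hit2 {U₁ U₂ : Set V} {s s' : ℝ} {I : Set ℝ} (hI : Set.Icc s s' ⊆ I)
    (hs : 0 ≤ s) (hs' : s' ≤ 1) (hss : s ≤ s') : MeasurableSet[sigmaX G I] (hit2 G U₁ U₂ s s') := by
  have e : hit2 G U₁ U₂ s s' = ⋃ r₁ ∈ rationalTimes s s', ⋃ r₂ ∈ rationalTimes s s',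
      {ω | r₁ ≤ r₂ ∧ X r₁ ω ∈ U₁ ∧ X r₂ ω ∈ U₂} := by
    ext ω
    simp only [mem_hit2_iff hs hs' ω hss, Set.mem_iUnion, exists_prop]
    rfl
  rw [e]
  refine MeasurableSet.biUnion (countable_rationalTimes _ _) fun r₁ h₁ =>
    MeasurableSet.biUnion (countable_rationalTimes _ _) fun r₂ h₂ => ?_
  by_cases h : r₁ ≤ r₂
  · simp only [h, true_and]
    exact (measurableSet_X_mem (hI (rationalTimes_subset hss h₁)) U₁).inter
      (measurableSet_X_mem (hI (rationalTimes_subset hss h₂)) U₂)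
  · simp [h]

lemma measurableSet_hit {U : Set V} {s s' : ℝ} {I : Set ℝ} (hI : Set.Icc s s' ⊆ I)
    (hs : 0 ≤ s) (hs' : s' ≤ 1) (hss : s ≤ s') : MeasurableSet[sigmaX G I] (hit G U s s') := by
  rw [hit_eq_hit2]
  exact measurableSet_hit2 hI hs hs' hss

end Meas

/-! ### The sequence of visited states -/

/-- `visits G t l s` is the event that the successive states of the path on `[t, s]` are the
entries of `l`, listed from the last one to the first one. A list `b :: b' :: l` is visited if
`b' :: l` is visited on `[t, q]` for some intermediate time `q`, and the path makes exactly one jump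
in `(q, s]`, from `b'` to `b`; the latter means that it starts in `b'`, ends in `b`, and that it is
never outside `b` once it has been outside `b'`. -/
def visits (G : SimpleGraph V) (t : ℝ) : List V → ℝ → Set (PathSpace G)
  | [], _ => ∅
  | [a], s => {ω | ∀ r, t ≤ r → r ≤ s → X r ω = a}
  | b :: b' :: l, s => {ω | b ≠ b' ∧ ∃ q, t ≤ q ∧ q ≤ s ∧ ω ∈ visits G t (b' :: l) q ∧
      X q ω = b' ∧ X s ω = b ∧ ω ∉ hit2 G {b'}ᶜ {b}ᶜ q s}

lemma visits_head {t s : ℝ} (hts : t ≤ s) {l : List V} {ω : PathSpace G}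
    (h : ω ∈ visits G t l s) : ∃ l', l = X s ω :: l' := by
  match l, h with
  | [a], h => exact ⟨[], by rw [h s hts le_rfl]⟩
  | b :: b' :: l, ⟨_, q, _, _, _, _, hb, _⟩ => exact ⟨b' :: l, by rw [hb]⟩

lemma X_of_visits {t s : ℝ} (hts : t ≤ s) {b : V} {l : List V} {ω : PathSpace G}
    (h : ω ∈ visits G t (b :: l) s) : X s ω = b := by
  obtain ⟨l', hl⟩ := visits_head hts h
  exact (List.cons.inj hl).1.symm

lemma visits_extend {t s s' : ℝ} (hss : s ≤ s') {b : V} {l : List V}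
    {ω : PathSpace G} (h : ω ∈ visits G t (b :: l) s) (hb : ∀ r, s ≤ r → r ≤ s' → X r ω = b) :
    ω ∈ visits G t (b :: l) s' := by
  match l, h with
  | [], h =>
    intro r h1 h2
    rcases le_total r s with h3 | h3
    · exact h r h1 h3
    · exact hb r h3 h2
  | b' :: l, ⟨hne, q, hq, hq', hv, hXq, hXs, hh⟩ =>
    refine ⟨hne, q, hq, hq'.trans hss, hv, hXq, hb s' hss le_rfl, ?_⟩
    rintro ⟨r₁, r₂, h1, h2, h3, h4, h5⟩
    rcases le_total r₂ s with h6 | h6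
    · exact hh ⟨r₁, r₂, h1, h2, h6, h4, h5⟩
    · exact h5 (hb r₂ h6 h3)

lemma visits_restrict {t s s' : ℝ} (hss : s ≤ s') {b : V} {l : List V}
    {ω : PathSpace G} (h : ω ∈ visits G t (b :: l) s') (hb : ∀ r, s ≤ r → r ≤ s' → X r ω = b) :
    ω ∈ visits G t (b :: l) s := by
  match l, h with
  | [], h => exact fun r h1 h2 => h r h1 (h2.trans hss)
  | b' :: l, ⟨hne, q, hq, hq', hv, hXq, hXs, hh⟩ =>
    have hqs : q ≤ s := by
      by_contra! h1
      exact hne ((hb q h1.le hq').symm.trans hXq)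
    exact ⟨hne, q, hq, hqs, hv, hXq, hb s le_rfl hss, fun h => hh (hit2_mono le_rfl hss h)⟩

lemma visits_cons {t s s' : ℝ} (hts : t ≤ s) (hss : s ≤ s') {b b' : V} {l : List V}
    {ω : PathSpace G} (hne : b ≠ b') (h : ω ∈ visits G t (b' :: l) s) (hb : X s' ω = b)
    (hh : ω ∉ hit2 G {b'}ᶜ {b}ᶜ s s') :
    ω ∈ visits G t (b :: b' :: l) s' :=
  ⟨hne, s, hts, hss, h, X_of_visits hts h, hb, hh⟩

lemma visits_tail {t s s' : ℝ} (hss : s ≤ s') {b b' : V} {l : List V}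
    {ω : PathSpace G} (hb' : X s ω = b') (hh : ω ∉ hit2 G {b'}ᶜ {b}ᶜ s s')
    (h : ω ∈ visits G t (b :: b' :: l) s') : ω ∈ visits G t (b' :: l) s := by
  obtain ⟨hne, q, hq, hq', hv, hXq, hXs, hh'⟩ := h
  rcases le_total q s with hqs | hqs
  · refine visits_extend hqs hv fun r h1 h2 => ?_
    by_contra h3
    exact hh' ⟨r, s, h1, h2, hss, h3, by simp [hb', hne.symm]⟩
  · refine visits_restrict hqs hv fun r h1 h2 => ?_
    by_contra h3
    exact hh ⟨r, q, h1, h2, hq', h3, by simp [hXq, hne.symm]⟩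

lemma hit2_of_visits {t s s' : ℝ} {b b' : V} {l : List V} {ω : PathSpace G} (hss : s ≤ s')
    (hb' : X s ω ≠ b') (hb : X s ω ≠ b) (h : ω ∈ visits G t (b :: b' :: l) s') :
    ω ∈ hit2 G {b'} {b} s s' := by
  obtain ⟨hne, q, hq, hq', hv, hXq, hXs, hh'⟩ := h
  rcases le_total q s with hqs | hqs
  · exact absurd ⟨s, s, hqs, le_rfl, hss, hb', hb⟩ hh'
  · exact ⟨q, s', hqs, hq', le_rfl, hXq, hXs⟩

lemma visits_unique {t : ℝ} {l : List V} : ∀ {l' : List V} {s : ℝ} {ω : PathSpace G}, t ≤ s →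
    ω ∈ visits G t l s → ω ∈ visits G t l' s → l = l' := by
  induction l with
  | nil => exact fun _ h => h.elim
  | cons b l ih =>
    intro l' s ω hts h h'
    match l, l', h, h' with
    | [], [c], h, h' => rw [← h s hts le_rfl, h' s hts le_rfl]
    | [], c :: c' :: m, h, ⟨hne, q, hq, hq', _, hXq, hXs, _⟩ =>
      exact absurd ((hXs.symm.trans (h s hts le_rfl)).trans
        ((h q hq hq').symm.trans hXq)) hne
    | b' :: l, [c], ⟨hne, q, hq, hq', _, hXq, hXs, _⟩, h =>
      exact absurd ((hXs.symm.trans (h s hts le_rfl)).trans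
        ((h q hq hq').symm.trans hXq)) hne
    | b' :: l, c :: c' :: m, ⟨hne, q, hq, hq', hv, hXq, hXs, hh⟩,
        ⟨hne2, q2, hq2, hq2', hv2, hXq2, hXs2, hh2⟩ =>
      obtain rfl : b = c := hXs.symm.trans hXs2
      rcases le_total q q2 with hle | hle
      · have hc : ∀ r, q ≤ r → r ≤ q2 → X r ω = b' := fun r h1 h2 => by
          by_contra h3
          exact hh ⟨r, q2, h1, h2, hq2', h3, by simp [hXq2, hne2.symm]⟩
        rw [ih hq2 (visits_extend hle hv hc) hv2]
      · have hc : ∀ r, q2 ≤ r → r ≤ q → X r ω = c' := fun r h1 h2 => by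
          by_contra h3
          exact hh2 ⟨r, q, h1, h2, hq', h3, by simp [hXq, hne.symm]⟩
        rw [ih hq hv (visits_extend hle hv2 hc)]

lemma exists_visits {t s : ℝ} (ht : 0 ≤ t) (hts : t ≤ s) (hs : s ≤ 1) (ω : PathSpace G) :
    ∃ l, ω ∈ visits G t l s := by
  let S : Set ℝ := {r | t ≤ r ∧ r ≤ s ∧ ∃ l, ω ∈ visits G t l r}
  have htS : t ∈ S := ⟨le_rfl, hts, [X t ω], fun r h1 h2 => by rw [le_antisymm h2 h1]⟩
  have hbdd : BddAbove S := ⟨s, fun r hr => hr.2.1⟩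
  have htm : t ≤ sSup S := le_csSup hbdd htS
  have hms : sSup S ≤ s := csSup_le ⟨t, htS⟩ fun r hr => hr.2.1
  have hmem : sSup S ∈ S := by
    rcases htm.eq_or_lt with h | h
    · rwa [← h]
    obtain ⟨ε, hε, -, a, ha, -⟩ := X_left ω (ht.trans_lt h) (hms.trans hs)
    obtain ⟨r, hr, hr'⟩ := exists_lt_of_lt_csSup ⟨t, htS⟩ (show sSup S - ε < sSup S by linarith)
    rcases (le_csSup hbdd hr).eq_or_lt with h2 | h2
    · rwa [← h2]
    obtain ⟨h3, h4, l, hl⟩ := hr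
    obtain ⟨l', rfl⟩ := visits_head h3 hl
    rw [ha r hr'.le h2] at hl
    refine ⟨htm, hms, ?_⟩
    by_cases hX : X (sSup S) ω = a
    · refine ⟨_, visits_extend h2.le hl fun r' h5 h6 => ?_⟩
      rcases h6.eq_or_lt with rfl | h6
      · exact hX
      · exact ha r' (hr'.le.trans h5) h6
    · refine ⟨_, visits_cons h3 h2.le hX hl rfl ?_⟩
      rintro ⟨r₁, r₂, h5, h6, h7, h8, h9⟩
      have h10 : r₂ < sSup S := lt_of_le_of_ne h7 fun e => h9 (by rw [e]; rfl)
      exact h8 (ha r₁ (hr'.le.trans h5) (h6.trans_lt h10))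
  rcases hms.eq_or_lt with h | h
  · rw [← h]; exact hmem.2.2
  · obtain ⟨ε, hε, hε1, hX⟩ := X_right ω (ht.trans htm) (h.trans_le hs)
    obtain ⟨-, -, l, hl⟩ := hmem
    obtain ⟨l', rfl⟩ := visits_head htm hl
    have hlt : sSup S < min (sSup S + ε / 2) s := lt_min (by linarith) h
    refine absurd (le_csSup hbdd (show min (sSup S + ε / 2) s ∈ S from
      ⟨htm.trans hlt.le, min_le_right _ _, _, visits_extend hlt.le hl fun r h1 h2 => ?_⟩))
      (not_le.2 hlt)
    exact hX r h1 (by linarith [h2.trans (min_le_left _ _)])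

lemma measurableSet_visits [MeasurableSpace V] [DiscreteMeasurableSpace V] {t : ℝ} (ht : 0 ≤ t)
    {l : List V} : ∀ {s : ℝ} {I : Set ℝ}, Set.Icc t s ⊆ I → t ≤ s → s ≤ 1 →
    MeasurableSet[sigmaX G I] (visits G t l s) := by
  induction l with
  | nil => intro s I _ _ _; exact @MeasurableSet.empty _ (sigmaX G I)
  | cons b l ih =>
    intro s I hI hts hs
    match l with
    | [] =>
      have e : visits G t [b] s = (hit G {b}ᶜ t s)ᶜ := by
        ext ω
        simp [hit, visits]
      rw [e]
      exact (measurableSet_hit hI ht hs hts).compl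
    | b' :: l =>
      by_cases hne : b = b'
      · convert @MeasurableSet.empty _ (sigmaX G I)
        ext ω
        simp [visits, hne]
      have e : visits G t (b :: b' :: l) s = ⋃ q ∈ rationalTimes t s,
          (visits G t (b' :: l) q ∩ {ω | X q ω = b'} ∩ {ω | X s ω = b} ∩
            (hit2 G {b'}ᶜ {b}ᶜ q s)ᶜ) := by
        ext ω
        simp only [Set.mem_iUnion, exists_prop]
        constructor
        · rintro ⟨-, q, hq, hq', hv, hXq, hXs, hh⟩
          have hqs : q < s := lt_of_le_of_ne hq' fun e => hne (by rw [← hXs, ← e, hXq])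
          obtain ⟨ε, hε, -, hX⟩ := X_right ω (ht.trans hq) (hqs.trans_le hs)
          obtain ⟨p, hp, hqp, hpm, e⟩ := exists_rationalTimes ω ht hs hq hq'
            (show q < min (q + ε) s from lt_min (by linarith) hqs)
          rw [lt_min_iff] at hpm
          exact ⟨p, hp, ⟨⟨visits_extend hqp hv fun r h1 h2 =>
            (hX r h1 (h2.trans_lt hpm.1)).trans hXq, e.trans hXq⟩, hXs⟩,
            fun h => hh (hit2_mono hqp le_rfl h)⟩
        · rintro ⟨q, hq, ⟨⟨hv, hXq⟩, hXs⟩, hh⟩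
          have := rationalTimes_subset hts hq
          exact ⟨hne, q, this.1, this.2, hv, hXq, hXs, hh⟩
      rw [e]
      refine MeasurableSet.biUnion (countable_rationalTimes _ _) fun q hq => ?_
      have hq := rationalTimes_subset hts hq
      exact (((ih ((Set.Icc_subset_Icc_right hq.2).trans hI) hq.1 (hq.2.trans hs)).inter
        (measurableSet_X_eq (hI hq) b')).inter (measurableSet_X_eq (hI ⟨hts, le_rfl⟩) b)).inter
        (measurableSet_hit2 ((Set.Icc_subset_Icc_left hq.1).trans hI) (ht.trans hq.1) hs
          hq.2).compl

end RandomWalk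

namespace RandomWalk

variable {V : Type*} {G : SimpleGraph V}

/-! ### Joint measurability of right-continuous processes -/

/-- A process that is locally constant to the right is jointly measurable. The σ-field is arbitrary,
so that the lemma applies to each `σ`-field of the canonical filtration. -/
lemma measurable_uncurry_of_rightConst {Ω : Type*} [MeasurableSpace Ω] (Y : ℝ → Ω → ℝ)
    (hm : ∀ r, Measurable (Y r)) (hr : ∀ ω r, ∀ᶠ s in 𝓝[>] r, Y s ω = Y r ω) :
    Measurable (Function.uncurry Y) := by
  let a : ℕ → ℝ → ℝ := fun N r => ((⌊r * (N + 1)⌋ : ℝ) + 1) / (N + 1)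
  have ha : ∀ r, Tendsto (fun N => a N r) atTop (𝓝[>] r) := by
    intro r
    have h1 : ∀ N : ℕ, r < a N r := fun N => by
      have hN : (0 : ℝ) < N + 1 := by positivity
      rw [lt_div_iff₀ hN]
      exact Int.lt_floor_add_one _
    have h2 : ∀ N : ℕ, a N r ≤ r + 1 / (N + 1) := fun N => by
      have hN : (0 : ℝ) < N + 1 := by positivity
      rw [div_le_iff₀ hN, add_mul, one_div, inv_mul_cancel₀ hN.ne']
      linarith [Int.floor_le (r * ((N : ℝ) + 1))]
    refine tendsto_nhdsWithin_iff.2 ⟨?_, Eventually.of_forall h1⟩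
    refine tendsto_of_tendsto_of_tendsto_of_le_of_le tendsto_const_nhds ?_
      (fun N => (h1 N).le) h2
    simpa using tendsto_const_nhds.add (tendsto_one_div_add_atTop_nhds_zero_nat (𝕜 := ℝ))
  refine measurable_of_tendsto_metrizable (f := fun N p => Y (a N p.1) p.2) (fun N => ?_) ?_
  · have h1 : Measurable (fun p : ℤ × Ω => Y (((p.1 : ℝ) + 1) / (N + 1)) p.2) :=
      measurable_from_prod_countable_right fun i => hm (((i : ℝ) + 1) / (N + 1))
    have h2 : Measurable (fun p : ℝ × Ω => (⌊p.1 * ((N : ℝ) + 1)⌋, p.2)) :=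
      ((Int.measurable_floor.comp (measurable_fst.mul_const _)).prodMk measurable_snd)
    exact h1.comp h2
  · rw [tendsto_pi_nhds]
    rintro ⟨r, ω⟩
    exact tendsto_const_nhds.congr' (((ha r).eventually (hr ω r)).mono fun N h => h.symm)

lemma eventually_X_eq (ω : PathSpace G) (r : ℝ) : ∀ᶠ s in 𝓝[>] r, X s ω = X r ω := by
  rcases lt_or_ge r 0 with h | h
  · filter_upwards [Ioo_mem_nhdsGT h] with s hs
    unfold X
    rw [Set.projIcc_of_le_left _ hs.2.le, Set.projIcc_of_le_left _ h.le]
  rcases lt_or_ge r 1 with h1 | h1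
  · obtain ⟨ε, hε, -, hX⟩ := X_right ω h h1
    filter_upwards [Ioo_mem_nhdsGT (show r < r + ε by linarith)] with s hs
    exact hX s hs.1.le hs.2
  · filter_upwards [self_mem_nhdsWithin] with s hs
    unfold X
    rw [Set.projIcc_of_right_le _ (h1.trans (le_of_lt hs)), Set.projIcc_of_right_le _ h1]

lemma tendsto_X_one (ω : PathSpace G) : ∀ᶠ s in 𝓝[<] (1 : ℝ), X s ω = X 1 ω := by
  obtain ⟨ε, hε, -, a, ha, h | h⟩ := X_left ω one_pos le_rfl
  · filter_upwards [Ioo_mem_nhdsLT (show 1 - ε < 1 by linarith)] with s hs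
    rw [ha s hs.1.le hs.2, h]
  · exact absurd h.1 (lt_irrefl _)

section Generator

variable [G.LocallyFinite] {k : ℝ → V → V → ℝ}

/-! ### Intensities that are continuous in time -/

/-- The rates `t ↦ k t z z'` along the arcs are continuous on `[0, 1)`. -/
def ContinuousRates (G : SimpleGraph V) (k : ℝ → V → V → ℝ) : Prop :=
  ∀ z z', G.Adj z z' → ContinuousOn (fun t => k t z z') (Set.Ico 0 1)

lemma ContinuousRates.generator (hk : ContinuousRates G k) (u : V → ℝ) (z : V) :
    ContinuousOn (fun t => generator G k t u z) (Set.Ico 0 1) :=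
  continuousOn_finsetSum _ fun z' hz' =>
    (hk z z' ((G.mem_neighborFinset _ _).1 hz')).mul continuousOn_const

lemma ContinuousRates.totalRate (hk : ContinuousRates G k) (z : V) :
    ContinuousOn (fun t => totalRate G k t z) (Set.Ico 0 1) :=
  continuousOn_finsetSum _ fun z' hz' => hk z z' ((G.mem_neighborFinset _ _).1 hz')

lemma exists_generator_support (u : V →₀ ℝ) :
    ∃ F : Finset V, ∀ z ∉ F, ∀ (k : ℝ → V → V → ℝ) (t : ℝ), generator G k t u z = 0 := by
  classical
  refine ⟨u.support ∪ u.support.biUnion fun z => G.neighborFinset z, fun z hz k t => ?_⟩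
  simp only [Finset.mem_union, Finset.mem_biUnion, not_or, not_exists, not_and] at hz
  refine Finset.sum_eq_zero fun z' hz' => ?_
  have h1 : u z = 0 := by simpa using hz.1
  have h2 : u z' = 0 := by
    by_contra h
    exact hz.2 z' (by simpa using h) (by
      rw [SimpleGraph.mem_neighborFinset] at hz' ⊢
      exact hz'.symm)
  rw [h1, h2, sub_zero, mul_zero]

lemma ContinuousRates.exists_bound (hk : ContinuousRates G k) (u : V →₀ ℝ) {S : ℝ} (hS : S < 1) :
    ∃ c, 0 ≤ c ∧ ∀ r, 0 ≤ r → r ≤ S → ∀ z, |RandomWalk.generator G k r u z| ≤ c := by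
  obtain ⟨F, hF⟩ := exists_generator_support (G := G) u
  have h : ∀ z, ∃ c, 0 ≤ c ∧ ∀ r ∈ Set.Icc 0 S, |RandomWalk.generator G k r u z| ≤ c := by
    intro z
    obtain ⟨c, hc⟩ := isCompact_Icc.exists_bound_of_continuousOn
      ((hk.generator u z).mono (Set.Icc_subset_Ico_right hS))
    exact ⟨max c 0, le_max_right _ _, fun r hr => (hc r hr).trans (le_max_left _ _)⟩
  choose c hc0 hc using h
  refine ⟨∑ z ∈ F, c z, Finset.sum_nonneg fun z _ => hc0 z, fun r h0 h1 z => ?_⟩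
  by_cases hz : z ∈ F
  · exact (hc z r ⟨h0, h1⟩).trans (Finset.single_le_sum (fun z _ => hc0 z) hz)
  · rw [hF z hz, abs_zero]
    exact Finset.sum_nonneg fun z _ => hc0 z

lemma measurable_X_indicator (ω : PathSpace G) (w : V) : MeasurableSet {r : ℝ | X r ω = w} := by
  classical
  have h := measurable_uncurry_of_rightConst (Ω := Unit)
    (fun r _ => if X r ω = w then (1 : ℝ) else 0) (fun r => measurable_const) (fun _ r => by
      filter_upwards [eventually_X_eq ω r] with s hs
      rw [hs])
  have h2 := (h.comp (measurable_id.prodMk measurable_const : Measurable fun r : ℝ => (r, ())))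
    (measurableSet_singleton (1 : ℝ))
  convert h2 using 1
  ext r
  by_cases hr : X r ω = w <;> simp [Function.uncurry, hr]

lemma generator_X_eq_sum {F : Finset V} {f : ℝ → V → ℝ} (hF : ∀ z ∉ F, ∀ r, f r z = 0) (r : ℝ)
    (ω : PathSpace G) :
    f r (X r ω) = ∑ w ∈ F, {r : ℝ | X r ω = w}.indicator (fun r => f r w) r := by
  classical
  by_cases h : X r ω ∈ F
  · rw [Finset.sum_eq_single_of_mem _ h]
    · simp [Set.indicator]
    · intro w _ hw
      simp [Set.indicator, hw.symm]
  · rw [hF _ h, Finset.sum_eq_zero]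
    intro w hw
    have : X r ω ≠ w := fun e => h (e ▸ hw)
    simp [Set.indicator, this]

lemma ContinuousRates.integrableOn (hk : ContinuousRates G k) (u : V →₀ ℝ) (ω : PathSpace G)
    {S : ℝ} (hS : S < 1) :
    IntegrableOn (fun r => RandomWalk.generator G k r u (X r ω)) (Set.Icc 0 S) := by
  obtain ⟨F, hF⟩ := exists_generator_support (G := G) u
  simp_rw [generator_X_eq_sum (f := fun r z => RandomWalk.generator G k r u z)
    (fun z hz r => hF z hz k r)]
  refine integrable_finsetSum _ fun w _ => ?_
  refine Integrable.indicator ?_ (measurable_X_indicator ω w)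
  exact (((hk.generator u w).mono (Set.Icc_subset_Ico_right hS)).integrableOn_Icc)

lemma ContinuousRates.intervalIntegrable (hk : ContinuousRates G k) (u : V →₀ ℝ)
    (ω : PathSpace G) {a b : ℝ} (ha : 0 ≤ a) (hab : a ≤ b) (hb : b < 1) :
    IntervalIntegrable (fun r => RandomWalk.generator G k r u (X r ω)) volume a b := by
  rw [intervalIntegrable_iff_integrableOn_Icc_of_le hab]
  exact (hk.integrableOn u ω hb).mono_set (Set.Icc_subset_Icc_left ha)

lemma ContinuousRates.hasDerivWithinAt (hk : ContinuousRates G k) (u : V →₀ ℝ)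
    (ω : PathSpace G) {s : ℝ} (hs : 0 ≤ s) (hs1 : s < 1) :
    HasDerivWithinAt (fun r => ∫ q in s..r, RandomWalk.generator G k q u (X q ω))
      (RandomWalk.generator G k s u (X s ω)) (Set.Ici s) s := by
  have hmid : s < (s + 1) / 2 := by linarith
  refine intervalIntegral.integral_hasDerivWithinAt_right (t := Set.Ioi s)
    (hk.intervalIntegrable u ω hs le_rfl hs1) ?_ ?_
  · refine ⟨Set.Ioo s ((s + 1) / 2), Ioo_mem_nhdsGT hmid, ?_⟩
    refine ((hk.integrableOn u ω (show (s + 1) / 2 < 1 by linarith)).mono_set ?_).1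
    exact fun r hr => ⟨hs.trans hr.1.le, hr.2.le⟩
  · have h1 : ContinuousWithinAt (fun q => RandomWalk.generator G k q u (X s ω)) (Set.Ioi s) s := by
      refine ((hk.generator u (X s ω)) s ⟨hs, hs1⟩).mono_of_mem_nhdsWithin ?_
      filter_upwards [Ioo_mem_nhdsGT hs1] with q hq
      exact ⟨hs.trans hq.1.le, hq.2⟩
    refine h1.congr_of_eventuallyEq ?_ rfl
    filter_upwards [eventually_X_eq ω s] with q hq
    rw [hq]

variable [Countable V] [MeasurableSpace V] [DiscreteMeasurableSpace V]
variable {Q : Measure (PathSpace G)} [IsProbabilityMeasure Q]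

lemma integrable_comp_X (u : V →₀ ℝ) (s : ℝ) : Integrable (fun ω => u (X s ω)) Q := by
  have hm : Measurable (fun ω : PathSpace G => u (X s ω)) :=
    (measurable_of_countable (fun z => u z)).comp (measurable_X s)
  obtain ⟨C, hC⟩ := (u.finite_range).isBounded.exists_norm_le
  exact Integrable.of_bound hm.aestronglyMeasurable C
    (Eventually.of_forall fun ω => hC _ ⟨_, rfl⟩)

lemma setIntegral_comp_X {F : Finset V} {f : V → ℝ} (hF : ∀ z ∉ F, f z = 0) (s : ℝ)
    (D : Set (PathSpace G)) :
    ∫ ω in D, f (X s ω) ∂Q = ∑ w ∈ F, f w * Q.real (D ∩ {ω | X s ω = w}) := by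
  have h : ∀ ω : PathSpace G, f (X s ω) = ∑ w ∈ F, {ω | X s ω = w}.indicator (fun _ => f w) ω := by
    classical
    intro ω
    by_cases h : X s ω ∈ F
    · rw [Finset.sum_eq_single_of_mem _ h]
      · simp [Set.indicator]
      · intro w _ hw
        simp [Set.indicator, hw.symm]
    · rw [hF _ h, Finset.sum_eq_zero]
      intro w hw
      have : X s ω ≠ w := fun e => h (e ▸ hw)
      simp [Set.indicator, this]
  simp_rw [h]
  rw [integral_finsetSum _ fun w _ =>
    (integrable_const _).indicator (measurableSet_X_eq' s w)]
  refine Finset.sum_congr rfl fun w _ => ?_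
  rw [setIntegral_indicator (measurableSet_X_eq' s w), setIntegral_const, smul_eq_mul, mul_comm]

lemma real_inter_X_eq (b : V) (s : ℝ) (D : Set (PathSpace G)) :
    Q.real (D ∩ {ω | X s ω = b}) = ∫ ω in D, (Finsupp.single b (1 : ℝ)) (X s ω) ∂Q := by
  classical
  rw [setIntegral_comp_X (F := {b}) (f := Finsupp.single b (1 : ℝ)) _ s D]
  · simp
  · intro z hz
    rw [Finsupp.single_apply, if_neg]
    simpa [eq_comm] using hz

lemma stronglyMeasurable_intervalIntegral_sum {Ω ι : Type*} [MeasurableSpace Ω] (F : Finset ι)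
    (Y : ι → ℝ → Ω → ℝ) (g : ι → ℝ → ℝ) (hm : ∀ i r, Measurable (Y i r))
    (hr : ∀ i ω r, ∀ᶠ s in 𝓝[>] r, Y i s ω = Y i r ω) (hg : ∀ i, Continuous (g i)) (a b : ℝ) :
    StronglyMeasurable fun ω => ∫ r in a..b, ∑ i ∈ F, Y i r ω * g i r := by
  have h : StronglyMeasurable (Function.uncurry fun r ω => ∑ i ∈ F, Y i r ω * g i r) := by
    refine Measurable.stronglyMeasurable ?_
    refine Finset.measurable_sum (f := fun i (p : ℝ × Ω) => Y i p.1 p.2 * g i p.1) F fun i _ => ?_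
    exact (measurable_uncurry_of_rightConst (Y i) (hm i) (hr i)).mul
      ((hg i).measurable.comp measurable_fst)
  simp only [intervalIntegral]
  exact h.integral_prod_left.sub h.integral_prod_left

lemma X_max_zero (r : ℝ) : X (G := G) (max 0 r) = X r := by
  ext ω
  simp only [X]
  refine congrArg ω.1 (Subtype.ext ?_)
  simp only [Set.coe_projIcc]
  rcases le_total 0 r with h | h
  · rw [max_eq_right h]
  · rw [max_eq_left h, min_eq_right zero_le_one, min_eq_right (h.trans zero_le_one), max_eq_left h,
      max_self]

lemma ContinuousRates.stronglyMeasurable_integral (hk : ContinuousRates G k) (u : V →₀ ℝ)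
    {a b : ℝ} (ha : 0 ≤ a) (hab : a ≤ b) (hb : b < 1) :
    StronglyMeasurable[sigmaX G (Set.Icc 0 b)]
      fun ω => ∫ r in a..b, RandomWalk.generator G k r u (X r ω) := by
  classical
  obtain ⟨F, hF⟩ := exists_generator_support (G := G) u
  have hsub : Set.Icc a b ⊆ Set.Ico 0 1 := fun r hr => ⟨ha.trans hr.1, hr.2.trans_lt hb⟩
  have h := @stronglyMeasurable_intervalIntegral_sum (PathSpace G) V (sigmaX G (Set.Icc 0 b)) F
    (fun w r ω => if X (min r b) ω = w then 1 else 0)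
    (fun w => Set.IccExtend hab ((Set.Icc a b).domRestrict fun r =>
      RandomWalk.generator G k r u w)) (fun w r => ?_) (fun w ω r => ?_)
    (fun w => (continuousOn_iff_continuous_domRestrict.1
      ((hk.generator u w).mono hsub)).Icc_extend') a b
  · convert h using 2 with ω
    refine intervalIntegral.integral_congr fun r hr => ?_
    rw [Set.uIcc_of_le hab] at hr
    simp only [min_eq_left hr.2]
    rw [generator_X_eq_sum (f := fun r z => RandomWalk.generator G k r u z)
      (fun z hz r => hF z hz k r)]
    refine Finset.sum_congr rfl fun w _ => ?_
    rw [Set.IccExtend_of_mem _ _ hr]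
    simp [Set.indicator, Set.domRestrict]
  · have h1 := measurableSet_X_eq (G := G) (I := Set.Icc 0 b) (r := max 0 (min r b))
      ⟨le_max_left _ _, max_le (ha.trans hab) (min_le_right _ _)⟩ w
    rw [X_max_zero] at h1
    exact Measurable.ite h1 measurable_const measurable_const
  · rcases lt_or_ge r b with h | h
    · filter_upwards [eventually_X_eq ω r, Ioo_mem_nhdsGT h] with s hs hs'
      rw [min_eq_left hs'.2.le, min_eq_left h.le, hs]
    · filter_upwards [self_mem_nhdsWithin] with s hs
      rw [min_eq_right h, min_eq_right (h.trans (le_of_lt hs))]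

lemma ContinuousRates.abs_integral_le {u : V →₀ ℝ} {S c : ℝ}
    (hc : ∀ r, 0 ≤ r → r ≤ S → ∀ z, |RandomWalk.generator G k r u z| ≤ c)
    {s s' : ℝ} (hs : 0 ≤ s) (hss : s ≤ s') (hs' : s' ≤ S) (ω : PathSpace G) :
    ‖∫ r in s..s', RandomWalk.generator G k r u (X r ω)‖ ≤ c * (s' - s) := by
  rw [← abs_of_nonneg (sub_nonneg.2 hss)]
  refine intervalIntegral.norm_integral_le_of_norm_le_const fun r hr => ?_
  rw [Set.uIoc_of_le hss] at hr
  exact hc r (hs.trans hr.1.le) (hr.2.trans hs') _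

lemma ContinuousRates.integrable_integral (hk : ContinuousRates G k) (u : V →₀ ℝ)
    {a b : ℝ} (ha : 0 ≤ a) (hab : a ≤ b) (hb : b < 1) :
    Integrable (fun ω => ∫ r in a..b, RandomWalk.generator G k r u (X r ω)) Q := by
  obtain ⟨c, hc0, hc⟩ := hk.exists_bound u hb
  exact Integrable.of_bound
    ((hk.stronglyMeasurable_integral u ha hab hb).mono (sigmaX_le _)).aestronglyMeasurable
    (c * (b - a)) (Eventually.of_forall fun ω => ContinuousRates.abs_integral_le hc ha hab le_rfl ω)

lemma ContinuousRates.hasDerivWithinAt_setIntegral (hk : ContinuousRates G k) (u : V →₀ ℝ)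
    {s : ℝ} (hs : 0 ≤ s) (hs1 : s < 1) (D : Set (PathSpace G)) :
    HasDerivWithinAt (fun s' => ∫ ω in D, (∫ r in s..s', RandomWalk.generator G k r u (X r ω)) ∂Q)
      (∫ ω in D, RandomWalk.generator G k s u (X s ω) ∂Q) (Set.Ici s) s := by
  have hmid : s < (s + 1) / 2 := by linarith
  obtain ⟨c, hc0, hc⟩ := hk.exists_bound u (show (s + 1) / 2 < 1 by linarith)
  rw [hasDerivWithinAt_iff_tendsto_slope, Set.Ici_sdiff_left]
  have key : Tendsto (fun s' => ∫ ω in D, (s' - s)⁻¹ *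
      (∫ r in s..s', RandomWalk.generator G k r u (X r ω)) ∂Q) (𝓝[>] s)
      (𝓝 (∫ ω in D, RandomWalk.generator G k s u (X s ω) ∂Q)) := by
    refine tendsto_integral_filter_of_dominated_convergence (fun _ => c) ?_ ?_
      (integrable_const _) ?_
    · filter_upwards [Ioo_mem_nhdsGT hs1] with s' hs'
      exact ((hk.integrable_integral u hs hs'.1.le hs'.2).const_mul _).1.restrict
    · filter_upwards [Ioo_mem_nhdsGT hmid] with s' hs'
      refine Eventually.of_forall fun ω => ?_
      have hp : 0 < s' - s := sub_pos.2 hs'.1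
      rw [norm_mul, norm_inv, Real.norm_of_nonneg hp.le, inv_mul_le_iff₀ hp, mul_comm (s' - s)]
      exact ContinuousRates.abs_integral_le hc hs hs'.1.le hs'.2.le ω
    · refine Eventually.of_forall fun ω => ?_
      have h := hk.hasDerivWithinAt u ω hs hs1
      rw [hasDerivWithinAt_iff_tendsto_slope, Set.Ici_sdiff_left] at h
      refine h.congr fun s' => ?_
      rw [slope_def_field, intervalIntegral.integral_same, sub_zero, div_eq_inv_mul]
  refine key.congr fun s' => ?_
  rw [slope_def_field, integral_const_mul, div_eq_inv_mul]
  simp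

lemma ContinuousRates.integral_sub (hk : ContinuousRates G k) (u : V →₀ ℝ) (ω : PathSpace G)
    {s s' : ℝ} (hs : 0 ≤ s) (hss : s ≤ s') (hs' : s' < 1) :
    (∫ r in (0 : ℝ)..s', RandomWalk.generator G k r u (X r ω)) -
      ∫ r in (0 : ℝ)..s, RandomWalk.generator G k r u (X r ω) =
      ∫ r in s..s', RandomWalk.generator G k r u (X r ω) :=
  intervalIntegral.integral_interval_sub_left
    (hk.intervalIntegrable u ω le_rfl (hs.trans hss) hs')
    (hk.intervalIntegrable u ω le_rfl hs (hss.trans_lt hs'))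

/-- The martingale property, between the times `s` and `s'`. -/
lemma HasIntensity.forward (hQ : HasIntensity Q k) (hk : ContinuousRates G k) (u : V →₀ ℝ)
    {s s' : ℝ} (hs : 0 ≤ s) (hss : s ≤ s') (hs' : s' < 1) {D : Set (PathSpace G)}
    (hD : MeasurableSet[sigmaX G (Set.Icc 0 s)] D) :
    ∫ ω in D, u (X s' ω) ∂Q - ∫ ω in D, u (X s ω) ∂Q =
      ∫ ω in D, (∫ r in s..s', RandomWalk.generator G k r u (X r ω)) ∂Q := by
  have hs1 : s < 1 := hss.trans_lt hs'
  have e := (hQ u).setIntegral_eq (i := ⟨s, hs, hs1⟩) (j := ⟨s', hs.trans hss, hs'⟩) hss hD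
  have h1 := (integrable_comp_X (Q := Q) u s).integrableOn (s := D)
  have h2 := (integrable_comp_X (Q := Q) u s').integrableOn (s := D)
  have h3 := (hk.integrable_integral (Q := Q) u le_rfl hs hs1).integrableOn (s := D)
  have h4 := (hk.integrable_integral (Q := Q) u le_rfl (hs.trans hss) hs').integrableOn (s := D)
  rw [MeasureTheory.integral_sub h1 h3, MeasureTheory.integral_sub h2 h4] at e
  simp_rw [← hk.integral_sub u _ hs hss hs']
  rw [MeasureTheory.integral_sub h4 h3]
  linarith

lemma HasIntensity.abs_le (hQ : HasIntensity Q k) (hk : ContinuousRates G k) (u : V →₀ ℝ)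
    {S c : ℝ} (hS : S < 1)
    (hc : ∀ r, 0 ≤ r → r ≤ S → ∀ z, |RandomWalk.generator G k r u z| ≤ c)
    {s s' : ℝ} (hs : 0 ≤ s) (hss : s ≤ s') (hs' : s' ≤ S) {D : Set (PathSpace G)}
    (hD : MeasurableSet[sigmaX G (Set.Icc 0 s)] D) :
    |∫ ω in D, u (X s' ω) ∂Q - ∫ ω in D, u (X s ω) ∂Q| ≤ c * (s' - s) * Q.real D := by
  rw [hQ.forward hk u hs hss (hs'.trans_lt hS) hD, ← Real.norm_eq_abs]
  exact norm_setIntegral_le_of_norm_le_const (measure_lt_top Q D) fun ω _ =>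
    ContinuousRates.abs_integral_le hc hs hss hs' ω

/-- The forward equation: the right derivative of `s ↦ ∫_D u(X_s) dQ` at a time `s` for which `D`
belongs to the past of `s`. -/
lemma HasIntensity.hasDerivWithinAt (hQ : HasIntensity Q k) (hk : ContinuousRates G k)
    (u : V →₀ ℝ) {s : ℝ} (hs : 0 ≤ s) (hs1 : s < 1) {D : Set (PathSpace G)}
    (hD : MeasurableSet[sigmaX G (Set.Icc 0 s)] D) :
    HasDerivWithinAt (fun s' => ∫ ω in D, u (X s' ω) ∂Q)
      (∫ ω in D, RandomWalk.generator G k s u (X s ω) ∂Q) (Set.Ici s) s := by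
  refine ((hk.hasDerivWithinAt_setIntegral u hs hs1 D).const_add
    (∫ ω in D, u (X s ω) ∂Q)).congr_of_eventuallyEq ?_ (by simp)
  filter_upwards [Ico_mem_nhdsGE hs1] with s' hs'
  linarith [hQ.forward hk u hs hs'.1 hs'.2 hD]

/-! ### Bounds for the probability to enter a set of states -/

/-- The probability to be in `U` a short time after having been outside `U` is at most `c` times
the time elapsed, uniformly in the past, up to the time `S`. -/
def EntryBound (Q : Measure (PathSpace G)) (S : ℝ) (U : Set V) (c : ℝ) : Prop :=
  ∀ r r', 0 ≤ r → r ≤ r' → r' ≤ S → ∀ D, MeasurableSet[sigmaX G (Set.Icc 0 r)] D →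
    (∀ ω ∈ D, X r ω ∉ U) → Q.real (D ∩ {ω | X r' ω ∈ U}) ≤ c * (r' - r) * Q.real D

lemma HasIntensity.entryBound_of_eq_ite (hQ : HasIntensity Q k) (hk : ContinuousRates G k)
    {S : ℝ} (hS : S < 1) (u : V →₀ ℝ) (U : Set V) (α β : ℝ) (hαβ : |α - β| = 1)
    (hα : ∀ z ∈ U, u z = α) (hβ : ∀ z ∉ U, u z = β) : ∃ c, 0 ≤ c ∧ EntryBound Q S U c := by
  obtain ⟨c, hc0, hc⟩ := hk.exists_bound u hS
  refine ⟨c, hc0, fun r r' hr hrr hr' D hD hDU => ?_⟩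
  have hD' := sigmaX_le _ _ hD
  refine le_trans (le_of_eq ?_) (hQ.abs_le hk u hS hc hr hrr hr' hD)
  rw [← integral_sub (integrable_comp_X u r').integrableOn (integrable_comp_X u r).integrableOn]
  have : ∀ ω ∈ D, u (X r' ω) - u (X r ω) =
      {ω | X r' ω ∈ U}.indicator (fun _ => α - β) ω := by
    intro ω hω
    rw [hβ _ (hDU ω hω)]
    by_cases h : X r' ω ∈ U
    · simp [Set.indicator, h, hα _ h]
    · simp [Set.indicator, h, hβ _ h]
  rw [setIntegral_congr_fun hD' this, setIntegral_indicator (measurableSet_X_mem' r' U),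
    setIntegral_const, smul_eq_mul, abs_mul, hαβ, mul_one, abs_of_nonneg measureReal_nonneg]

lemma HasIntensity.entryBound_finite (hQ : HasIntensity Q k) (hk : ContinuousRates G k)
    {S : ℝ} (hS : S < 1) {U : Set V} (hU : U.Finite) : ∃ c, 0 ≤ c ∧ EntryBound Q S U c := by
  classical
  refine hQ.entryBound_of_eq_ite hk hS (Finsupp.indicator hU.toFinset fun _ _ => 1) U 1 0 (by simp)
    (fun z hz => ?_) (fun z hz => ?_)
  · simp [Finsupp.indicator_apply, hz]
  · simp [Finsupp.indicator_apply, hz]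

lemma HasIntensity.entryBound_cofinite (hQ : HasIntensity Q k) (hk : ContinuousRates G k)
    {S : ℝ} (hS : S < 1) {U : Set V} (hU : Uᶜ.Finite) : ∃ c, 0 ≤ c ∧ EntryBound Q S U c := by
  classical
  refine hQ.entryBound_of_eq_ite hk hS (Finsupp.indicator hU.toFinset fun _ _ => 1) U 0 1 (by simp)
    (fun z hz => ?_) (fun z hz => ?_)
  · simp [Finsupp.indicator_apply, hz]
  · simp [Finsupp.indicator_apply, hz]

lemma real_inter_le_of_finset {C : Set ℝ} (hC : C.Countable) (hne : C.Nonempty)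
    {E D : Set (PathSpace G)} {p : Finset ℝ → Set (PathSpace G)} (hp : Monotone p)
    (hE : ∀ ω ∈ E, ∃ F : Finset ℝ, ↑F ⊆ C ∧ ω ∈ p F) {c : ℝ}
    (h : ∀ F : Finset ℝ, ↑F ⊆ C → Q.real (D ∩ p F) ≤ c) : Q.real (D ∩ E) ≤ c := by
  classical
  obtain ⟨e, rfl⟩ := hC.exists_eq_range hne
  let q : ℕ → Set (PathSpace G) := fun N => D ∩ p ((Finset.range N).image e)
  have hq : Monotone q := fun N M hNM => Set.inter_subset_inter_right _
    (hp (Finset.image_subset_image (Finset.range_subset_range.2 hNM)))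
  have hc : 0 ≤ c := measureReal_nonneg.trans (h ∅ (by simp))
  have hsub : D ∩ E ⊆ ⋃ N, q N := by
    rintro ω ⟨h1, h2⟩
    obtain ⟨F, hF, hω⟩ := hE ω h2
    obtain ⟨F', -, rfl⟩ := Finset.subset_set_image_iff.1
      (Set.image_univ.symm ▸ hF : (F : Set ℝ) ⊆ e '' Set.univ)
    obtain ⟨N, hN⟩ := F'.exists_nat_subset_range
    exact Set.mem_iUnion.2 ⟨N, h1, hp (Finset.image_subset_image hN) hω⟩
  refine ENNReal.toReal_le_of_le_ofReal hc ((measure_mono hsub).trans ?_)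
  rw [hq.directed_le.measure_iUnion]
  refine iSup_le fun N => ?_
  rw [← ENNReal.ofReal_toReal (measure_ne_top Q (q N))]
  exact ENNReal.ofReal_le_ofReal (h _ (by simp))

lemma EntryBound.finset_hit {S c : ℝ} {U : Set V} (hU : EntryBound Q S U c) (hc : 0 ≤ c)
    {s' : ℝ} (hs' : s' ≤ S) (F : Finset ℝ) :
    ∀ {s : ℝ} {D : Set (PathSpace G)}, 0 ≤ s → s ≤ s' → (∀ r ∈ F, s ≤ r ∧ r ≤ s') →
    MeasurableSet[sigmaX G (Set.Icc 0 s)] D → (∀ ω ∈ D, X s ω ∉ U) →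
    Q.real (D ∩ {ω | ∃ r ∈ F, X r ω ∈ U}) ≤ c * (s' - s) * Q.real D := by
  induction F using Finset.induction_on_min with
  | empty =>
    intro s D hs hss _ _ _
    simp only [Finset.notMem_empty, false_and, exists_false, Set.ofPred_false, Set.inter_empty,
      measureReal_empty]
    have := sub_nonneg.2 hss
    positivity
  | insert m F hm ih =>
    intro s D hs hss hF hD hDU
    have hsm := hF m (Finset.mem_insert_self _ _)
    have hsub : D ∩ {ω | ∃ r ∈ insert m F, X r ω ∈ U} ⊆ (D ∩ {ω | X m ω ∈ U}) ∪
        ((D ∩ {ω | X m ω ∈ Uᶜ}) ∩ {ω | ∃ r ∈ F, X r ω ∈ U}) := by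
      rintro ω ⟨h1, r, h2, h3⟩
      by_cases h4 : X m ω ∈ U
      · exact Or.inl ⟨h1, h4⟩
      · refine Or.inr ⟨⟨h1, h4⟩, r, (Finset.mem_insert.1 h2).resolve_left ?_, h3⟩
        rintro rfl
        exact h4 h3
    have h1 := hU s m hs hsm.1 (hsm.2.trans hs') D hD hDU
    have h2 := ih (D := D ∩ {ω | X m ω ∈ Uᶜ}) (hs.trans hsm.1) hsm.2
      (fun r hr => ⟨(hm r hr).le, (hF r (Finset.mem_insert_of_mem hr)).2⟩)
      ((sigmaX_mono (Set.Icc_subset_Icc_right hsm.1) _ hD).inter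
        (measurableSet_X_mem (Set.right_mem_Icc.2 (hs.trans hsm.1)) _)) (fun ω hω => hω.2)
    have h3 : Q.real (D ∩ {ω | X m ω ∈ Uᶜ}) ≤ Q.real D := measureReal_mono Set.inter_subset_left
    have h4 : c * (s' - m) * Q.real (D ∩ {ω | X m ω ∈ Uᶜ}) ≤ c * (s' - m) * Q.real D :=
      mul_le_mul_of_nonneg_left h3 (mul_nonneg hc (sub_nonneg.2 hsm.2))
    calc _ ≤ _ := measureReal_mono hsub
      _ ≤ _ := measureReal_union_le _ _
      _ ≤ c * (m - s) * Q.real D + c * (s' - m) * Q.real D := add_le_add h1 (h2.trans h4)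
      _ = _ := by ring

lemma EntryBound.hit {S c : ℝ} {U : Set V} (hU : EntryBound Q S U c) (hc : 0 ≤ c) {s s' : ℝ}
    (hs : 0 ≤ s) (hss : s ≤ s') (hs' : s' ≤ S) (hS : S < 1) {D : Set (PathSpace G)}
    (hD : MeasurableSet[sigmaX G (Set.Icc 0 s)] D) (hDU : ∀ ω ∈ D, X s ω ∉ U) :
    Q.real (D ∩ RandomWalk.hit G U s s') ≤ c * (s' - s) * Q.real D := by
  refine real_inter_le_of_finset (countable_rationalTimes s s') ⟨s', Set.mem_insert _ _⟩
    (p := fun F => {ω | ∃ r ∈ F, X r ω ∈ U}) (fun F F' h ω ⟨r, hr, h'⟩ => ⟨r, h hr, h'⟩)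
    (fun ω hω => ?_) (fun F hF => hU.finset_hit hc hs' F hs hss
      (fun r hr => rationalTimes_subset hss (hF hr)) hD hDU)
  rw [hit_eq_hit2, mem_hit2_iff hs (hs'.trans hS.le) ω hss] at hω
  obtain ⟨r, hr, -, -, -, h, -⟩ := hω
  exact ⟨{r}, by simpa using hr, r, by simp, h⟩

lemma EntryBound.finset_hit2 {S c₁ c₂ : ℝ} {U₁ U₂ : Set V} (hU₁ : EntryBound Q S U₁ c₁)
    (hU₂ : EntryBound Q S U₂ c₂) (hc₁ : 0 ≤ c₁) (hc₂ : 0 ≤ c₂) (hdis : Disjoint U₁ U₂)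
    {s₀ s' : ℝ} (hs' : s' ≤ S) (F : Finset ℝ) :
    ∀ {s : ℝ} {D : Set (PathSpace G)}, 0 ≤ s → s₀ ≤ s → s ≤ s' → (∀ r ∈ F, s ≤ r ∧ r ≤ s') →
    MeasurableSet[sigmaX G (Set.Icc 0 s)] D → (∀ ω ∈ D, X s ω ∉ U₁) →
    Q.real (D ∩ {ω | ∃ r₁ ∈ F, ∃ r₂ ∈ F, r₁ ≤ r₂ ∧ X r₁ ω ∈ U₁ ∧ X r₂ ω ∈ U₂}) ≤
      c₁ * (s' - s) * (c₂ * (s' - s₀)) * Q.real D := by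
  induction F using Finset.induction_on_min with
  | empty =>
    intro s D hs hs0 hss _ _ _
    simp only [Finset.notMem_empty, false_and, exists_false, Set.ofPred_false, Set.inter_empty,
      measureReal_empty]
    have := sub_nonneg.2 hss
    have := sub_nonneg.2 (hs0.trans hss)
    positivity
  | insert m F hm ih =>
    intro s D hs hs0 hss hF hD hDU
    have hsm := hF m (Finset.mem_insert_self _ _)
    have hsub : D ∩ {ω | ∃ r₁ ∈ insert m F, ∃ r₂ ∈ insert m F,
        r₁ ≤ r₂ ∧ X r₁ ω ∈ U₁ ∧ X r₂ ω ∈ U₂} ⊆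
        ((D ∩ {ω | X m ω ∈ U₁}) ∩ {ω | ∃ r ∈ F, X r ω ∈ U₂}) ∪
        ((D ∩ {ω | X m ω ∈ U₁ᶜ}) ∩
          {ω | ∃ r₁ ∈ F, ∃ r₂ ∈ F, r₁ ≤ r₂ ∧ X r₁ ω ∈ U₁ ∧ X r₂ ω ∈ U₂}) := by
      rintro ω ⟨h1, r₁, h2, r₂, h3, h4, h5, h6⟩
      by_cases h7 : X m ω ∈ U₁
      · refine Or.inl ⟨⟨h1, h7⟩, r₂, (Finset.mem_insert.1 h3).resolve_left ?_, h6⟩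
        rintro rfl
        exact Set.disjoint_left.1 hdis h7 h6
      · have h8 : r₁ ∈ F := (Finset.mem_insert.1 h2).resolve_left (by rintro rfl; exact h7 h5)
        refine Or.inr ⟨⟨h1, h7⟩, r₁, h8, r₂, (Finset.mem_insert.1 h3).resolve_left ?_, h4, h5, h6⟩
        rintro rfl
        exact absurd (hm r₁ h8) (not_lt.2 h4)
    have hD' := sigmaX_mono (Set.Icc_subset_Icc_right hsm.1) _ hD
    have hFm : ∀ r ∈ F, m ≤ r ∧ r ≤ s' := fun r hr =>
      ⟨(hm r hr).le, (hF r (Finset.mem_insert_of_mem hr)).2⟩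
    have h1 := hU₁ s m hs hsm.1 (hsm.2.trans hs') D hD hDU
    have h2 := hU₂.finset_hit hc₂ hs' F (D := D ∩ {ω | X m ω ∈ U₁}) (hs.trans hsm.1) hsm.2 hFm
      (hD'.inter (measurableSet_X_mem (Set.right_mem_Icc.2 (hs.trans hsm.1)) _))
      (fun ω hω h => Set.disjoint_left.1 hdis hω.2 h)
    have h3 := ih (D := D ∩ {ω | X m ω ∈ U₁ᶜ}) (hs.trans hsm.1) (hs0.trans hsm.1) hsm.2 hFm
      (hD'.inter (measurableSet_X_mem (Set.right_mem_Icc.2 (hs.trans hsm.1)) _)) (fun ω hω => hω.2)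
    have h4 : Q.real (D ∩ {ω | X m ω ∈ U₁ᶜ}) ≤ Q.real D := measureReal_mono Set.inter_subset_left
    have hn1 : 0 ≤ s' - m := sub_nonneg.2 hsm.2
    have hn2 : 0 ≤ s' - s₀ := sub_nonneg.2 (hs0.trans hss)
    have h5 : c₂ * (s' - m) * Q.real (D ∩ {ω | X m ω ∈ U₁}) ≤
        c₂ * (s' - s₀) * (c₁ * (m - s) * Q.real D) := by
      refine mul_le_mul (mul_le_mul_of_nonneg_left ?_ hc₂) h1 measureReal_nonneg
        (mul_nonneg hc₂ hn2)
      linarith [hsm.1]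
    have h6 : c₁ * (s' - m) * (c₂ * (s' - s₀)) * Q.real (D ∩ {ω | X m ω ∈ U₁ᶜ}) ≤
        c₁ * (s' - m) * (c₂ * (s' - s₀)) * Q.real D :=
      mul_le_mul_of_nonneg_left h4 (by positivity)
    calc _ ≤ _ := measureReal_mono hsub
      _ ≤ _ := measureReal_union_le _ _
      _ ≤ c₂ * (s' - s₀) * (c₁ * (m - s) * Q.real D) +
          c₁ * (s' - m) * (c₂ * (s' - s₀)) * Q.real D := add_le_add (h2.trans h5) (h3.trans h6)
      _ = _ := by ring

/-- The probability of two successive entries, into `U₁` and then into `U₂`, is of second order. -/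
lemma EntryBound.hit2 {S c₁ c₂ : ℝ} {U₁ U₂ : Set V} (hU₁ : EntryBound Q S U₁ c₁)
    (hU₂ : EntryBound Q S U₂ c₂) (hc₁ : 0 ≤ c₁) (hc₂ : 0 ≤ c₂) (hdis : Disjoint U₁ U₂) {s s' : ℝ}
    (hs : 0 ≤ s) (hss : s ≤ s') (hs' : s' ≤ S) (hS : S < 1) {D : Set (PathSpace G)}
    (hD : MeasurableSet[sigmaX G (Set.Icc 0 s)] D) (hDU : ∀ ω ∈ D, X s ω ∉ U₁) :
    Q.real (D ∩ RandomWalk.hit2 G U₁ U₂ s s') ≤ c₁ * c₂ * (s' - s) ^ 2 := by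
  have h : Q.real (D ∩ RandomWalk.hit2 G U₁ U₂ s s') ≤
      c₁ * (s' - s) * (c₂ * (s' - s)) * Q.real D := by
    refine real_inter_le_of_finset (countable_rationalTimes s s') ⟨s', Set.mem_insert _ _⟩
      (p := fun F => {ω | ∃ r₁ ∈ F, ∃ r₂ ∈ F, r₁ ≤ r₂ ∧ X r₁ ω ∈ U₁ ∧ X r₂ ω ∈ U₂})
      (fun F F' h ω ⟨r, hr, r', hr', h'⟩ => ⟨r, h hr, r', h hr', h'⟩)
      (fun ω hω => ?_) (fun F hF => hU₁.finset_hit2 hU₂ hc₁ hc₂ hdis hs' F hs le_rfl hss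
        (fun r hr => rationalTimes_subset hss (hF hr)) hD hDU)
    classical
    rw [mem_hit2_iff hs (hs'.trans hS.le) ω hss] at hω
    obtain ⟨r, hr, r', hr', h⟩ := hω
    refine ⟨{r, r'}, by simp [Set.insert_subset_iff, hr, hr'], r, by simp, r', by simp, h⟩
  have hn : 0 ≤ s' - s := sub_nonneg.2 hss
  have h1 : Q.real D ≤ 1 := measureReal_le_one
  calc _ ≤ _ := h
    _ ≤ c₁ * (s' - s) * (c₂ * (s' - s)) * 1 := mul_le_mul_of_nonneg_left h1 (by positivity)
    _ = _ := by ring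

end Generator

end RandomWalk

namespace RandomWalk

variable {V : Type*} {G : SimpleGraph V} [G.LocallyFinite] {k : ℝ → V → V → ℝ}

/-! ### The equations for the probabilities to follow a given sequence of states -/

/-- The entries of the generator: off the diagonal these are the intensities `k s w b`, and on the
diagonal the total rates with a minus sign. -/
def rate (G : SimpleGraph V) [G.LocallyFinite] (k : ℝ → V → V → ℝ) (s : ℝ) (w b : V) : ℝ :=
  generator G k s (Finsupp.single b (1 : ℝ)) w

lemma rate_self (s : ℝ) (b : V) : rate G k s b b = -totalRate G k s b := by
  classical
  rw [rate, generator, totalRate, ← Finset.sum_neg_distrib]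
  refine Finset.sum_congr rfl fun z hz => ?_
  have : b ≠ z := ((G.mem_neighborFinset _ _).1 hz).ne
  simp [this]

lemma rate_of_adj {s : ℝ} {w b : V} (h : G.Adj w b) : rate G k s w b = k s w b := by
  classical
  rw [rate, generator, Finset.sum_eq_single_of_mem b ((G.mem_neighborFinset _ _).2 h)]
  · simp [h.ne.symm]
  · intro z _ hz
    simp [hz.symm, h.ne.symm]

lemma rate_of_not_adj {s : ℝ} {w b : V} (hne : w ≠ b) (h : ¬ G.Adj w b) : rate G k s w b = 0 := by
  classical
  rw [rate, generator]
  refine Finset.sum_eq_zero fun z hz => ?_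
  have hzb : z ≠ b := by
    rintro rfl
    exact h ((G.mem_neighborFinset _ _).1 hz)
  simp [hzb.symm, hne.symm]

lemma ContinuousRates.rate (hk : ContinuousRates G k) (w b : V) :
    ContinuousOn (fun s => RandomWalk.rate G k s w b) (Set.Ico 0 1) :=
  hk.generator _ _

lemma generator_eq_sum (u : V →₀ ℝ) (s : ℝ) (w : V) :
    generator G k s u w = ∑ b ∈ u.support, u b * rate G k s w b := by
  classical
  simp only [rate, generator, Finset.mul_sum]
  rw [Finset.sum_comm]
  refine Finset.sum_congr rfl fun z _ => ?_
  have h : ∀ z : V, u z = ∑ b ∈ u.support, u b * (Finsupp.single b (1 : ℝ)) z := by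
    intro z
    simp only [Finsupp.single_apply, mul_ite, mul_one, mul_zero, Finset.sum_ite_eq',
      Finsupp.mem_support_iff, ne_eq, ite_not]
    split_ifs with h
    · exact h
    · rfl
  rw [h z, h w, ← Finset.sum_sub_distrib, Finset.mul_sum]
  refine Finset.sum_congr rfl fun b _ => ?_
  ring

lemma abs_measureReal_sub_le {Ω : Type*} [MeasurableSpace Ω] {Q : Measure Ω} [IsFiniteMeasure Q]
    {A B E : Set Ω} (h : ∀ ω ∉ E, ω ∈ A ↔ ω ∈ B) : |Q.real A - Q.real B| ≤ Q.real E := by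
  have h1 : A ⊆ B ∪ E := fun ω hω => by
    by_cases hE : ω ∈ E
    · exact Or.inr hE
    · exact Or.inl ((h ω hE).1 hω)
  have h2 : B ⊆ A ∪ E := fun ω hω => by
    by_cases hE : ω ∈ E
    · exact Or.inr hE
    · exact Or.inl ((h ω hE).2 hω)
  have h3 := (measureReal_mono (μ := Q) h1).trans (measureReal_union_le _ _)
  have h4 := (measureReal_mono (μ := Q) h2).trans (measureReal_union_le _ _)
  rw [abs_le]
  constructor <;> linarith

lemma hasDerivWithinAt_of_abs_sub_le {f g : ℝ → ℝ} {f' s S C : ℝ} (hS : s < S)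
    (hf : HasDerivWithinAt f f' (Set.Ici s) s)
    (h : ∀ s', s ≤ s' → s' ≤ S → |g s' - f s'| ≤ C * (s' - s) ^ 2) :
    HasDerivWithinAt g f' (Set.Ici s) s := by
  have h0 : HasDerivWithinAt (fun x => g x - f x) 0 (Set.Ici s) s := by
    rw [hasDerivWithinAt_iff_isLittleO]
    have e : g s - f s = 0 := by
      have := h s le_rfl hS.le
      rw [sub_self, zero_pow two_ne_zero, mul_zero] at this
      exact abs_nonpos_iff.1 this
    simp only [e, sub_zero, smul_zero]
    have h1 : (fun x => g x - f x) =O[𝓝[≥] s] fun x => (x - s) ^ 2 := by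
      refine IsBigO.of_bound C ?_
      filter_upwards [Icc_mem_nhdsGE hS] with x hx
      rw [Real.norm_eq_abs, Real.norm_of_nonneg (sq_nonneg _)]
      exact h x hx.1 hx.2
    refine h1.trans_isLittleO ?_
    have h2 : (fun x : ℝ => (x - s) ^ 2) =o[𝓝 s] fun x => x - s := by
      have h3 : Tendsto (fun x : ℝ => x - s) (𝓝 s) (𝓝 0) := by
        simpa using (continuous_sub_right s).tendsto s
      have := (isLittleO_pow_id (𝕜 := ℝ) one_lt_two).comp_tendsto h3
      exact this
    exact h2.mono nhdsWithin_le_nhds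
  have h2 := h0.add hf
  simp only [zero_add] at h2
  refine h2.congr (fun x _ => ?_) ?_ <;> simp

variable [Countable V] [MeasurableSpace V] [DiscreteMeasurableSpace V]
variable {Q : Measure (PathSpace G)} [IsProbabilityMeasure Q]

lemma HasIntensity.hasDerivWithinAt_real (hQ : HasIntensity Q k) (hk : ContinuousRates G k)
    {s : ℝ} (hs : 0 ≤ s) (hs1 : s < 1) {D : Set (PathSpace G)}
    (hD : MeasurableSet[sigmaX G (Set.Icc 0 s)] D) {w : V} (hw : ∀ ω ∈ D, X s ω = w) (b : V) :
    HasDerivWithinAt (fun s' => Q.real (D ∩ {ω | X s' ω = b})) (Q.real D * rate G k s w b)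
      (Set.Ici s) s := by
  have h := hQ.hasDerivWithinAt hk (Finsupp.single b (1 : ℝ)) hs hs1 hD
  have e : ∫ ω in D, generator G k s (Finsupp.single b (1 : ℝ)) (X s ω) ∂Q =
      Q.real D * rate G k s w b := by
    have h1 : ∀ ω ∈ D, generator G k s (Finsupp.single b (1 : ℝ)) (X s ω) = rate G k s w b :=
      fun ω hω => by rw [hw ω hω]; rfl
    rw [setIntegral_congr_fun (sigmaX_le _ _ hD) h1, setIntegral_const, smul_eq_mul]
  rw [e] at h
  simpa only [real_inter_X_eq] using h

lemma continuousOn_of_abs_sub_le {S t : ℝ} {f : ℝ → ℝ} {C : ℝ}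
    (h : ∀ s s', t ≤ s → s ≤ s' → s' ≤ S → |f s' - f s| ≤ C * (s' - s)) :
    ContinuousOn f (Set.Icc t S) := by
  have hL : LipschitzOnWith (Real.toNNReal C) f (Set.Icc t S) := by
    refine LipschitzOnWith.of_dist_le_mul fun x hx y hy => ?_
    wlog hxy : y ≤ x generalizing x y
    · rw [dist_comm, dist_comm x]
      exact this y hy x hx (not_le.1 hxy).le
    rw [Real.dist_eq, Real.dist_eq, abs_of_nonneg (sub_nonneg.2 hxy)]
    exact (h y x hy.1 hxy hx.2).trans
      (mul_le_mul_of_nonneg_right (Real.le_coe_toNNReal C) (sub_nonneg.2 hxy))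
  exact hL.continuousOn

/-- Up to an event of first order, the path does not enter or leave `b` within a short time. -/
lemma HasIntensity.exists_lipschitz (hQ : HasIntensity Q k) (hk : ContinuousRates G k) (b : V)
    {S : ℝ} (hS : S < 1) : ∃ C, ∀ s s', 0 ≤ s → s ≤ s' → s' ≤ S → ∀ A B : Set (PathSpace G),
      (∀ ω, (X s ω = b → ∀ r, s ≤ r → r ≤ s' → X r ω = b) →
        (X s ω ≠ b → ∀ r, s ≤ r → r ≤ s' → X r ω ≠ b) → (ω ∈ A ↔ ω ∈ B)) →
      |Q.real A - Q.real B| ≤ C * (s' - s) := by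
  obtain ⟨c₁, hc₁, h₁⟩ := hQ.entryBound_finite hk hS (Set.finite_singleton b)
  obtain ⟨c₂, hc₂, h₂⟩ := hQ.entryBound_cofinite hk hS (U := {b}ᶜ) (by simp)
  refine ⟨c₁ + c₂, fun s s' hs hss hs' A B h => ?_⟩
  have hm : s ∈ Set.Icc 0 s := ⟨hs, le_rfl⟩
  have e1 := h₁.hit hc₁ hs hss hs' hS (D := {ω | X s ω ∈ ({b}ᶜ : Set V)})
    (measurableSet_X_mem hm _) (fun ω hω => hω)
  have e2 := h₂.hit hc₂ hs hss hs' hS (D := {ω | X s ω ∈ ({b} : Set V)})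
    (measurableSet_X_mem hm _) (fun ω hω h => h hω)
  have hn := sub_nonneg.2 hss
  refine (abs_measureReal_sub_le (E := ({ω | X s ω ∈ ({b}ᶜ : Set V)} ∩ hit G {b} s s') ∪
    ({ω | X s ω ∈ ({b} : Set V)} ∩ hit G {b}ᶜ s s')) fun ω hω => ?_).trans
    ((measureReal_union_le _ _).trans ?_)
  · simp only [Set.mem_union, Set.mem_inter_iff, not_or, not_and, Set.mem_ofPred_eq, notMem_hit,
      Set.mem_compl_iff, Set.mem_singleton_iff, not_not] at hω
    exact h ω hω.2 hω.1
  · have h3 : ∀ D : Set (PathSpace G), ∀ c, 0 ≤ c → c * (s' - s) * Q.real D ≤ c * (s' - s) :=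
      fun D c hc => mul_le_of_le_one_right (mul_nonneg hc hn) measureReal_le_one
    linarith [e1.trans (h3 _ _ hc₁), e2.trans (h3 _ _ hc₂)]

lemma HasIntensity.continuousOn_visits (hQ : HasIntensity Q k) (hk : ContinuousRates G k)
    {t S : ℝ} (ht : 0 ≤ t) (hS : S < 1) (B : Set (PathSpace G)) (l : List V) :
    ContinuousOn (fun s => Q.real (B ∩ visits G t l s)) (Set.Icc t S) := by
  match l with
  | [] => simpa [visits] using continuousOn_const
  | b :: l =>
    obtain ⟨C, hC⟩ := hQ.exists_lipschitz hk b hS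
    refine continuousOn_of_abs_sub_le (C := C) fun s s' hs hss hs' =>
      hC s s' (ht.trans hs) hss hs' _ _ fun ω h1 h2 => ?_
    refine and_congr_right fun _ => ⟨fun h => ?_, fun h => ?_⟩
    · have hb : X s ω = b := by
        by_contra hne
        exact h2 hne s' hss le_rfl (X_of_visits (hs.trans hss) h)
      exact visits_restrict hss h (h1 hb)
    · exact visits_extend hss h (h1 (X_of_visits hs h))

lemma HasIntensity.continuousOn_real (hQ : HasIntensity Q k) (hk : ContinuousRates G k)
    {S : ℝ} (hS : S < 1) (B : Set (PathSpace G)) (b : V) :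
    ContinuousOn (fun s => Q.real (B ∩ {ω | X s ω = b})) (Set.Icc 0 S) := by
  obtain ⟨C, hC⟩ := hQ.exists_lipschitz hk b hS
  refine continuousOn_of_abs_sub_le (C := C) fun s s' hs hss hs' =>
    hC s s' hs hss hs' _ _ fun ω h1 h2 => ?_
  refine and_congr_right fun _ => ⟨fun h => ?_, fun h => h1 h s' hss le_rfl⟩
  by_contra hne
  exact h2 hne s' hss le_rfl h

lemma HasIntensity.hasDerivWithinAt_visits_singleton (hQ : HasIntensity Q k)
    (hk : ContinuousRates G k) {t s : ℝ} (ht : 0 ≤ t) (hts : t ≤ s) (hs1 : s < 1)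
    {B : Set (PathSpace G)} (hB : MeasurableSet[sigmaX G (Set.Icc 0 t)] B) (a : V) :
    HasDerivWithinAt (fun s' => Q.real (B ∩ visits G t [a] s'))
      (Q.real (B ∩ visits G t [a] s) * rate G k s a a) (Set.Ici s) s := by
  have hS1 : (s + 1) / 2 < 1 := by linarith
  have hs : 0 ≤ s := ht.trans hts
  have hm : s ∈ Set.Icc 0 s := ⟨hs, le_rfl⟩
  obtain ⟨c₁, hc₁, h₁⟩ := hQ.entryBound_finite hk hS1 (Set.finite_singleton a)
  obtain ⟨c₂, hc₂, h₂⟩ := hQ.entryBound_cofinite hk hS1 (U := {a}ᶜ) (by simp)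
  have hD : MeasurableSet[sigmaX G (Set.Icc 0 s)] (B ∩ visits G t [a] s) :=
    (sigmaX_mono (Set.Icc_subset_Icc_right hts) _ hB).inter
      (measurableSet_visits ht (Set.Icc_subset_Icc_left ht) hts hs1.le)
  refine hasDerivWithinAt_of_abs_sub_le (S := (s + 1) / 2) (C := c₂ * c₁) (by linarith)
    (hQ.hasDerivWithinAt_real hk hs hs1 hD (fun ω hω => X_of_visits hts hω.2) a)
    fun s' hss hs' => ?_
  refine (abs_measureReal_sub_le fun ω hω => ?_).trans
    (h₂.hit2 h₁ hc₂ hc₁ disjoint_compl_left hs hss hs' hS1 (D := {ω | X s ω ∈ ({a} : Set V)})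
    (measurableSet_X_mem hm _) fun ω hω h => h hω)
  constructor
  · rintro ⟨hB, h⟩
    exact ⟨⟨hB, fun r h1 h2 => h r h1 (h2.trans hss)⟩, h s' (hts.trans hss) le_rfl⟩
  · rintro ⟨⟨hB, h⟩, h'⟩
    refine ⟨hB, visits_extend hss h fun r h1 h2 => ?_⟩
    by_contra h3
    exact hω ⟨X_of_visits hts h, r, s', h1, h2, le_rfl, h3, h'⟩

/-- Up to an event of second order, the states visited during `[t, s']` are `b :: b' :: l` if and only
if they are `b :: b' :: l` or `b' :: l` at the time `s`, with `X s' = b`. Hence the forward equation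
of the probability to visit given states involves only the list itself and its tail. -/
lemma HasIntensity.hasDerivWithinAt_visits_cons (hQ : HasIntensity Q k)
    (hk : ContinuousRates G k) {t s : ℝ} (ht : 0 ≤ t) (hts : t ≤ s) (hs1 : s < 1)
    {B : Set (PathSpace G)} (hB : MeasurableSet[sigmaX G (Set.Icc 0 t)] B) {b b' : V}
    (hne : b ≠ b') (l : List V) :
    HasDerivWithinAt (fun s' => Q.real (B ∩ visits G t (b :: b' :: l) s'))
      (Q.real (B ∩ visits G t (b' :: l) s) * rate G k s b' b +
        Q.real (B ∩ visits G t (b :: b' :: l) s) * rate G k s b b) (Set.Ici s) s := by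
  have hS1 : (s + 1) / 2 < 1 := by linarith
  have hs : 0 ≤ s := ht.trans hts
  have hm : s ∈ Set.Icc 0 s := ⟨hs, le_rfl⟩
  obtain ⟨c₁, hc₁, h₁⟩ := hQ.entryBound_finite hk hS1 (Set.finite_singleton b)
  obtain ⟨c₂, hc₂, h₂⟩ := hQ.entryBound_cofinite hk hS1 (U := {b}ᶜ) (by simp)
  obtain ⟨c₃, hc₃, h₃⟩ := hQ.entryBound_finite hk hS1 (Set.finite_singleton b')
  obtain ⟨c₄, hc₄, h₄⟩ := hQ.entryBound_cofinite hk hS1 (U := {b, b'}ᶜ) (by simp)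
  have hB' := sigmaX_mono (Set.Icc_subset_Icc_right hts) _ hB
  have hD : ∀ l, MeasurableSet[sigmaX G (Set.Icc 0 s)] (B ∩ visits G t l s) := fun l =>
    hB'.inter (measurableSet_visits ht (Set.Icc_subset_Icc_left ht) hts hs1.le)
  have hd := (hQ.hasDerivWithinAt_real hk hs hs1 (hD (b' :: l))
    (fun ω hω => X_of_visits hts hω.2) b).add (hQ.hasDerivWithinAt_real hk hs hs1
    (hD (b :: b' :: l)) (fun ω hω => X_of_visits hts hω.2) b)
  refine hasDerivWithinAt_of_abs_sub_le (S := (s + 1) / 2)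
    (C := c₂ * c₁ + c₄ * c₁ + c₁ * c₂ + c₃ * c₁) (by linarith) hd fun s' hss hs' => ?_
  -- the excluded events: the path leaves `b` and returns; on the way from `b'` to `b` it visits
  -- another state; it reaches `b` from `b'` and leaves it; it comes to `b'` and goes on to `b`
  have e1 := h₂.hit2 h₁ hc₂ hc₁ disjoint_compl_left hs hss hs' hS1
    (D := {ω | X s ω ∈ ({b} : Set V)}) (measurableSet_X_mem hm _) fun ω hω h => h hω
  have e2 := h₄.hit2 h₁ hc₄ hc₁ (Set.disjoint_left.2 fun z hz hz' => hz (Or.inl hz')) hs hss hs' hS1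
    (D := {ω | X s ω ∈ ({b'} : Set V)}) (measurableSet_X_mem hm _) fun ω hω h => h (Or.inr hω)
  have e3 := h₁.hit2 h₂ hc₁ hc₂ disjoint_compl_right hs hss hs' hS1
    (D := {ω | X s ω ∈ ({b'} : Set V)}) (measurableSet_X_mem hm _)
    fun ω hω h => hne (h.symm.trans hω)
  have e4 := h₃.hit2 h₁ hc₃ hc₁ (by simpa using hne.symm) hs hss hs' hS1
    (D := {ω | X s ω ∈ ({b'}ᶜ : Set V)}) (measurableSet_X_mem hm _) fun ω hω h => hω h
  set E1 := {ω : PathSpace G | X s ω ∈ ({b} : Set V)} ∩ hit2 G {b}ᶜ {b} s s'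
  set E2 := {ω : PathSpace G | X s ω ∈ ({b'} : Set V)} ∩ hit2 G {b, b'}ᶜ {b} s s'
  set E3 := {ω : PathSpace G | X s ω ∈ ({b'} : Set V)} ∩ hit2 G {b} {b}ᶜ s s'
  set E4 := {ω : PathSpace G | X s ω ∈ ({b'}ᶜ : Set V)} ∩ hit2 G {b'} {b} s s'
  have hdisj : Q.real (B ∩ visits G t (b' :: l) s ∩ {ω | X s' ω = b}) +
      Q.real (B ∩ visits G t (b :: b' :: l) s ∩ {ω | X s' ω = b}) =
      Q.real ((B ∩ visits G t (b' :: l) s ∩ {ω | X s' ω = b}) ∪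
        (B ∩ visits G t (b :: b' :: l) s ∩ {ω | X s' ω = b})) := by
    rw [measureReal_union]
    · rw [Set.disjoint_left]
      rintro ω ⟨⟨_, h1⟩, _⟩ ⟨⟨_, h2⟩, _⟩
      exact hne ((X_of_visits hts h2).symm.trans (X_of_visits hts h1))
    · exact (sigmaX_le _ _ (hD _)).inter (measurableSet_X_eq' s' b)
  simp only [Pi.add_apply]
  rw [hdisj]
  refine (abs_measureReal_sub_le (E := E1 ∪ E2 ∪ E3 ∪ E4) fun ω hω => ?_).trans ?_
  · simp only [Set.mem_union, not_or] at hω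
    obtain ⟨⟨⟨n1, n2⟩, n3⟩, n4⟩ := hω
    have key : X s ω = b' → X s' ω = b → ω ∉ hit2 G {b'}ᶜ {b}ᶜ s s' := by
      rintro hb' hb ⟨r₁, r₂, g1, g2, g3, g4, g5⟩
      by_cases g6 : X r₁ ω = b
      · exact n3 ⟨hb', r₁, r₂, g1, g2, g3, g6, g5⟩
      · refine n2 ⟨hb', r₁, s', g1, g2.trans g3, le_rfl, ?_, hb⟩
        rintro (g7 | g7)
        · exact g6 g7
        · exact g4 g7
    constructor
    · rintro ⟨hωB, h⟩
      have hb := X_of_visits (hts.trans hss) h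
      by_cases h1 : X s ω = b
      · refine Or.inr ⟨⟨hωB, visits_restrict hss h fun r g1 g2 => ?_⟩, hb⟩
        by_contra g3
        exact n1 ⟨h1, r, s', g1, g2, le_rfl, g3, hb⟩
      by_cases h2 : X s ω = b'
      · exact Or.inl ⟨⟨hωB, visits_tail hss h2 (key h2 hb) h⟩, hb⟩
      · exact absurd ⟨h2, hit2_of_visits hss h2 h1 h⟩ n4
    · rintro (⟨⟨hωB, h⟩, hb⟩ | ⟨⟨hωB, h⟩, hb⟩)
      · exact ⟨hωB, visits_cons hts hss hne h hb (key (X_of_visits hts h) hb)⟩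
      · refine ⟨hωB, visits_extend hss h fun r g1 g2 => ?_⟩
        by_contra g3
        exact n1 ⟨X_of_visits hts h, r, s', g1, g2, le_rfl, g3, hb⟩
  · have u1 := measureReal_union_le (μ := Q) (E1 ∪ E2 ∪ E3) E4
    have u2 := measureReal_union_le (μ := Q) (E1 ∪ E2) E3
    have u3 := measureReal_union_le (μ := Q) E1 E2
    linarith

lemma visits_self {t : ℝ} {b b' : V} {l : List V} : visits G t (b :: b' :: l) t = ∅ := by
  rw [Set.eq_empty_iff_forall_notMem]
  rintro ω ⟨hne, q, h1, h2, -, h3, h4, -⟩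
  obtain rfl := le_antisymm h1 h2
  exact hne (h4.symm.trans h3)

lemma visits_singleton_self {t : ℝ} {a : V} : visits G t [a] t = {ω | X t ω = a} := by
  ext ω
  exact ⟨fun h => h t le_rfl le_rfl, fun h r h1 h2 => by rw [← le_antisymm h1 h2]; exact h⟩

end RandomWalk

namespace RandomWalk

/-! ### Auxiliary facts on finite measures and linear equations -/

section Aux

variable {Ω : Type*} [m₀ : MeasurableSpace Ω]

lemma hasSum_measureReal {ι : Type*} [Countable ι] {Q : Measure Ω} [IsFiniteMeasure Q]
    {A : ι → Set Ω} {B : Set Ω} (hA : ∀ i, MeasurableSet (A i))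
    (hd : Pairwise (Function.onFun Disjoint A)) (hB : B = ⋃ i, A i) :
    HasSum (fun i => Q.real (A i)) (Q.real B) := by
  have h := measure_iUnion (μ := Q) hd hA
  rw [hB, measureReal_def, h, ENNReal.tsum_toReal_eq fun i => measure_ne_top _ _]
  exact ENNReal.hasSum_toReal (by rw [← h]; exact measure_ne_top _ _)

lemma tendsto_measureReal_of_eventually {ι : Type*} {L : Filter ι} [L.IsCountablyGenerated]
    {Q : Measure Ω} [IsFiniteMeasure Q] {A : ι → Set Ω} {B : Set Ω}
    (hA : ∀ i, MeasurableSet (A i)) (h : ∀ ω, ∀ᶠ i in L, ω ∈ A i ↔ ω ∈ B) :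
    Tendsto (fun i => Q.real (A i)) L (𝓝 (Q.real B)) :=
  (ENNReal.continuousAt_toReal (measure_ne_top Q B)).tendsto.comp
    (tendsto_measure_of_tendsto_indicator_of_isFiniteMeasure L Q hA h)

/-- Proportional measures on a `π`-system are proportional on the generated `σ`-field. -/
lemma mul_measureReal_eq_of_piSystem {Ω : Type*} {m m₀ : MeasurableSpace Ω}
    (hm : m ≤ m₀) {C : Set (Set Ω)}
    (hC : m = MeasurableSpace.generateFrom C) (hpi : IsPiSystem C) {Q R : Measure Ω}
    [IsFiniteMeasure Q] [IsFiniteMeasure R] {c d : ℝ} (hc : 0 ≤ c) (hd : 0 ≤ d) {A B : Set Ω}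
    (huniv : c * Q.real B = d * R.real A)
    (h : ∀ E ∈ C, c * Q.real (E ∩ B) = d * R.real (E ∩ A)) {E : Set Ω} (hE : MeasurableSet[m] E) :
    c * Q.real (E ∩ B) = d * R.real (E ∩ A) := by
  have key : ∀ (P : Measure Ω) [IsFiniteMeasure P] (c : ℝ) (D E : Set Ω), 0 ≤ c →
      MeasurableSet E → (ENNReal.ofReal c • P.restrict D) E =
        ENNReal.ofReal (c * P.real (E ∩ D)) := by
    intro P _ c D E hc hE
    rw [Measure.smul_apply, Measure.restrict_apply hE, smul_eq_mul, ENNReal.ofReal_mul hc,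
      ofReal_measureReal]
  have : IsFiniteMeasure (ENNReal.ofReal c • Q.restrict B) :=
    Measure.smul_finite _ ENNReal.ofReal_ne_top
  have h1 := ext_on_measurableSpace_of_generate_finite m₀ (μ := ENNReal.ofReal c • Q.restrict B)
    (ν := ENNReal.ofReal d • R.restrict A) C (fun E hE => ?_) hm hC hpi ?_ hE
  · rw [key Q c B E hc (hm _ hE), key R d A E hd (hm _ hE)] at h1
    exact (ENNReal.ofReal_eq_ofReal_iff (mul_nonneg hc measureReal_nonneg)
      (mul_nonneg hd measureReal_nonneg)).1 h1
  · have hE' : MeasurableSet E := hm _ (by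
      rw [hC]; exact MeasurableSpace.measurableSet_generateFrom hE)
    rw [key Q c B E hc hE', key R d A E hd hE', h E hE]
  · rw [key Q c B _ hc MeasurableSet.univ, key R d A _ hd MeasurableSet.univ, Set.univ_inter,
      Set.univ_inter, huniv]

lemma eqOn_of_linear_ode {f g p a : ℝ → ℝ} {t S : ℝ} (ha : ContinuousOn a (Set.Icc t S))
    (hf : ContinuousOn f (Set.Icc t S)) (hg : ContinuousOn g (Set.Icc t S))
    (hf' : ∀ s ∈ Set.Ico t S, HasDerivWithinAt f (p s + f s * a s) (Set.Ici s) s)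
    (hg' : ∀ s ∈ Set.Ico t S, HasDerivWithinAt g (p s + g s * a s) (Set.Ici s) s)
    (h0 : f t = g t) : Set.EqOn f g (Set.Icc t S) := by
  obtain ⟨C, hC⟩ := isCompact_Icc.exists_bound_of_continuousOn ha
  refine ODE_solution_unique_of_mem_Icc_right (v := fun s y => p s + y * a s)
    (K := Real.toNNReal C) (s := fun _ => Set.univ) (fun s hs => ?_) hf hf' (fun _ _ => trivial) hg
    hg' (fun _ _ => trivial) h0
  refine LipschitzOnWith.of_dist_le_mul fun x _ y _ => ?_
  rw [dist_add_left, Real.dist_eq, ← sub_mul, abs_mul, Real.dist_eq, mul_comm]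
  exact mul_le_mul_of_nonneg_right ((hC s ⟨hs.1, hs.2.le⟩).trans (Real.le_coe_toNNReal C))
    (abs_nonneg _)

end Aux

variable {V : Type*} {G : SimpleGraph V} [G.LocallyFinite] {k j : ℝ → V → V → ℝ}
variable [Countable V] [MeasurableSpace V] [DiscreteMeasurableSpace V]
variable {Q R : Measure (PathSpace G)} [IsProbabilityMeasure Q] [IsProbabilityMeasure R]

lemma hasSum_X_eq (s : ℝ) {D : Set (PathSpace G)} (hD : MeasurableSet D) :
    HasSum (fun b => Q.real (D ∩ {ω | X s ω = b})) (Q.real D) := by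
  refine hasSum_measureReal (fun b => hD.inter (measurableSet_X_eq' s b)) (fun b b' hne => ?_) ?_
  · rw [Function.onFun, Set.disjoint_left]
    rintro ω ⟨-, h⟩ ⟨-, h'⟩
    exact hne (h.symm.trans h')
  · ext ω
    simp

lemma hasSum_visits {t s : ℝ} (ht : 0 ≤ t) (hts : t ≤ s) (hs : s ≤ 1) {D : Set (PathSpace G)}
    (hD : MeasurableSet D) (b : V) :
    HasSum (fun l => Q.real (D ∩ visits G t (b :: l) s)) (Q.real (D ∩ {ω | X s ω = b})) := by
  refine hasSum_measureReal (fun l => hD.inter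
    (sigmaX_le _ _ (measurableSet_visits ht subset_rfl hts hs))) (fun l l' hne => ?_) ?_
  · rw [Function.onFun, Set.disjoint_left]
    rintro ω ⟨-, h⟩ ⟨-, h'⟩
    exact hne (List.cons.inj (visits_unique hts h h')).2
  · ext ω
    simp only [Set.mem_inter_iff, Set.mem_ofPred_eq, Set.mem_iUnion, exists_and_left]
    refine and_congr_right fun _ => ⟨fun h => ?_, fun ⟨l, h⟩ => X_of_visits hts h⟩
    obtain ⟨l, hl⟩ := exists_visits ht hts hs ω
    obtain ⟨l', rfl⟩ := visits_head hts hl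
    exact ⟨l', h ▸ hl⟩

/-! ### Proportional transition probabilities -/

/-- On the time interval `I`, the transition probabilities of `Q` from `(t, a)` to `(s, b)` are
those of `R`, multiplied by `g s b / g t a`. As the states are only reached with positive probability
under assumptions, this is written for all events `A`, `B` of the past of `t` contained in
`{X t = a}`, and without quotients. For `Q = R` and `g = 1` this is the Markov property. -/
def TransitionRatio (Q R : Measure (PathSpace G)) (g : ℝ → V → ℝ) (I : Set ℝ) : Prop :=
  ∀ t ∈ I, ∀ s ∈ I, t ≤ s → ∀ a b, ∀ A B, MeasurableSet[sigmaX G (Set.Icc 0 t)] A →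
    MeasurableSet[sigmaX G (Set.Icc 0 t)] B → (∀ ω ∈ A, X t ω = a) → (∀ ω ∈ B, X t ω = a) →
    g t a * R.real A * Q.real (B ∩ {ω | X s ω = b}) =
      Q.real B * (g s b * R.real (A ∩ {ω | X s ω = b}))

/-- Both sides solve the same linear differential equation in `s`, by induction on the list: the
inhomogeneous terms come from the tail of the list. -/
lemma visits_ratio (hQ : HasIntensity Q k) (hk : ContinuousRates G k) (hR : HasIntensity R j)
    (hj : ContinuousRates G j) {g g' : ℝ → V → ℝ} {t S : ℝ} (ht : 0 ≤ t) (hS : S < 1)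
    (hg : ∀ z, ∀ s ∈ Set.Icc t S, HasDerivAt (fun r => g r z) (g' s z) s)
    (hoff : ∀ w b, w ≠ b → ∀ s ∈ Set.Icc t S, rate G k s w b * g s w = rate G j s w b * g s b)
    (hdiag : ∀ b, ∀ s ∈ Set.Icc t S,
      rate G k s b b * g s b = rate G j s b b * g s b + g' s b)
    {a : V} {A B : Set (PathSpace G)} (hA : MeasurableSet[sigmaX G (Set.Icc 0 t)] A)
    (hB : MeasurableSet[sigmaX G (Set.Icc 0 t)] B) (hAa : ∀ ω ∈ A, X t ω = a)
    (hBa : ∀ ω ∈ B, X t ω = a) (l : List V) : ∀ b, ∀ s ∈ Set.Icc t S,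
    g t a * R.real A * Q.real (B ∩ visits G t (b :: l) s) =
      Q.real B * (g s b * R.real (A ∩ visits G t (b :: l) s)) := by
  have hcg : ∀ z, ContinuousOn (fun r => g r z) (Set.Icc t S) := fun z s hs =>
    (hg z s hs).continuousAt.continuousWithinAt
  have hsub : Set.Icc t S ⊆ Set.Ico 0 1 := fun s hs => ⟨ht.trans hs.1, hs.2.trans_lt hS⟩
  induction l with
  | nil =>
    intro b
    refine eqOn_of_linear_ode (p := fun _ => 0) ((hk.rate b b).mono hsub)
      (continuousOn_const.mul (hQ.continuousOn_visits hk ht hS B _))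
      (continuousOn_const.mul ((hcg b).mul (hR.continuousOn_visits hj ht hS A _)))
      (fun s hs => ?_) (fun s hs => ?_) ?_
    · refine ((hQ.hasDerivWithinAt_visits_singleton hk ht hs.1 (hs.2.trans hS) hB b).const_mul
        (g t a * R.real A)).congr_deriv (by ring)
    · have hs' : s ∈ Set.Icc t S := ⟨hs.1, hs.2.le⟩
      refine (((hg b s hs').hasDerivWithinAt.mul (hR.hasDerivWithinAt_visits_singleton hj ht hs.1
        (hs.2.trans hS) hA b)).const_mul (Q.real B)).congr_deriv ?_
      linear_combination -Q.real B * R.real (A ∩ visits G t [b] s) * hdiag b s hs'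
    · simp only [visits_singleton_self]
      by_cases hab : a = b
      · have h1 : A ∩ {ω | X t ω = b} = A :=
          Set.inter_eq_left.2 fun ω hω => (hAa ω hω).trans hab
        have h2 : B ∩ {ω | X t ω = b} = B :=
          Set.inter_eq_left.2 fun ω hω => (hBa ω hω).trans hab
        rw [h1, h2, hab]
        ring
      · have h1 : A ∩ {ω | X t ω = b} = ∅ := Set.eq_empty_of_forall_notMem fun ω hω =>
          hab ((hAa ω hω.1).symm.trans hω.2)
        have h2 : B ∩ {ω | X t ω = b} = ∅ := Set.eq_empty_of_forall_notMem fun ω hω =>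
          hab ((hBa ω hω.1).symm.trans hω.2)
        rw [h1, h2]
        simp
  | cons b' l ih =>
    intro b
    by_cases hne : b = b'
    · intro s hs
      have : visits G t (b :: b' :: l) s = ∅ := by
        ext ω
        simp [visits, hne]
      simp [this]
    refine eqOn_of_linear_ode (p := fun s => g t a * R.real A * Q.real (B ∩ visits G t (b' :: l) s)
      * rate G k s b' b) ((hk.rate b b).mono hsub)
      (continuousOn_const.mul (hQ.continuousOn_visits hk ht hS B _))
      (continuousOn_const.mul ((hcg b).mul (hR.continuousOn_visits hj ht hS A _)))
      (fun s hs => ?_) (fun s hs => ?_) ?_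
    · refine ((hQ.hasDerivWithinAt_visits_cons hk ht hs.1 (hs.2.trans hS) hB hne l).const_mul
        (g t a * R.real A)).congr_deriv (by ring)
    · have hs' : s ∈ Set.Icc t S := ⟨hs.1, hs.2.le⟩
      refine (((hg b s hs').hasDerivWithinAt.mul (hR.hasDerivWithinAt_visits_cons hj ht hs.1
        (hs.2.trans hS) hA hne l)).const_mul (Q.real B)).congr_deriv ?_
      linear_combination -Q.real B * R.real (A ∩ visits G t (b :: b' :: l) s) * hdiag b s hs' -
        rate G k s b' b * ih b' s hs' -
        Q.real B * R.real (A ∩ visits G t (b' :: l) s) * hoff b' b (Ne.symm hne) s hs'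
    · simp [visits_self]

/-- If the off-diagonal rates of `Q` are those of `R` transformed by `g`, and the total rates differ
by the logarithmic derivative of `g`, then the transition probabilities are proportional. The
probabilities to follow a given sequence of states are proportional, by their equations, and the
paths have finitely many jumps. -/
lemma transitionRatio_of_rates (hQ : HasIntensity Q k) (hk : ContinuousRates G k)
    (hR : HasIntensity R j) (hj : ContinuousRates G j) {g g' : ℝ → V → ℝ} {I : Set ℝ}
    (hI : I ⊆ Set.Ico 0 1) (hord : I.OrdConnected)
    (hg : ∀ z, ∀ s ∈ I, HasDerivAt (fun r => g r z) (g' s z) s)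
    (hoff : ∀ w b, w ≠ b → ∀ s ∈ I, rate G k s w b * g s w = rate G j s w b * g s b)
    (hdiag : ∀ b, ∀ s ∈ I, rate G k s b b * g s b = rate G j s b b * g s b + g' s b) :
    TransitionRatio Q R g I := by
  intro t ht s hs hts a b A B hA hB hAa hBa
  have hsub : Set.Icc t s ⊆ I := hord.out ht hs
  have h := visits_ratio hQ hk hR hj (hI ht).1 (hI hs).2 (fun z r hr => hg z r (hsub hr))
    (fun w b hne r hr => hoff w b hne r (hsub hr)) (fun b r hr => hdiag b r (hsub hr)) hA hB hAa hBa
  have h1 := (hasSum_visits (Q := Q) (hI ht).1 hts (hI hs).2.le (sigmaX_le _ _ hB) b).mul_left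
    (g t a * R.real A)
  have h2 := ((hasSum_visits (Q := R) (hI ht).1 hts (hI hs).2.le (sigmaX_le _ _ hA) b).mul_left
    (g s b)).mul_left (Q.real B)
  refine h1.unique (h2.congr_fun ?_)
  exact fun l => h l b s (Set.right_mem_Icc.2 hts)

lemma TransitionRatio.cylinder {g : ℝ → V → ℝ} {I : Set ℝ} (h : TransitionRatio Q R g I)
    (hpos : ∀ s ∈ I, ∀ z, 0 < g s z) (hI : I ⊆ Set.Icc 0 1) {t : ℝ} (ht : t ∈ I) {a : V}
    {A B : Set (PathSpace G)} (hA : MeasurableSet[sigmaX G (Set.Icc 0 t)] A)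
    (hB : MeasurableSet[sigmaX G (Set.Icc 0 t)] B) (hAa : ∀ ω ∈ A, X t ω = a)
    (hBa : ∀ ω ∈ B, X t ω = a) (U : ℝ → Set V) (F : Finset ℝ) :
    ∀ r ∈ I, t ≤ r → (∀ i ∈ F, i ∈ I ∧ t ≤ i ∧ i ≤ r) → ∀ b,
    g t a * R.real A * Q.real ((B ∩ ⋂ i ∈ F, {ω | X i ω ∈ U i}) ∩ {ω | X r ω = b}) =
      Q.real B * (g r b * R.real ((A ∩ ⋂ i ∈ F, {ω | X i ω ∈ U i}) ∩ {ω | X r ω = b})) := by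
  induction F using Finset.induction_on_max with
  | empty =>
    intro r hr htr _ b
    simpa using h t ht r hr htr a b A B hA hB hAa hBa
  | insert m F hm ih =>
    intro r hr htr hF b
    obtain ⟨hmI, htm, hmr⟩ := hF m (Finset.mem_insert_self _ _)
    have hmeas : ∀ D, MeasurableSet[sigmaX G (Set.Icc 0 t)] D →
        MeasurableSet[sigmaX G (Set.Icc 0 m)] (D ∩ ⋂ i ∈ F, {ω | X i ω ∈ U i}) := fun D hD =>
      (sigmaX_mono (Set.Icc_subset_Icc_right htm) _ hD).inter
        (Finset.measurableSet_biInter _ fun i hi => measurableSet_X_mem (I := Set.Icc 0 m)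
          ⟨(hI (hF i (Finset.mem_insert_of_mem hi)).1).1, (hm i hi).le⟩ _)
    have hmm : m ∈ Set.Icc 0 m := ⟨(hI hmI).1, le_rfl⟩
    set EA := A ∩ ⋂ i ∈ F, {ω | X i ω ∈ U i} with hEA
    set EB := B ∩ ⋂ i ∈ F, {ω | X i ω ∈ U i} with hEB
    have hins : ∀ D, D ∩ ⋂ i ∈ insert m F, {ω | X i ω ∈ U i} =
        (D ∩ ⋂ i ∈ F, {ω : PathSpace G | X i ω ∈ U i}) ∩ {ω | X m ω ∈ U m} := fun D => by
      rw [Finset.set_biInter_insert, Set.inter_comm {ω : PathSpace G | X m ω ∈ U m},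
        Set.inter_assoc]
    rw [hins, hins, ← hEA, ← hEB]
    -- the identity for each value `w` of the state at the time `m`
    have hw : ∀ w, g t a * R.real A * Q.real (EB ∩ {ω | X m ω = w} ∩ {ω | X r ω = b}) =
        Q.real B * (g r b * R.real (EA ∩ {ω | X m ω = w} ∩ {ω | X r ω = b})) := by
      intro w
      have h1 := ih m hmI htm (fun i hi => ⟨(hF i (Finset.mem_insert_of_mem hi)).1,
        (hF i (Finset.mem_insert_of_mem hi)).2.1, (hm i hi).le⟩) w
      have h2 := h m hmI r hr hmr w b (EA ∩ {ω | X m ω = w}) (EB ∩ {ω | X m ω = w})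
        ((hmeas A hA).inter (measurableSet_X_eq hmm w))
        ((hmeas B hB).inter (measurableSet_X_eq hmm w)) (fun ω hω => hω.2) (fun ω hω => hω.2)
      have hmono : ∀ (P : Measure (PathSpace G)) [IsProbabilityMeasure P] (D : Set (PathSpace G)),
          P.real D = 0 → P.real (D ∩ {ω | X r ω = b}) = 0 := fun P _ D hD =>
        le_antisymm ((measureReal_mono Set.inter_subset_left).trans hD.le) measureReal_nonneg
      by_cases hRA : R.real A = 0
      · have h3 : R.real (EA ∩ {ω | X m ω = w} ∩ {ω | X r ω = b}) = 0 :=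
          le_antisymm ((measureReal_mono (μ := R) (s₂ := A) (fun ω hω => hω.1.1.1)).trans hRA.le)
            measureReal_nonneg
        rw [h3, hRA]
        simp
      have hgt := (hpos t ht a).ne'
      by_cases h0 : R.real (EA ∩ {ω | X m ω = w}) = 0
      · have h4 : Q.real (EB ∩ {ω | X m ω = w}) = 0 := by
          rw [h0, mul_zero, mul_zero] at h1
          exact (mul_eq_zero.1 h1).resolve_left (mul_ne_zero hgt hRA)
        rw [hmono Q _ h4, hmono R _ h0]
        simp
      · refine mul_left_cancel₀ (mul_ne_zero (hpos m hmI w).ne' h0) ?_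
        linear_combination (g t a * R.real A) * h2 +
          g r b * R.real (EA ∩ {ω | X m ω = w} ∩ {ω | X r ω = b}) * h1
    have hsum : ∀ (P : Measure (PathSpace G)) [IsProbabilityMeasure P] (D : Set (PathSpace G)),
        MeasurableSet D → HasSum (fun w => (U m).indicator
          (fun w => P.real (D ∩ {ω | X m ω = w} ∩ {ω | X r ω = b})) w)
          (P.real (D ∩ {ω | X m ω ∈ U m} ∩ {ω | X r ω = b})) := by
      intro P _ D hD
      have h5 := hasSum_X_eq (Q := P) m ((hD.inter (measurableSet_X_mem' m (U m))).inter
        (measurableSet_X_eq' r b))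
      refine h5.congr_fun fun w => ?_
      classical
      rw [Set.indicator_apply]
      split_ifs with hwU
      · congr 1
        ext ω
        simp only [Set.mem_inter_iff, Set.mem_ofPred_eq]
        constructor
        · rintro ⟨⟨h1, rfl⟩, h2⟩
          exact ⟨⟨⟨h1, hwU⟩, h2⟩, rfl⟩
        · rintro ⟨⟨⟨h1, -⟩, h2⟩, h3⟩
          exact ⟨⟨h1, h3⟩, h2⟩
      · have : D ∩ {ω | X m ω ∈ U m} ∩ {ω | X r ω = b} ∩ {ω | X m ω = w} = ∅ := by
          refine Set.eq_empty_of_forall_notMem fun ω hω => hwU ?_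
          have h2 : X m ω = w := hω.2
          rw [← h2]
          exact hω.1.1.2
        rw [this, measureReal_empty]
    have h6 := (hsum Q EB (sigmaX_le _ _ (hmeas B hB))).mul_left (g t a * R.real A)
    have h7 := ((hsum R EA (sigmaX_le _ _ (hmeas A hA))).mul_left (g r b)).mul_left (Q.real B)
    refine h6.unique (h7.congr_fun fun w => ?_)
    classical
    simp only [Set.indicator_apply]
    split_ifs
    · exact hw w
    · simp

lemma piiUnionInter_comap_X {I : Set ℝ} {E : Set (PathSpace G)}
    (hE : E ∈ piiUnionInter (fun t => {s | MeasurableSet[MeasurableSpace.comap (X (G := G) t)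
      inferInstance] s}) I) :
    ∃ (F : Finset ℝ) (U : ℝ → Set V), ↑F ⊆ I ∧ E = ⋂ i ∈ F, {ω | X i ω ∈ U i} := by
  obtain ⟨F, hF, f, hf, rfl⟩ := hE
  have : ∀ i : ℝ, ∃ U : Set V, i ∈ F → f i = {ω | X i ω ∈ U} := by
    intro i
    by_cases hi : i ∈ F
    · obtain ⟨U, -, hU⟩ := hf i hi
      exact ⟨U, fun _ => hU.symm⟩
    · exact ⟨∅, fun h => absurd h hi⟩
  choose U hU using this
  exact ⟨F, U, hF, Set.iInter₂_congr hU⟩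

lemma isPiSystem_comap_X (I : Set ℝ) : IsPiSystem (piiUnionInter
    (fun t => {s | MeasurableSet[MeasurableSpace.comap (X (G := G) t) inferInstance] s}) I) :=
  isPiSystem_piiUnionInter _ (fun t => @MeasurableSpace.isPiSystem_measurableSet _
    (MeasurableSpace.comap (X (G := G) t) inferInstance)) I

/-- Proportional transition probabilities yield proportional bridges. -/
lemma TransitionRatio.sigmaX {g : ℝ → V → ℝ} {t S : ℝ} (h : TransitionRatio Q R g (Set.Icc t S))
    (hpos : ∀ s ∈ Set.Icc t S, ∀ z, 0 < g s z) (ht : 0 ≤ t) (htS : t ≤ S) (hS : S ≤ 1) {a : V}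
    {A B : Set (PathSpace G)} (hA : MeasurableSet[RandomWalk.sigmaX G (Set.Icc 0 t)] A)
    (hB : MeasurableSet[RandomWalk.sigmaX G (Set.Icc 0 t)] B) (hAa : ∀ ω ∈ A, X t ω = a)
    (hBa : ∀ ω ∈ B, X t ω = a) {E : Set (PathSpace G)}
    (hE : MeasurableSet[RandomWalk.sigmaX G (Set.Icc t S)] E) (b : V) :
    g t a * R.real A * Q.real (E ∩ (B ∩ {ω | X S ω = b})) =
      Q.real B * g S b * R.real (E ∩ (A ∩ {ω | X S ω = b})) := by
  have hI : Set.Icc t S ⊆ Set.Icc 0 1 := Set.Icc_subset_Icc ht hS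
  have htI : t ∈ Set.Icc t S := ⟨le_rfl, htS⟩
  have hSI : S ∈ Set.Icc t S := ⟨htS, le_rfl⟩
  refine mul_measureReal_eq_of_piSystem (sigmaX_le _)
    (generateFrom_piiUnionInter_measurableSet _ _).symm (isPiSystem_comap_X _)
    (mul_nonneg (hpos t htI a).le measureReal_nonneg)
    (mul_nonneg measureReal_nonneg (hpos S hSI b).le) ?_ (fun E hE => ?_) hE
  · have := h.cylinder hpos hI htI hA hB hAa hBa (fun _ => Set.univ) ∅ S hSI htS (by simp) b
    simp only [Finset.notMem_empty, Set.iInter_of_empty, Set.iInter_univ, Set.inter_univ] at this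
    rw [this]
    ring
  · obtain ⟨F, U, hF, rfl⟩ := piiUnionInter_comap_X hE
    have := h.cylinder hpos hI htI hA hB hAa hBa U F S hSI htS
      (fun i hi => ⟨hF hi, (hF hi).1, (hF hi).2⟩) b
    have e : ∀ D : Set (PathSpace G), (⋂ i ∈ F, {ω | X i ω ∈ U i}) ∩ (D ∩ {ω | X S ω = b}) =
        (D ∩ ⋂ i ∈ F, {ω | X i ω ∈ U i}) ∩ {ω | X S ω = b} := fun D => by
      rw [← Set.inter_assoc, Set.inter_comm _ D]
    rw [e, e, this]
    ring

end RandomWalk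

namespace RandomWalk

variable {V : Type*} {G : SimpleGraph V}
variable [Countable V] [MeasurableSpace V] [DiscreteMeasurableSpace V]
variable {P Q R : Measure (PathSpace G)} [IsProbabilityMeasure P] [IsProbabilityMeasure Q]
  [IsProbabilityMeasure R]

lemma tendsto_real_X_one (D : Set (PathSpace G)) (hD : MeasurableSet D) (b : V) :
    Tendsto (fun s => Q.real (D ∩ {ω | X s ω = b})) (𝓝[<] 1)
      (𝓝 (Q.real (D ∩ {ω | X 1 ω = b}))) := by
  refine tendsto_measureReal_of_eventually (fun s => hD.inter (measurableSet_X_eq' s b))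
    fun ω => ?_
  filter_upwards [tendsto_X_one ω] with s hs
  simp [hs]

lemma tendsto_real_X_zero (D : Set (PathSpace G)) (hD : MeasurableSet D) (b : V) :
    Tendsto (fun s => Q.real (D ∩ {ω | X s ω = b})) (𝓝[>] 0)
      (𝓝 (Q.real (D ∩ {ω | X 0 ω = b}))) := by
  refine tendsto_measureReal_of_eventually (fun s => hD.inter (measurableSet_X_eq' s b))
    fun ω => ?_
  filter_upwards [eventually_X_eq ω 0] with s hs
  simp [hs]

section Markov

variable [G.LocallyFinite] {k j : ℝ → V → V → ℝ}

/-! ### The Markov property -/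

lemma HasIntensity.transitionRatio_self (hR : HasIntensity R j) (hj : ContinuousRates G j) :
    TransitionRatio R R (fun _ _ => 1) (Set.Icc 0 1) := by
  have h : TransitionRatio R R (fun _ _ => 1) (Set.Ico 0 1) :=
    transitionRatio_of_rates hR hj hR hj (g' := fun _ _ => 0) subset_rfl Set.ordConnected_Ico
      (fun z s _ => hasDerivAt_const s _) (fun _ _ _ _ _ => rfl) (fun _ _ _ => by ring)
  intro t ht s hs hts a b A B hA hB hAa hBa
  rcases hs.2.lt_or_eq with hs1 | rfl
  · exact h t ⟨ht.1, hts.trans_lt hs1⟩ s ⟨hs.1, hs1⟩ hts a b A B hA hB hAa hBa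
  rcases ht.2.lt_or_eq with ht1 | rfl
  · refine tendsto_nhds_unique ((tendsto_real_X_one B (sigmaX_le _ _ hB) b).const_mul _)
      (((((tendsto_real_X_one A (sigmaX_le _ _ hA) b).const_mul _).const_mul _)).congr' ?_)
    filter_upwards [Ioo_mem_nhdsLT ht1] with s hs
    exact (h t ⟨ht.1, ht1⟩ s ⟨ht.1.trans hs.1.le, hs.2⟩ hs.1.le a b A B hA hB hAa hBa).symm
  · by_cases hab : a = b
    · have h1 : A ∩ {ω | X 1 ω = b} = A :=
        Set.inter_eq_left.2 fun ω hω => (hAa ω hω).trans hab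
      have h2 : B ∩ {ω | X 1 ω = b} = B :=
        Set.inter_eq_left.2 fun ω hω => (hBa ω hω).trans hab
      rw [h1, h2]
      ring
    · have h1 : A ∩ {ω | X 1 ω = b} = ∅ := Set.eq_empty_of_forall_notMem fun ω hω =>
        hab ((hAa ω hω.1).symm.trans hω.2)
      have h2 : B ∩ {ω | X 1 ω = b} = ∅ := Set.eq_empty_of_forall_notMem fun ω hω =>
        hab ((hBa ω hω.1).symm.trans hω.2)
      rw [h1, h2]
      simp

/-- The Markov property: the past `B` and the future `D` are independent given `X t = a`. -/
lemma HasIntensity.markov (hR : HasIntensity R j) (hj : ContinuousRates G j) {t : ℝ}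
    (ht : t ∈ Set.Icc (0 : ℝ) 1) {a : V} {B D : Set (PathSpace G)}
    (hB : MeasurableSet[sigmaX G (Set.Icc 0 t)] B) (hBa : ∀ ω ∈ B, X t ω = a)
    (hD : MeasurableSet[sigmaX G (Set.Icc t 1)] D) :
    R.real {ω | X t ω = a} * R.real (D ∩ B) = R.real B * R.real (D ∩ {ω | X t ω = a}) := by
  have htt : t ∈ Set.Icc 0 t := ⟨ht.1, le_rfl⟩
  have h0 : TransitionRatio R R (fun _ _ => 1) (Set.Icc t 1) := fun t' ht' s hs =>
    hR.transitionRatio_self hj t' ⟨ht.1.trans ht'.1, ht'.2⟩ s ⟨ht.1.trans hs.1, hs.2⟩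
  have h := fun b => h0.sigmaX (fun _ _ _ => one_pos) ht.1 ht.2 le_rfl
    (measurableSet_X_eq htt a) hB (fun ω hω => hω) hBa hD b
  simp only [one_mul, mul_one, ← Set.inter_assoc] at h
  have hD' := sigmaX_le _ _ hD
  refine ((hasSum_X_eq 1 (hD'.inter (sigmaX_le _ _ hB))).mul_left _).unique
    (((hasSum_X_eq 1 (hD'.inter (measurableSet_X_eq' t a))).mul_left _).congr_fun fun b => h b)

end Markov

/-! ### Independence of the inside and the outside of a time interval -/

/-- Given `X u = a` and `X v = b`, the events observed within `[u, v]` and those observed outside are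
`P`-independent, and the former ones have the same conditional probability as under `R`. -/
def SameBridges (P R : Measure (PathSpace G)) : Prop :=
  ∀ u v : ℝ, 0 ≤ u → u ≤ v → v ≤ 1 → ∀ B C : Set (PathSpace G),
    MeasurableSet[sigmaX G (Set.Icc u v)] B →
    MeasurableSet[sigmaX G (Set.Icc 0 u ∪ Set.Icc v 1)] C → ∀ a b,
    R.real {ω | X u ω = a ∧ X v ω = b} * P.real (C ∩ (B ∩ {ω | X u ω = a ∧ X v ω = b})) =
      R.real (B ∩ {ω | X u ω = a ∧ X v ω = b}) * P.real (C ∩ {ω | X u ω = a ∧ X v ω = b})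

/-- This is the Markov property, in the form that is symmetric in the past and the future. -/
lemma HasIntensity.sameBridges [G.LocallyFinite] {j : ℝ → V → V → ℝ} (hR : HasIntensity R j)
    (hj : ContinuousRates G j) : SameBridges R R := by
  intro u v hu huv hv B C hB hC a b
  refine mul_measureReal_eq_of_piSystem (sigmaX_le _)
    (generateFrom_piiUnionInter_measurableSet _ _).symm (isPiSystem_comap_X _)
    measureReal_nonneg measureReal_nonneg (mul_comm _ _) (fun E hE => ?_) hC
  classical
  obtain ⟨F, U, hF, rfl⟩ := piiUnionInter_comap_X hE
  set A : Set (PathSpace G) := ⋂ i ∈ F.filter (· ≤ u), {ω | X i ω ∈ U i} with hAdef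
  set D : Set (PathSpace G) := ⋂ i ∈ F.filter (¬ · ≤ u), {ω | X i ω ∈ U i} with hDdef
  have hAD : (⋂ i ∈ F, {ω | X i ω ∈ U i}) = A ∩ D := by
    ext ω
    simp only [hAdef, hDdef, Set.mem_iInter, Set.mem_inter_iff, Finset.mem_filter]
    constructor
    · exact fun h => ⟨fun i hi => h i hi.1, fun i hi => h i hi.1⟩
    · intro h i hi
      by_cases hiu : i ≤ u
      · exact h.1 i ⟨hi, hiu⟩
      · exact h.2 i ⟨hi, hiu⟩
  have hA : MeasurableSet[sigmaX G (Set.Icc 0 u)] A := by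
    refine Finset.measurableSet_biInter _ fun i hi =>
      measurableSet_X_mem (I := Set.Icc 0 u) ?_ _
    rw [Finset.mem_filter] at hi
    rcases hF hi.1 with h | h
    · exact h
    · exact ⟨hu.trans (huv.trans h.1), hi.2⟩
  have hD : MeasurableSet[sigmaX G (Set.Icc v 1)] D := by
    refine Finset.measurableSet_biInter _ fun i hi =>
      measurableSet_X_mem (I := Set.Icc v 1) ?_ _
    rw [Finset.mem_filter] at hi
    rcases hF hi.1 with h | h
    · exact absurd h.2 hi.2
    · exact h
  rw [hAD]
  set Eu : Set (PathSpace G) := {ω | X u ω = a} with hEu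
  set Ev : Set (PathSpace G) := {ω | X v ω = b} with hEv
  have hab : {ω : PathSpace G | X u ω = a ∧ X v ω = b} = Eu ∩ Ev := rfl
  rw [hab]
  have hu1 : u ∈ Set.Icc (0 : ℝ) 1 := ⟨hu, huv.trans hv⟩
  have hv1 : v ∈ Set.Icc (0 : ℝ) 1 := ⟨hu.trans huv, hv⟩
  have mEu : ∀ {I : Set ℝ}, u ∈ I → MeasurableSet[sigmaX G I] Eu := fun h =>
    measurableSet_X_eq h a
  have mEv : ∀ {I : Set ℝ}, v ∈ I → MeasurableSet[sigmaX G I] Ev := fun h =>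
    measurableSet_X_eq h b
  have mA : MeasurableSet[sigmaX G (Set.Icc 0 v)] A :=
    sigmaX_mono (Set.Icc_subset_Icc_right huv) _ hA
  have mB : MeasurableSet[sigmaX G (Set.Icc 0 v)] B :=
    sigmaX_mono (Set.Icc_subset_Icc_left hu) _ hB
  have mB' : MeasurableSet[sigmaX G (Set.Icc u 1)] B :=
    sigmaX_mono (Set.Icc_subset_Icc_right hv) _ hB
  have uv : u ∈ Set.Icc 0 v := ⟨hu, huv⟩
  have vv : v ∈ Set.Icc 0 v := ⟨hv1.1, le_rfl⟩
  have uu : u ∈ Set.Icc 0 u := ⟨hu, le_rfl⟩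
  have vu : v ∈ Set.Icc u 1 := ⟨huv, hv⟩
  -- the Markov property at `v`, for the pasts `A ∩ B ∩ Eu ∩ Ev` and `A ∩ Eu ∩ Ev`
  have m1 := hR.markov hj hv1 (B := A ∩ B ∩ Eu ∩ Ev)
    (((mA.inter mB).inter (mEu uv)).inter (mEv vv)) (fun ω h => h.2) hD
  have m2 := hR.markov hj hv1 (B := A ∩ Eu ∩ Ev)
    ((mA.inter (mEu uv)).inter (mEv vv)) (fun ω h => h.2) hD
  -- the Markov property at `u`, for the futures `B ∩ Ev` and `Ev`
  have m3 := hR.markov hj hu1 (B := A ∩ Eu) (hA.inter (mEu uu)) (fun ω h => h.2)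
    (mB'.inter (mEv vu))
  have m4 := hR.markov hj hu1 (B := A ∩ Eu) (hA.inter (mEu uu)) (fun ω h => h.2) (mEv vu)
  have s1 : A ∩ D ∩ (B ∩ (Eu ∩ Ev)) = D ∩ (A ∩ B ∩ Eu ∩ Ev) := by
    ext ω; simp only [Set.mem_inter_iff]; tauto
  have s2 : A ∩ D ∩ (Eu ∩ Ev) = D ∩ (A ∩ Eu ∩ Ev) := by
    ext ω; simp only [Set.mem_inter_iff]; tauto
  have s3 : B ∩ Ev ∩ (A ∩ Eu) = A ∩ B ∩ Eu ∩ Ev := by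
    ext ω; simp only [Set.mem_inter_iff]; tauto
  have s4 : Ev ∩ (A ∩ Eu) = A ∩ Eu ∩ Ev := by
    ext ω; simp only [Set.mem_inter_iff]; tauto
  have s5 : B ∩ Ev ∩ Eu = B ∩ (Eu ∩ Ev) := by
    ext ω; simp only [Set.mem_inter_iff]; tauto
  rw [s3, s5] at m3
  rw [s4, Set.inter_comm Ev] at m4
  rw [s1, s2]
  by_cases h0 : R.real Eu = 0
  · have h1 : R.real (Eu ∩ Ev) = 0 :=
      le_antisymm ((measureReal_mono Set.inter_subset_left).trans h0.le) measureReal_nonneg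
    have h2 : R.real (B ∩ (Eu ∩ Ev)) = 0 :=
      le_antisymm ((measureReal_mono Set.inter_subset_right).trans h1.le) measureReal_nonneg
    rw [h1, h2]
    ring
  by_cases h0' : R.real Ev = 0
  · have h1 : R.real (Eu ∩ Ev) = 0 :=
      le_antisymm ((measureReal_mono Set.inter_subset_right).trans h0'.le) measureReal_nonneg
    have h2 : R.real (B ∩ (Eu ∩ Ev)) = 0 :=
      le_antisymm ((measureReal_mono Set.inter_subset_right).trans h1.le) measureReal_nonneg
    rw [h1, h2]
    ring
  refine mul_left_cancel₀ (mul_ne_zero h0 h0') ?_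
  change R.real Ev * R.real (D ∩ (A ∩ B ∩ Eu ∩ Ev)) = _ * R.real (D ∩ Ev) at m1
  change R.real Ev * R.real (D ∩ (A ∩ Eu ∩ Ev)) = _ * R.real (D ∩ Ev) at m2
  change R.real Eu * R.real (A ∩ B ∩ Eu ∩ Ev) = _ at m3
  change R.real Eu * R.real (A ∩ Eu ∩ Ev) = _ at m4
  linear_combination R.real Eu * R.real (Eu ∩ Ev) * m1 -
    R.real Eu * R.real (B ∩ (Eu ∩ Ev)) * m2 + R.real (Eu ∩ Ev) * R.real (D ∩ Ev) * m3 -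
    R.real (B ∩ (Eu ∩ Ev)) * R.real (D ∩ Ev) * m4

lemma sigmaX_pair_eq {u v : ℝ} {f : PathSpace G → ℝ} (hf : StronglyMeasurable[sigmaX G {u, v}] f)
    {ω ω' : PathSpace G} (hu : X u ω = X u ω') (hv : X v ω = X v ω') : f ω = f ω' := by
  have hle : sigmaX G {u, v} ≤ MeasurableSpace.comap
      (fun ω : PathSpace G => (X u ω, X v ω)) ⊤ := by
    refine iSup₂_le fun t ht => ?_
    rintro _ ⟨U, -, rfl⟩
    rcases ht with rfl | rfl
    · exact ⟨Prod.fst ⁻¹' U, trivial, rfl⟩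
    · exact ⟨Prod.snd ⁻¹' U, trivial, rfl⟩
  obtain ⟨U, -, hU⟩ := hle _ (hf.measurable (measurableSet_singleton (f ω)))
  have h1 : ω' ∈ f ⁻¹' {f ω} := by
    rw [← hU, Set.mem_preimage, ← hu, ← hv, ← Set.mem_preimage (f := fun ω => (X u ω, X v ω)), hU]
    rfl
  exact h1.symm

lemma setIntegral_of_sigmaX_pair {u v : ℝ} {f : PathSpace G → ℝ}
    (hf : StronglyMeasurable[sigmaX G {u, v}] f) (a b : V) :
    ∃ c, ∀ C, MeasurableSet C → ∫ ω in C ∩ {ω | X u ω = a ∧ X v ω = b}, f ω ∂P =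
      c * P.real (C ∩ {ω | X u ω = a ∧ X v ω = b}) := by
  by_cases hne : ∃ ω : PathSpace G, X u ω = a ∧ X v ω = b
  · obtain ⟨ω₀, hu, hv⟩ := hne
    refine ⟨f ω₀, fun C hC => ?_⟩
    have hm : MeasurableSet (C ∩ {ω : PathSpace G | X u ω = a ∧ X v ω = b}) :=
      hC.inter ((measurableSet_X_eq' u a).inter (measurableSet_X_eq' v b))
    rw [setIntegral_congr_fun (g := fun _ => f ω₀) hm fun ω hω =>
      sigmaX_pair_eq hf (hω.2.1.trans hu.symm) (hω.2.2.trans hv.symm), setIntegral_const,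
      smul_eq_mul, mul_comm]
  · refine ⟨0, fun C _ => ?_⟩
    have : C ∩ {ω : PathSpace G | X u ω = a ∧ X v ω = b} = ∅ :=
      Set.eq_empty_of_forall_notMem fun ω hω => hne ⟨ω, hω.2⟩
    rw [this]
    simp

lemma isReciprocal_iff_sameBridges : IsReciprocal P ↔ SameBridges P P := by
  have hset : ∀ u v : ℝ, ∀ a b : V, ∀ {I : Set ℝ}, u ∈ I → v ∈ I →
      MeasurableSet[sigmaX G I] {ω | X u ω = a ∧ X v ω = b} := fun u v a b I hu hv =>
    (measurableSet_X_eq hu a).inter (measurableSet_X_eq hv b)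
  have hint : ∀ B : Set (PathSpace G), MeasurableSet B →
      Integrable (B.indicator fun _ => (1 : ℝ)) P := fun B hB => (integrable_const _).indicator hB
  have hone : ∀ B C : Set (PathSpace G), MeasurableSet B →
      ∫ ω in C, B.indicator (fun _ => (1 : ℝ)) ω ∂P = P.real (C ∩ B) := fun B C hB => by
    rw [setIntegral_indicator hB]
    simp
  constructor
  · intro h u v hu huv hv B C hB hC a b
    have hB' := sigmaX_le _ _ hB
    have hC' := sigmaX_le _ _ hC
    have hab := hset u v a b (I := {u, v}) (by simp) (by simp)
    have hab' := hset u v a b (I := Set.Icc 0 u ∪ Set.Icc v 1) (Or.inl ⟨hu, le_rfl⟩)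
      (Or.inr ⟨le_rfl, hv⟩)
    obtain ⟨c, hc⟩ := setIntegral_of_sigmaX_pair (P := P)
      (stronglyMeasurable_condExp (m := sigmaX G {u, v}) (μ := P)
        (f := B.indicator fun _ => (1 : ℝ))) a b
    have e1 := setIntegral_condExp (sigmaX_le (G := G) {u, v}) (hint B hB') hab
    have e2 := setIntegral_condExp (sigmaX_le (G := G) (Set.Icc 0 u ∪ Set.Icc v 1)) (hint B hB')
      (hC.inter hab')
    rw [integral_congr_ae (ae_restrict_of_ae (h u v hu huv hv B hB)), hc C hC', hone _ _ hB'] at e2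
    have h3 := hc Set.univ MeasurableSet.univ
    rw [Set.univ_inter, e1, hone _ _ hB'] at h3
    have s1 : C ∩ {ω | X u ω = a ∧ X v ω = b} ∩ B = C ∩ (B ∩ {ω | X u ω = a ∧ X v ω = b}) := by
      rw [Set.inter_assoc, Set.inter_comm B]
    rw [Set.inter_comm B, h3, ← Set.inter_comm B, ← s1, ← e2]
    ring
  · intro h u v hu huv hv B hB
    have hB' := sigmaX_le _ _ hB
    have hsm := stronglyMeasurable_condExp (m := sigmaX G {u, v}) (μ := P)
        (f := B.indicator fun _ => (1 : ℝ))
    refine (ae_eq_condExp_of_forall_setIntegral_eq (sigmaX_le _) (hint B hB')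
      (fun _ _ _ => integrable_condExp.integrableOn) (fun C hC _ => ?_) ?_).symm
    · have hC' := sigmaX_le _ _ hC
      have hU : C = ⋃ p : V × V, C ∩ {ω | X u ω = p.1 ∧ X v ω = p.2} := by
        ext ω
        simp
      have hdisj : Pairwise (Function.onFun Disjoint
          fun p : V × V => C ∩ {ω : PathSpace G | X u ω = p.1 ∧ X v ω = p.2}) := by
        intro p q hpq
        rw [Function.onFun, Set.disjoint_left]
        rintro ω ⟨-, h1, h2⟩ ⟨-, h3, h4⟩
        exact hpq (Prod.ext (h1.symm.trans h3) (h2.symm.trans h4))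
      have hmeas : ∀ p : V × V, MeasurableSet
          (C ∩ {ω : PathSpace G | X u ω = p.1 ∧ X v ω = p.2}) := fun p =>
        hC'.inter ((measurableSet_X_eq' u _).inter (measurableSet_X_eq' v _))
      rw [hU]
      rw [integral_iUnion hmeas hdisj integrable_condExp.integrableOn,
        integral_iUnion hmeas hdisj (hint B hB').integrableOn]
      refine tsum_congr fun p => ?_
      obtain ⟨c, hc⟩ := setIntegral_of_sigmaX_pair (P := P) hsm p.1 p.2
      have hab := hset u v p.1 p.2 (I := {u, v}) (by simp) (by simp)
      have e1 := setIntegral_condExp (sigmaX_le (G := G) {u, v}) (hint B hB') hab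
      have h3 := hc Set.univ MeasurableSet.univ
      rw [Set.univ_inter, e1, hone _ _ hB'] at h3
      rw [hc C hC', hone _ _ hB']
      have h4 := h u v hu huv hv B C hB hC p.1 p.2
      have s1 : C ∩ {ω | X u ω = p.1 ∧ X v ω = p.2} ∩ B =
          C ∩ (B ∩ {ω | X u ω = p.1 ∧ X v ω = p.2}) := by
        rw [Set.inter_assoc, Set.inter_comm B]
      rw [s1]
      rw [Set.inter_comm _ B] at h3
      by_cases h0 : P.real {ω | X u ω = p.1 ∧ X v ω = p.2} = 0
      · have h5 : P.real (C ∩ {ω | X u ω = p.1 ∧ X v ω = p.2}) = 0 :=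
          le_antisymm ((measureReal_mono Set.inter_subset_right).trans h0.le) measureReal_nonneg
        have h6 : P.real (C ∩ (B ∩ {ω | X u ω = p.1 ∧ X v ω = p.2})) = 0 :=
          le_antisymm ((measureReal_mono (Set.inter_subset_right.trans
            Set.inter_subset_right)).trans h0.le) measureReal_nonneg
        rw [h5, h6, mul_zero]
      · refine mul_left_cancel₀ h0 ?_
        rw [h4, h3]
        ring
    · refine (hsm.mono (sigmaX_mono ?_)).aestronglyMeasurable
      rintro t (rfl | rfl)
      · exact Or.inl ⟨hu, le_rfl⟩
      · exact Or.inr ⟨le_rfl, hv⟩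

end RandomWalk

namespace RandomWalk

variable {V : Type*} {G : SimpleGraph V}

/-! ### Jump times and visited states -/

/-- The list `[x n, …, x 1, x 0]`. -/
def walkList (x : ℕ → V) : ℕ → List V
  | 0 => [x 0]
  | n + 1 => x (n + 1) :: walkList x n

lemma walkList_eq_cons (x : ℕ → V) (n : ℕ) : ∃ l, walkList x n = x n :: l := by
  cases n with
  | zero => exact ⟨[], rfl⟩
  | succ n => exact ⟨walkList x n, rfl⟩

lemma walkList_congr {x y : ℕ → V} {n : ℕ} (h : ∀ i ≤ n, x i = y i) :
    walkList x n = walkList y n := by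
  induction n with
  | zero => simp [walkList, h 0 le_rfl]
  | succ n ih => simp only [walkList, h (n + 1) le_rfl, ih fun i hi => h i (hi.trans n.le_succ)]

lemma exists_eq_walkList (b : V) (l : List V) : ∃ x n, b :: l = walkList x n := by
  induction l generalizing b with
  | nil => exact ⟨fun _ => b, 0, rfl⟩
  | cons b' l ih =>
    obtain ⟨x, n, hx⟩ := ih b'
    refine ⟨fun i => if i = n + 1 then b else x i, n + 1, ?_⟩
    rw [hx]
    simp only [walkList, if_true]
    congr 1
    exact walkList_congr fun i hi => by rw [if_neg (by omega)]

lemma jumpTime_le_succ (t : ℝ) (i : ℕ) (ω : PathSpace G) :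
    jumpTime t i ω ≤ jumpTime t (i + 1) ω := by
  refine le_sInf ?_
  rintro _ ⟨s, rfl, -, -, h, -⟩
  exact h.le

lemma jumpTime_mono (t : ℝ) (ω : PathSpace G) : Monotone fun i => jumpTime t i ω :=
  monotone_nat_of_le_succ fun i => jumpTime_le_succ t i ω

lemma eventually_X_eq_of_const {ω : PathSpace G} {τ r : ℝ} (hτ : τ < r) {a : V}
    (h : ∀ q, τ ≤ q → q ≤ r → X q ω = a) : ∀ᶠ q in 𝓝[<] r, X q ω = X r ω := by
  filter_upwards [Ioo_mem_nhdsLT hτ] with q hq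
  rw [h q hq.1.le hq.2.le, h r hτ.le le_rfl]

lemma lt_jumpTime_succ {t s τ : ℝ} {i : ℕ} {ω : PathSpace G} (h : jumpTime t i ω = τ)
    (h0 : 0 ≤ τ) (hτ : τ ≤ s) (hs : s ≤ 1) {a : V} (hX : ∀ r, τ ≤ r → r ≤ s → X r ω = a) :
    (s : EReal) < jumpTime t (i + 1) ω := by
  obtain ⟨m, hm, hXm⟩ : ∃ m > s, ∀ r, τ ≤ r → r < m → r ≤ 1 → X r ω = a := by
    rcases hs.lt_or_eq with hs | rfl
    · obtain ⟨ε, hε, -, hε'⟩ := X_right ω (h0.trans hτ) hs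
      refine ⟨s + ε, by linarith, fun r h1 h2 _ => ?_⟩
      rcases le_total r s with h3 | h3
      · exact hX r h1 h3
      · rw [hε' r h3 h2, hX s hτ le_rfl]
    · exact ⟨2, by norm_num, fun r h1 _ h2 => hX r h1 h2⟩
  refine lt_of_lt_of_le (EReal.coe_lt_coe_iff.2 hm) (le_sInf ?_)
  rintro _ ⟨r, rfl, -, hr1, hr, hj⟩
  rw [h, EReal.coe_lt_coe_iff] at hr
  rw [EReal.coe_le_coe_iff]
  by_contra! hlt
  exact hj (eventually_X_eq_of_const hr fun q h1 h2 => hXm q h1 (h2.trans_lt hlt) (h2.trans hr1))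

/-- If exactly one jump, from `b'` to `b`, happens in `(q, s]`, then it happens at some time `σ`. -/
lemma exists_jump_of_notMem_hit2 {q s : ℝ} (hq : 0 ≤ q) (hs : s ≤ 1) (hqs : q ≤ s) {b b' : V}
    (hne : b ≠ b') {ω : PathSpace G} (h1 : X q ω = b') (h2 : X s ω = b)
    (h : ω ∉ hit2 G {b'}ᶜ {b}ᶜ q s) : ∃ σ, q < σ ∧ σ ≤ s ∧ (∀ r, q ≤ r → r < σ → X r ω = b') ∧
      ∀ r, σ ≤ r → r ≤ s → X r ω = b := by
  let S : Set ℝ := {r | q ≤ r ∧ r ≤ s ∧ X r ω ≠ b'}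
  have hsS : s ∈ S := ⟨hqs, le_rfl, by rw [h2]; exact hne⟩
  have hbdd : BddBelow S := ⟨q, fun r hr => hr.1⟩
  have hqσ : q ≤ sInf S := le_csInf ⟨s, hsS⟩ fun r hr => hr.1
  have hσs : sInf S ≤ s := csInf_le hbdd hsS
  have hlt : ∀ r, q ≤ r → r < sInf S → X r ω = b' := fun r hr hr' => by
    by_contra hX
    exact absurd (csInf_le hbdd ⟨hr, hr'.le.trans hσs, hX⟩) (not_le.2 hr')
  have hσX : X (sInf S) ω ≠ b' := by
    intro hX
    rcases hσs.lt_or_eq with hσ | hσ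
    · obtain ⟨ε, hε, -, hε'⟩ := X_right ω (hq.trans hqσ) (hσ.trans_le hs)
      obtain ⟨r, hr, hr'⟩ := exists_lt_of_csInf_lt ⟨s, hsS⟩ (show sInf S < sInf S + ε by linarith)
      exact hr.2.2 ((hε' r (csInf_le hbdd hr) hr').trans hX)
    · rw [hσ, h2] at hX
      exact hne hX
  refine ⟨sInf S, lt_of_le_of_ne hqσ fun e => hσX (by rw [← e, h1]), hσs, hlt, fun r hr hr' => ?_⟩
  by_contra hX
  exact h ⟨sInf S, r, hqσ, hr, hr', hσX, hX⟩

/-- On the event that the states `x 0, …, x n` are visited, the first `n` jump times are the times of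
entry `τ i` into them, and the next one comes after `s`. -/
lemma jumpTime_of_visits {t : ℝ} (ht : 0 ≤ t) (x : ℕ → V) (ω : PathSpace G) (n : ℕ) :
    ∀ {s : ℝ}, t ≤ s → s ≤ 1 → ω ∈ visits G t (walkList x n) s →
    (∃ τ : ℕ → ℝ, (∀ i ≤ n, jumpTime t i ω = τ i ∧ t ≤ τ i ∧ τ i ≤ s ∧ X (τ i) ω = x i) ∧
      ∀ r, τ n ≤ r → r ≤ s → X r ω = x n) ∧ (s : EReal) < jumpTime t (n + 1) ω := by
  induction n with
  | zero =>
    intro s hts hs h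
    have h' : ∀ r, t ≤ r → r ≤ s → X r ω = x 0 := h
    refine ⟨⟨fun _ => t, fun i hi => ?_, h'⟩, lt_jumpTime_succ (i := 0) rfl ht hts hs h'⟩
    obtain rfl : i = 0 := by omega
    exact ⟨rfl, le_rfl, hts, h t le_rfl hts⟩
  | succ n ih =>
    intro s hts hs h
    obtain ⟨l, hl⟩ := walkList_eq_cons x n
    rw [walkList, hl] at h
    obtain ⟨hne, q, htq, hqs, hv, hXq, hXs, hh⟩ := h
    rw [← hl] at hv
    obtain ⟨⟨τ, hτ, hτn⟩, hlt⟩ := ih htq (hqs.trans hs) hv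
    obtain ⟨σ, hqσ, hσs, hσ1, hσ2⟩ :=
      exists_jump_of_notMem_hit2 (ht.trans htq) hs hqs hne hXq hXs hh
    obtain ⟨e1, e2, e3, e4⟩ := hτ n le_rfl
    have hconst : ∀ r, τ n ≤ r → r < σ → X r ω = x n := fun r h1 h2 => by
      rcases le_total r q with h3 | h3
      · exact hτn r h1 h3
      · exact hσ1 r h3 h2
    have hσ : jumpTime t (n + 1) ω = σ := by
      refine le_antisymm (sInf_le ⟨σ, rfl, by linarith, hσs.trans hs, ?_, ?_⟩) (le_sInf ?_)
      · rw [e1, EReal.coe_lt_coe_iff]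
        linarith
      · intro hev
        obtain ⟨r, hr, hr'⟩ := (hev.and (Ioo_mem_nhdsLT hqσ)).exists
        rw [hσ1 r hr'.1.le hr'.2, hσ2 σ le_rfl hσs] at hr
        exact hne hr.symm
      · rintro _ ⟨r, rfl, -, -, hr, hj⟩
        rw [e1, EReal.coe_lt_coe_iff] at hr
        rw [EReal.coe_le_coe_iff]
        by_contra! hr'
        exact hj (eventually_X_eq_of_const hr fun q h1 h2 => hconst q h1 (h2.trans_lt hr'))
    refine ⟨⟨fun i => if i = n + 1 then σ else τ i, fun i hi => ?_, ?_⟩,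
      lt_jumpTime_succ hσ (by linarith) hσs hs hσ2⟩
    · by_cases hin : i = n + 1
      · subst hin
        simp only [if_true]
        exact ⟨hσ, by linarith, hσs, hσ2 σ le_rfl hσs⟩
      · simp only [hin, if_false]
        obtain ⟨f1, f2, f3, f4⟩ := hτ i (by omega)
        exact ⟨f1, f2, f3.trans hqs, f4⟩
    · simpa using hσ2

/-- The visited states, as the list of the values of a sequence. -/
lemma exists_visits_walkList {t s : ℝ} (ht : 0 ≤ t) (hts : t ≤ s) (hs : s ≤ 1)
    (ω : PathSpace G) : ∃ x n, ω ∈ visits G t (walkList x n) s := by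
  obtain ⟨l, hl⟩ := exists_visits ht hts hs ω
  obtain ⟨l', rfl⟩ := visits_head hts hl
  obtain ⟨x, n, hx⟩ := exists_eq_walkList (X s ω) l'
  exact ⟨x, n, hx ▸ hl⟩

lemma mem_followsWalk_iff {t h : ℝ} (ht : 0 ≤ t) (hh : 0 ≤ h) (hth : t + h ≤ 1)
    (c : ClosedWalk G) (ω : PathSpace G) :
    ω ∈ followsWalk t h c ↔ ω ∈ visits G t (walkList c.2.getVert c.2.length) (t + h) ∧
      jumpTime t c.2.length ω < ((t + h : ℝ) : EReal) := by
  have hts : t ≤ t + h := by linarith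
  constructor
  · rintro ⟨h1, h2, h3⟩
    refine ⟨?_, h2⟩
    obtain ⟨x, m, hm⟩ := exists_visits_walkList ht hts hth ω
    obtain ⟨⟨τ, hτ, -⟩, h4⟩ := jumpTime_of_visits ht x ω m hts hth hm
    have hmn : m = c.2.length := by
      rcases lt_trichotomy m c.2.length with hlt | heq | hlt
      · exact absurd (h4.trans_le (jumpTime_mono t ω hlt)) (not_lt.2 h2.le)
      · exact heq
      · have h5 : jumpTime t m ω ≤ ((t + h : ℝ) : EReal) := by
          rw [(hτ m le_rfl).1, EReal.coe_le_coe_iff]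
          exact (hτ m le_rfl).2.2.1
        exact absurd (h3.trans_le (jumpTime_mono t ω hlt)) (not_lt.2 h5)
    rw [← hmn, ← walkList_congr (x := x) fun i hi => ?_]
    · exact hm
    · obtain ⟨e1, -, -, e4⟩ := hτ i hi
      rw [← h1 i (hmn ▸ hi), e1, EReal.toReal_coe, e4]
  · rintro ⟨h1, h2⟩
    obtain ⟨⟨τ, hτ, -⟩, h4⟩ := jumpTime_of_visits ht _ ω _ hts hth h1
    refine ⟨fun i hi => ?_, h2, h4⟩
    obtain ⟨e1, -, -, e4⟩ := hτ i hi
    rw [e1, EReal.toReal_coe, e4]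

/-- A path that follows the walk makes no jump in some interval `[r, t + h]`, `r < t + h`. -/
lemma mem_followsWalk_iff_exists {t h : ℝ} (ht : 0 ≤ t) (hh : 0 < h) (hth : t + h ≤ 1)
    (c : ClosedWalk G) (ω : PathSpace G) :
    ω ∈ followsWalk t h c ↔ ω ∈ visits G t (walkList c.2.getVert c.2.length) (t + h) ∧
      ∃ m : ℕ, ω ∉ hit G {c.1}ᶜ (t + h - h / (m + 2)) (t + h) := by
  rw [mem_followsWalk_iff ht hh.le hth]
  refine and_congr_right fun hv => ?_
  have hc : c.2.getVert c.2.length = c.1 := c.2.getVert_length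
  constructor
  · intro hlt
    obtain ⟨⟨τ, hτ, hτn⟩, -⟩ := jumpTime_of_visits ht _ ω _ (by linarith) hth hv
    rw [(hτ _ le_rfl).1, EReal.coe_lt_coe_iff] at hlt
    obtain ⟨m, hm⟩ := exists_nat_gt (h / (t + h - τ c.2.length))
    refine ⟨m, notMem_hit.2 fun r h1 h2 => ?_⟩
    have hp : 0 < t + h - τ c.2.length := by linarith
    have h3 : h / ((m : ℝ) + 2) ≤ t + h - τ c.2.length := by
      rw [div_le_iff₀ (by positivity)]
      rw [div_lt_iff₀ hp] at hm
      nlinarith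
    simp only [Set.mem_compl_iff, Set.mem_singleton_iff, not_not]
    rw [hτn r (by linarith) h2, hc]
  · rintro ⟨m, hm⟩
    have h1 : h / ((m : ℝ) + 2) ≤ h := div_le_self hh.le (by
      have : (0 : ℝ) ≤ m := Nat.cast_nonneg m
      linarith)
    have h2 : 0 < h / ((m : ℝ) + 2) := by positivity
    obtain ⟨l, hl⟩ := walkList_eq_cons c.2.getVert c.2.length
    rw [hl, hc] at hv
    have hv' := visits_restrict (s := t + h - h / (m + 2)) (by linarith) hv fun r h3 h4 => by
      simpa using notMem_hit.1 hm r h3 h4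
    rw [← hc, ← hl] at hv'
    obtain ⟨⟨τ, hτ, -⟩, -⟩ := jumpTime_of_visits ht _ ω _ (by linarith) (by linarith) hv'
    rw [(hτ _ le_rfl).1, EReal.coe_lt_coe_iff]
    linarith [(hτ _ le_rfl).2.2.1]

lemma measurableSet_followsWalk [MeasurableSpace V] [DiscreteMeasurableSpace V] {t h : ℝ}
    (ht : 0 ≤ t) (hh : 0 < h) (hth : t + h ≤ 1) (c : ClosedWalk G) :
    MeasurableSet[sigmaX G (Set.Icc t (t + h))] (followsWalk t h c) := by
  have e : followsWalk t h c = visits G t (walkList c.2.getVert c.2.length) (t + h) ∩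
      ⋃ m : ℕ, (hit G {c.1}ᶜ (t + h - h / (m + 2)) (t + h))ᶜ := by
    ext ω
    rw [mem_followsWalk_iff_exists ht hh hth]
    simp
  rw [e]
  refine (measurableSet_visits ht subset_rfl (by linarith) hth).inter
    (MeasurableSet.iUnion fun m => ?_)
  have h1 : h / ((m : ℝ) + 2) ≤ h := div_le_self hh.le (by
    have : (0 : ℝ) ≤ m := Nat.cast_nonneg m
    linarith)
  have h2 : 0 < h / ((m : ℝ) + 2) := by positivity
  exact (measurableSet_hit (Set.Icc_subset_Icc_left (by linarith)) (by linarith) hth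
    (by linarith)).compl

/-- One jump in `(t, s]`, from `z` to `z'`. -/
lemma setOf_lt_jumpTime_two {t s : ℝ} (ht : 0 ≤ t) (hts : t ≤ s) (hs : s ≤ 1) {z z' : V}
    (hne : z ≠ z') : {ω : PathSpace G | X t ω = z ∧ X s ω = z' ∧ (s : EReal) < jumpTime t 2 ω} =
      visits G t [z', z] s := by
  ext ω
  constructor
  · rintro ⟨h1, h2, h3⟩
    obtain ⟨x, m, hm⟩ := exists_visits_walkList ht hts hs ω
    obtain ⟨⟨τ, hτ, -⟩, -⟩ := jumpTime_of_visits ht x ω m hts hs hm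
    have hx0 : x 0 = z := by
      obtain ⟨e1, -, -, e4⟩ := hτ 0 (Nat.zero_le _)
      have e5 : (t : EReal) = τ 0 := e1
      rw [EReal.coe_eq_coe_iff] at e5
      rw [← e4, ← e5, h1]
    have hxm : x m = z' := by
      obtain ⟨l, hl⟩ := walkList_eq_cons x m
      rw [← h2]
      exact (X_of_visits hts (hl ▸ hm)).symm
    have hm2 : m < 2 := by
      by_contra! h4
      have h5 : jumpTime t m ω ≤ (s : EReal) := by
        rw [(hτ m le_rfl).1, EReal.coe_le_coe_iff]
        exact (hτ m le_rfl).2.2.1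
      exact absurd (h3.trans_le (jumpTime_mono t ω h4)) (not_lt.2 h5)
    interval_cases m
    · exact absurd (hx0.symm.trans hxm) hne
    · simpa [walkList, hx0, hxm] using hm
  · intro h
    have h' : ω ∈ visits G t (walkList (fun i => if i = 0 then z else z') 1) s := h
    obtain ⟨⟨τ, hτ, -⟩, h4⟩ := jumpTime_of_visits ht _ ω _ hts hs h'
    refine ⟨?_, X_of_visits hts h, h4⟩
    obtain ⟨e1, -, -, e4⟩ := hτ 0 (Nat.zero_le _)
    have e5 : (t : EReal) = τ 0 := e1
    rw [EReal.coe_eq_coe_iff] at e5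
    rw [e5, e4]
    simp

lemma visits_inter_jumpTime_one {t s m : ℝ} (ht : 0 ≤ t) (htm : t ≤ m) (hms : m ≤ s) (hs : s ≤ 1)
    {z z' : V} : visits G t [z', z] s ∩ {ω | jumpTime t 1 ω ≤ (m : EReal)} =
      visits G t [z', z] m ∩ visits G m [z'] s := by
  have key : ∀ {r : ℝ} {ω : PathSpace G}, ω ∈ visits G t [z', z] r →
      ω ∈ visits G t (walkList (fun i => if i = 0 then z else z') 1) r := fun h => h
  ext ω
  constructor
  · rintro ⟨h, hm⟩
    obtain ⟨⟨τ, hτ, hτ1⟩, h4⟩ := jumpTime_of_visits ht _ ω _ (htm.trans hms) hs (key h)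
    have hm' : jumpTime t 1 ω ≤ (m : EReal) := hm
    rw [(hτ 1 le_rfl).1, EReal.coe_le_coe_iff] at hm'
    have hc : ∀ r, m ≤ r → r ≤ s → X r ω = z' := fun r h1 h2 => by
      simpa using hτ1 r (hm'.trans h1) h2
    exact ⟨visits_restrict hms h hc, hc⟩
  · rintro ⟨h, hc⟩
    refine ⟨visits_extend hms h hc, ?_⟩
    obtain ⟨⟨τ, hτ, hτ1⟩, h4⟩ := jumpTime_of_visits ht _ ω _ htm (hms.trans hs) (key h)
    change jumpTime t 1 ω ≤ (m : EReal)
    rw [(hτ 1 le_rfl).1, EReal.coe_le_coe_iff]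
    exact (hτ 1 le_rfl).2.2.1

end RandomWalk

namespace RandomWalk

/-! ### Integration of asymptotic expansions -/

/-- Only a right derivative is available, so the mean value inequality replaces integration. -/
lemma isLittleO_of_hasDerivWithinAt {f f' : ℝ → ℝ} {t S : ℝ} {n : ℕ} (htS : t < S)
    (hf : ContinuousOn f (Set.Icc t S)) (h0 : f t = 0)
    (hf' : ∀ s ∈ Set.Ico t S, HasDerivWithinAt f (f' s) (Set.Ici s) s)
    (h : f' =o[𝓝[≥] t] fun s => (s - t) ^ n) : f =o[𝓝[≥] t] fun s => (s - t) ^ (n + 1) := by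
  rw [isLittleO_iff] at h ⊢
  intro ε hε
  obtain ⟨u, hu, hsub⟩ := (mem_nhdsGE_iff_exists_Ico_subset' htS).1 (h hε)
  have hm : t < min u S := lt_min hu htS
  filter_upwards [Ico_mem_nhdsGE hm] with s hs
  have hsu : s < u := hs.2.trans_le (min_le_left _ _)
  have hsS : s < S := hs.2.trans_le (min_le_right _ _)
  have key := image_norm_le_of_norm_deriv_right_le_deriv_boundary' (f := f) (f' := f') (a := t)
    (b := s) (B := fun r => ε * ((r - t) ^ (n + 1) / (n + 1))) (B' := fun r => ε * (r - t) ^ n)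
    (hf.mono (Set.Icc_subset_Icc_right hsS.le))
    (fun r hr => hf' r ⟨hr.1, hr.2.trans hsS⟩) (by simp [h0]) (by fun_prop) (fun r _ => ?_)
    (fun r hr => ?_) (Set.right_mem_Icc.2 hs.1)
  · refine key.trans (mul_le_mul_of_nonneg_left ?_ hε.le)
    have hp : 0 ≤ (s - t) ^ (n + 1) := pow_nonneg (sub_nonneg.2 hs.1) _
    rw [Real.norm_of_nonneg hp]
    refine div_le_self hp ?_
    have : (0 : ℝ) ≤ n := Nat.cast_nonneg n
    linarith
  · have h1 := ((((hasDerivAt_id r).sub_const t).pow (n + 1)).div_const ((n : ℝ) + 1)).const_mul ε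
    refine (h1.congr_deriv ?_).hasDerivWithinAt
    have : (n : ℝ) + 1 ≠ 0 := by positivity
    simp only [id, Nat.cast_add, Nat.cast_one, add_tsub_cancel_right]
    field_simp
  · have h2 : ‖f' r‖ ≤ ε * ‖(r - t) ^ n‖ := hsub ⟨hr.1, hr.2.trans hsu⟩
    rwa [Real.norm_of_nonneg (pow_nonneg (sub_nonneg.2 hr.1) _)] at h2

lemma isLittleO_sub_of_hasDerivWithinAt {f f' : ℝ → ℝ} {t S c : ℝ} {n : ℕ} (htS : t < S)
    (hf : ContinuousOn f (Set.Icc t S)) (h0 : f t = 0)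
    (hf' : ∀ s ∈ Set.Ico t S, HasDerivWithinAt f (f' s) (Set.Ici s) s)
    (h : (fun s => f' s - c * (s - t) ^ n) =o[𝓝[≥] t] fun s => (s - t) ^ n) :
    (fun s => f s - c / (n + 1) * (s - t) ^ (n + 1)) =o[𝓝[≥] t] fun s => (s - t) ^ (n + 1) := by
  refine isLittleO_of_hasDerivWithinAt htS (hf.sub (by fun_prop)) (by simp [h0])
    (fun s hs => ?_) h
  have h1 := (((hasDerivAt_id s).sub_const t).pow (n + 1)).const_mul (c / ((n : ℝ) + 1))
  refine ((hf' s hs).sub h1.hasDerivWithinAt).congr_deriv ?_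
  have : (n : ℝ) + 1 ≠ 0 := by positivity
  simp only [id, Nat.cast_add, Nat.cast_one, add_tsub_cancel_right]
  field_simp

lemma tendsto_add_nhdsGT (t : ℝ) : Tendsto (fun h : ℝ => t + h) (𝓝[>] 0) (𝓝[≥] t) := by
  refine tendsto_nhdsWithin_iff.2 ⟨?_, ?_⟩
  · have : Tendsto (fun h : ℝ => t + h) (𝓝 0) (𝓝 (t + 0)) := (continuous_const_add t).tendsto 0
    rw [add_zero] at this
    exact this.mono_left nhdsWithin_le_nhds
  · filter_upwards [self_mem_nhdsWithin] with h hh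
    exact (lt_add_of_pos_right t hh).le

variable {V : Type*} {G : SimpleGraph V} [G.LocallyFinite] {k j : ℝ → V → V → ℝ}
variable [Countable V] [MeasurableSpace V] [DiscreteMeasurableSpace V]
variable {P Q : Measure (PathSpace G)} [IsProbabilityMeasure P] [IsProbabilityMeasure Q]

/-! ### Short-time expansion along walks -/

lemma continuousWithinAt_Ici {f : ℝ → ℝ} (hf : ContinuousOn f (Set.Ico 0 1)) {t : ℝ} (ht : 0 ≤ t)
    (ht1 : t < 1) : ContinuousWithinAt f (Set.Ici t) t := by
  refine (hf t ⟨ht, ht1⟩).mono_of_mem_nhdsWithin ?_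
  filter_upwards [Ico_mem_nhdsGE ht1] with q hq
  exact ⟨ht.trans hq.1, hq.2⟩

/-- The probability to follow `x 0 → ⋯ → x n` from the time `t` on behaves as the product of the
rates times `(s - t) ^ n / n!`. -/
lemma HasIntensity.isLittleO_visits (hQ : HasIntensity Q k) (hk : ContinuousRates G k) {t : ℝ}
    (ht : 0 ≤ t) (ht1 : t < 1) {B : Set (PathSpace G)}
    (hB : MeasurableSet[sigmaX G (Set.Icc 0 t)] B) (x : ℕ → V) (hBx : ∀ ω ∈ B, X t ω = x 0)
    (n : ℕ) (hx : ∀ i < n, x (i + 1) ≠ x i) :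
    (fun s => Q.real (B ∩ visits G t (walkList x n) s) -
      Q.real B * (∏ i ∈ Finset.range n, rate G k t (x i) (x (i + 1))) / n.factorial * (s - t) ^ n)
      =o[𝓝[≥] t] fun s => (s - t) ^ n := by
  have hS : t < (t + 1) / 2 := by linarith
  have hS1 : (t + 1) / 2 < 1 := by linarith
  have hcont : ∀ l, ContinuousOn (fun s => Q.real (B ∩ visits G t l s)) (Set.Icc t ((t + 1) / 2)) :=
    fun l => hQ.continuousOn_visits hk ht hS1 B l
  have hcw : ∀ l, Tendsto (fun s => Q.real (B ∩ visits G t l s)) (𝓝[≥] t)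
      (𝓝 (Q.real (B ∩ visits G t l t))) := fun l => by
    have := hcont l t ⟨le_rfl, hS.le⟩
    rwa [ContinuousWithinAt, nhdsWithin_Icc_eq_nhdsGE hS] at this
  induction n with
  | zero =>
    simp only [Finset.range_zero, Finset.prod_empty, mul_one, Nat.factorial_zero, Nat.cast_one,
      div_one, pow_zero, isLittleO_one_iff]
    have h1 := hcw [x 0]
    have e : B ∩ {ω | X t ω = x 0} = B := Set.inter_eq_left.2 fun ω hω => hBx ω hω
    rw [visits_singleton_self, e] at h1
    simpa [walkList] using h1.sub_const (Q.real B)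
  | succ n ih =>
    obtain ⟨l, hl⟩ := walkList_eq_cons x n
    specialize ih fun i hi => hx i (by omega)
    have hne := hx n (by omega)
    have hwl : walkList x (n + 1) = x (n + 1) :: x n :: l := by rw [walkList, hl]
    rw [hl] at ih
    rw [hwl]
    set q := fun s => Q.real (B ∩ visits G t (x (n + 1) :: x n :: l) s) with hq
    set p := fun s => Q.real (B ∩ visits G t (x n :: l) s) with hp
    set c := Q.real B * (∏ i ∈ Finset.range n, rate G k t (x i) (x (i + 1))) / n.factorial
    set κ := fun s => rate G k s (x n) (x (n + 1))
    set μ := fun s => rate G k s (x (n + 1)) (x (n + 1))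
    have hderiv : ∀ s ∈ Set.Ico t ((t + 1) / 2),
        HasDerivWithinAt q (p s * κ s + q s * μ s) (Set.Ici s) s := fun s hs =>
      hQ.hasDerivWithinAt_visits_cons hk ht hs.1 (hs.2.trans hS1) hB hne l
    have hκ : Tendsto κ (𝓝[≥] t) (𝓝 (κ t)) := continuousWithinAt_Ici (hk.rate _ _) ht ht1
    have hμ : Tendsto μ (𝓝[≥] t) (𝓝 (μ t)) := continuousWithinAt_Ici (hk.rate _ _) ht ht1
    have hq0 : q t = 0 := by simp [hq, visits_self]
    have hqt : Tendsto q (𝓝[≥] t) (𝓝 0) := hq0 ▸ hcw _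
    have hpO : p =O[𝓝[≥] t] fun s => (s - t) ^ n := by
      have h1 : (fun s => c * (s - t) ^ n) =O[𝓝[≥] t] fun s => (s - t) ^ n :=
        (isBigO_refl _ _).const_mul_left c
      have := ih.isBigO.add h1
      simpa using this
    have hpκ : (fun s => p s * κ s) =O[𝓝[≥] t] fun s => (s - t) ^ n := by
      simpa using hpO.mul (hκ.isBigO_one ℝ)
    -- the powers of `s - t` that dominate `q` are increased one by one, by integration
    have hboot : ∀ m ≤ n, q =o[𝓝[≥] t] fun s => (s - t) ^ m := by
      intro m
      induction m with
      | zero => intro _; simpa using hqt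
      | succ m ihm =>
        intro hm
        refine isLittleO_of_hasDerivWithinAt hS (hcont _) hq0 hderiv ?_
        have h1 : (fun s => (s - t) ^ n) =o[𝓝[≥] t] fun s => (s - t) ^ m := by
          have h3 : Tendsto (fun s : ℝ => s - t) (𝓝[≥] t) (𝓝 0) := by
            have : Tendsto (fun s : ℝ => s - t) (𝓝 t) (𝓝 (t - t)) :=
              (continuous_sub_right t).tendsto t
            rw [sub_self] at this
            exact this.mono_left nhdsWithin_le_nhds
          exact (isLittleO_pow_pow (𝕜 := ℝ) (show m < n by omega)).comp_tendsto h3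
        have h2 : (fun s => q s * μ s) =o[𝓝[≥] t] fun s => (s - t) ^ m := by
          simpa using (ihm (by omega)).mul_isBigO (hμ.isBigO_one ℝ)
        exact (hpκ.trans_isLittleO h1).add h2
    have hmain := isLittleO_sub_of_hasDerivWithinAt (n := n) (c := c * κ t) hS (hcont _) hq0 hderiv
      (by
        have h1 : (fun s => (p s - c * (s - t) ^ n) * κ s) =o[𝓝[≥] t] fun s => (s - t) ^ n := by
          simpa using ih.mul_isBigO (hκ.isBigO_one ℝ)
        have h2 : (fun s => q s * μ s) =o[𝓝[≥] t] fun s => (s - t) ^ n := by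
          simpa using (hboot n le_rfl).mul_isBigO (hμ.isBigO_one ℝ)
        have h3 : (fun s => c * (s - t) ^ n * (κ s - κ t)) =o[𝓝[≥] t] fun s => (s - t) ^ n := by
          have h4 : (fun s => κ s - κ t) =o[𝓝[≥] t] fun _ => (1 : ℝ) := by
            rw [isLittleO_one_iff]
            simpa using hκ.sub_const (κ t)
          simpa using ((isBigO_refl (fun s : ℝ => (s - t) ^ n) _).const_mul_left c).mul_isLittleO h4
        refine ((h1.add h2).add h3).congr_left fun s => ?_
        ring)
    refine hmain.congr_left fun s => ?_
    rw [Finset.prod_range_succ, Nat.factorial_succ]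
    simp only [c, κ]
    push_cast
    have : (n : ℝ) + 1 ≠ 0 := by positivity
    have h2 : (n.factorial : ℝ) ≠ 0 := by positivity
    field_simp

/-- Almost surely, no jump occurs at the given time `t + h`. -/
lemma HasIntensity.real_followsWalk (hQ : HasIntensity Q k) (hk : ContinuousRates G k) {t h : ℝ}
    (ht : 0 ≤ t) (hh : 0 < h) (hth : t + h < 1) (c : ClosedWalk G) (D : Set (PathSpace G)) :
    Q.real (D ∩ followsWalk t h c) =
      Q.real (D ∩ visits G t (walkList c.2.getVert c.2.length) (t + h)) := by
  obtain ⟨C, hC⟩ := hQ.exists_lipschitz hk c.1 hth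
  have hc : c.2.getVert c.2.length = c.1 := c.2.getVert_length
  have hsub : D ∩ followsWalk t h c ⊆
      D ∩ visits G t (walkList c.2.getVert c.2.length) (t + h) := by
    rintro ω ⟨h1, h2⟩
    exact ⟨h1, ((mem_followsWalk_iff_exists ht hh hth.le c ω).1 h2).1⟩
  refine le_antisymm (measureReal_mono hsub) ?_
  set E := (D ∩ visits G t (walkList c.2.getVert c.2.length) (t + h)) \ (D ∩ followsWalk t h c)
    with hE
  have hbound : ∀ m : ℕ, Q.real E ≤ C * (h / (m + 2)) := by
    intro m
    have h1 : h / ((m : ℝ) + 2) ≤ h := div_le_self hh.le (by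
      have : (0 : ℝ) ≤ m := Nat.cast_nonneg m
      linarith)
    have h2 : 0 < h / ((m : ℝ) + 2) := by positivity
    have h3 := hC (t + h - h / (m + 2)) (t + h) (by linarith) (by linarith) le_rfl E ∅
      fun ω g1 g2 => ?_
    · rw [measureReal_empty, sub_zero, abs_of_nonneg measureReal_nonneg] at h3
      linarith [h3]
    · simp only [Set.mem_empty_iff_false, iff_false]
      rintro ⟨⟨h5, h6⟩, h7⟩
      refine h7 ⟨h5, (mem_followsWalk_iff_exists ht hh hth.le c ω).2 ⟨h6, m, ?_⟩⟩
      obtain ⟨l, hl⟩ := walkList_eq_cons c.2.getVert c.2.length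
      rw [hl, hc] at h6
      have h8 := X_of_visits (by linarith) h6
      rw [notMem_hit]
      intro r hr hr'
      simp only [Set.mem_compl_iff, Set.mem_singleton_iff, not_not]
      by_cases h9 : X (t + h - h / (m + 2)) ω = c.1
      · exact g1 h9 r hr hr'
      · exact absurd h8 (g2 h9 (t + h) (by linarith) le_rfl)
  have hE0 : Q.real E ≤ 0 := by
    have hlim : Tendsto (fun m : ℕ => C * (h / ((m : ℝ) + 2))) atTop (𝓝 (C * 0)) := by
      refine Tendsto.const_mul C (Tendsto.div_atTop tendsto_const_nhds ?_)
      exact tendsto_atTop_add_const_right _ _ tendsto_natCast_atTop_atTop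
    rw [mul_zero] at hlim
    exact ge_of_tendsto' hlim hbound
  have h1 : D ∩ visits G t (walkList c.2.getVert c.2.length) (t + h) ⊆
      (D ∩ followsWalk t h c) ∪ E := by
    intro ω hω
    by_cases hf : ω ∈ D ∩ followsWalk t h c
    · exact Or.inl hf
    · exact Or.inr ⟨hω, hf⟩
  have := (measureReal_mono (μ := Q) h1).trans (measureReal_union_le _ _)
  linarith

lemma tendsto_real_X_add {t : ℝ} (a b : V) : Tendsto
    (fun h => Q.real {ω | X t ω = a ∧ X (t + h) ω = b}) (𝓝[>] 0)
    (𝓝 (Q.real {ω | X t ω = a ∧ X t ω = b})) := by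
  refine tendsto_measureReal_of_eventually
    (fun s => (measurableSet_X_eq' t a).inter (measurableSet_X_eq' _ b)) fun ω => ?_
  have h1 : Tendsto (fun h : ℝ => t + h) (𝓝[>] 0) (𝓝[>] t) := by
    refine tendsto_nhdsWithin_iff.2 ⟨(tendsto_add_nhdsGT t).mono_right nhdsWithin_le_nhds, ?_⟩
    filter_upwards [self_mem_nhdsWithin] with h hh
    exact lt_add_of_pos_right t hh
  filter_upwards [h1.eventually (eventually_X_eq ω t)] with s hs
  simp [hs]

lemma measureReal_cond {Ω : Type*} [MeasurableSpace Ω] {μ : Measure Ω} {A : Set Ω}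
    (hA : MeasurableSet A) (B : Set Ω) : (μ[|A]).real B = (μ.real A)⁻¹ * μ.real (A ∩ B) := by
  simp [measureReal_def, cond_apply hA, ENNReal.toReal_mul, ENNReal.toReal_inv]

/-- The expansion along a closed walk holds for a walk with intensity `k`, with the
characteristic of `k`. -/
lemma HasIntensity.walkExpansion (hQ : HasIntensity Q k) (hk : ContinuousRates G k) {t : ℝ}
    (ht : 0 ≤ t) (ht1 : t < 1) (c : ClosedWalk G) (hpos : Q.real {ω | X t ω = c.1} ≠ 0) :
    WalkExpansion Q k t c := by
  set B : Set (PathSpace G) := {ω | X t ω = c.1} with hB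
  have hmB : MeasurableSet[sigmaX G (Set.Icc 0 t)] B :=
    measurableSet_X_eq (Set.right_mem_Icc.2 ht) _
  have h1 := hQ.isLittleO_visits hk ht ht1 hmB c.2.getVert (fun ω hω => by
    rw [c.2.getVert_zero]; exact hω) c.2.length
    (fun i hi => (c.2.adj_getVert_succ hi).ne.symm)
  have hprod : ∏ i ∈ Finset.range c.2.length, rate G k t (c.2.getVert i) (c.2.getVert (i + 1)) =
      walkChar k t c := Finset.prod_congr rfl fun i hi =>
    rate_of_adj (c.2.adj_getVert_succ (Finset.mem_range.1 hi))
  rw [hprod] at h1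
  have h2 := h1.comp_tendsto (tendsto_add_nhdsGT t)
  simp only [Function.comp_def, add_sub_cancel_left] at h2
  set A := fun h : ℝ => {ω : PathSpace G | X t ω = c.1 ∧ X (t + h) ω = c.1} with hA
  have hAt : Tendsto (fun h => Q.real (A h)) (𝓝[>] 0) (𝓝 (Q.real B)) := by
    have := tendsto_real_X_add (Q := Q) (t := t) c.1 c.1
    simpa only [and_self] using this
  have hinv : Tendsto (fun h => (Q.real (A h))⁻¹) (𝓝[>] 0) (𝓝 (Q.real B)⁻¹) := hAt.inv₀ hpos
  set χ := walkChar k t c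
  set n := c.2.length
  set N := fun h : ℝ => Q.real (B ∩ visits G t (walkList c.2.getVert n) (t + h)) with hN
  have h3 : (fun h => (Q.real (A h))⁻¹ * (N h - Q.real B * χ / n.factorial * h ^ n))
      =o[𝓝[>] 0] fun h => h ^ n := by
    simpa using (hinv.isBigO_one ℝ).mul_isLittleO h2
  have h4 : (fun h => ((Q.real (A h))⁻¹ - (Q.real B)⁻¹) * (Q.real B * χ / n.factorial * h ^ n))
      =o[𝓝[>] 0] fun h => h ^ n := by
    have h5 : (fun h => (Q.real (A h))⁻¹ - (Q.real B)⁻¹) =o[𝓝[>] 0] fun _ => (1 : ℝ) := by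
      rw [isLittleO_one_iff]
      simpa using hinv.sub_const (Q.real B)⁻¹
    simpa using h5.mul_isBigO ((isBigO_refl (fun h : ℝ => h ^ n) _).const_mul_left
      (Q.real B * χ / n.factorial))
  refine ((h3.add h4).congr' ?_ EventuallyEq.rfl)
  filter_upwards [Ioo_mem_nhdsGT (show 0 < 1 - t by linarith)] with h hh
  have hth : t + h < 1 := by linarith [hh.2]
  have hmA : MeasurableSet (A h) := (measurableSet_X_eq' t _).inter (measurableSet_X_eq' _ _)
  have hAB : A h ∩ followsWalk t h c = B ∩ followsWalk t h c := by
    ext ω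
    refine ⟨fun g => ⟨g.1.1, g.2⟩, fun g => ⟨⟨g.1, ?_⟩, g.2⟩⟩
    have g2 := ((mem_followsWalk_iff_exists ht hh.1 hth.le c ω).1 g.2).1
    obtain ⟨l, hl⟩ := walkList_eq_cons c.2.getVert n
    rw [hl] at g2
    rw [X_of_visits (by linarith [hh.1]) g2]
    exact c.2.getVert_length
  have hcond : (Q[|A h]).real (followsWalk t h c) = (Q.real (A h))⁻¹ * N h := by
    rw [measureReal_cond hmA, hAB, hQ.real_followsWalk hk ht hh.1 hth]
  rw [hcond]
  field_simp
  ring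

/-- For two closed-walk expansions of the same measure, the characteristics agree. -/
lemma WalkExpansion.walkChar_eq {t : ℝ} {c : ClosedWalk G} (h : WalkExpansion Q k t c)
    (h' : WalkExpansion Q j t c) : walkChar k t c = walkChar j t c := by
  have h1 := h'.sub h
  set n := c.2.length
  have h2 : (fun h : ℝ => (walkChar k t c - walkChar j t c) / n.factorial * h ^ n)
      =o[𝓝[>] 0] fun h => h ^ n := h1.congr_left fun s => by ring
  have h3 := h2.mul_isBigO (isBigO_refl (fun h : ℝ => (h ^ n)⁻¹) (𝓝[>] 0))
  have h4 : (fun _ : ℝ => (walkChar k t c - walkChar j t c) / (n.factorial : ℝ))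
      =o[𝓝[>] 0] fun _ => (1 : ℝ) := by
    refine h3.congr' ?_ ?_ <;>
    · filter_upwards [self_mem_nhdsWithin] with h hh
      have : h ^ n ≠ 0 := pow_ne_zero _ (ne_of_gt hh)
      field_simp
  rw [isLittleO_one_iff] at h4
  have h5 := tendsto_nhds_unique h4 tendsto_const_nhds
  have h6 : (n.factorial : ℝ) ≠ 0 := by positivity
  have h7 := h5.symm
  rw [div_eq_zero_iff] at h7
  exact sub_eq_zero.1 (h7.resolve_right h6)

lemma ArcExpansion.arcChar_eq {t : ℝ} {z z' : V} (h : ArcExpansion Q k t z z')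
    (h' : ArcExpansion Q j t z z') : arcChar G k t z z' = arcChar G j t z z' := by
  have h1 := h.sub h'
  have h2 : (fun h : ℝ => (arcChar G k t z z' - arcChar G j t z z') / 8 * h)
      =o[𝓝[>] 0] fun h => h := h1.congr_left fun s => by ring
  have h3 := h2.mul_isBigO (isBigO_refl (fun h : ℝ => h⁻¹) (𝓝[>] 0))
  have h4 : (fun _ : ℝ => (arcChar G k t z z' - arcChar G j t z z') / 8)
      =o[𝓝[>] 0] fun _ => (1 : ℝ) := by
    refine h3.congr' ?_ ?_ <;>
    · filter_upwards [self_mem_nhdsWithin] with h hh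
      have : h ≠ 0 := ne_of_gt hh
      field_simp
  rw [isLittleO_one_iff] at h4
  have h5 := tendsto_nhds_unique h4 tendsto_const_nhds
  linarith

end RandomWalk

namespace RandomWalk

/-! ### Probability to stay, positivity -/

lemma exists_primitive {a : ℝ → ℝ} {t S : ℝ} (h : t ≤ S) (ha : ContinuousOn a (Set.Icc t S)) :
    ∃ A : ℝ → ℝ, A t = 0 ∧ ∀ s ∈ Set.Icc t S, HasDerivAt A (a s) s := by
  have hc : Continuous (Set.IccExtend h ((Set.Icc t S).domRestrict a)) :=
    (continuousOn_iff_continuous_domRestrict.1 ha).Icc_extend'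
  refine ⟨fun s => ∫ q in t..s, Set.IccExtend h ((Set.Icc t S).domRestrict a) q, by simp,
    fun s hs => ?_⟩
  have h1 := (hc.integral_hasStrictDerivAt t s).hasDerivAt
  rwa [Set.IccExtend_of_mem _ _ hs] at h1

variable {V : Type*} {G : SimpleGraph V} [G.LocallyFinite] {k j : ℝ → V → V → ℝ}
variable [Countable V] [MeasurableSpace V] [DiscreteMeasurableSpace V]
variable {P Q R : Measure (PathSpace G)} [IsProbabilityMeasure P] [IsProbabilityMeasure Q]
  [IsProbabilityMeasure R]

/-- The probability to stay in `b` during `[r, s]` is the exponential of the integral of the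
diagonal entry of the generator. -/
lemma HasIntensity.real_stay (hQ : HasIntensity Q k) (hk : ContinuousRates G k) {r s : ℝ}
    (hr : 0 ≤ r) (hrs : r ≤ s) (hs : s < 1) {b : V} {A : ℝ → ℝ}
    (hA : ∀ q ∈ Set.Icc r s, HasDerivAt A (rate G k q b b) q) {D : Set (PathSpace G)}
    (hD : MeasurableSet[sigmaX G (Set.Icc 0 r)] D) (hDb : ∀ ω ∈ D, X r ω = b) :
    Q.real (D ∩ visits G r [b] s) = Q.real D * Real.exp (A s - A r) := by
  have hcA : ContinuousOn A (Set.Icc r s) := fun q hq => (hA q hq).continuousAt.continuousWithinAt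
  have e : D ∩ {ω | X r ω = b} = D := Set.inter_eq_left.2 hDb
  refine eqOn_of_linear_ode (p := fun _ => 0) (a := fun q => rate G k q b b)
    (f := fun q => Q.real (D ∩ visits G r [b] q))
    (g := fun q => Q.real D * Real.exp (A q - A r))
    ((hk.rate b b).mono fun q hq => ⟨hr.trans hq.1, hq.2.trans_lt hs⟩)
    (hQ.continuousOn_visits hk hr hs D [b]) (by fun_prop) (fun q hq => ?_) (fun q hq => ?_) ?_
    (Set.right_mem_Icc.2 hrs)
  · simpa using hQ.hasDerivWithinAt_visits_singleton hk hr hq.1 (hq.2.trans hs) hD b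
  · have h1 := (((hA q (Set.Ico_subset_Icc_self hq)).sub_const (A r)).exp.const_mul (Q.real D))
    refine (h1.congr_deriv ?_).hasDerivWithinAt
    ring
  · simp [visits_singleton_self, e]

lemma HasIntensity.pos_stay (hQ : HasIntensity Q k) (hk : ContinuousRates G k) {r s : ℝ}
    (hr : 0 ≤ r) (hrs : r ≤ s) (hs : s < 1) {b : V} {D : Set (PathSpace G)}
    (hD : MeasurableSet[sigmaX G (Set.Icc 0 r)] D) (hDb : ∀ ω ∈ D, X r ω = b)
    (hpos : 0 < Q.real D) : 0 < Q.real (D ∩ {ω | X s ω = b}) := by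
  obtain ⟨A, -, hA⟩ := exists_primitive hrs
    ((hk.rate b b).mono fun q hq => ⟨hr.trans hq.1, hq.2.trans_lt hs⟩)
  have h1 := hQ.real_stay hk hr hrs hs hA hD hDb
  have h2 : 0 < Q.real (D ∩ visits G r [b] s) := by rw [h1]; positivity
  exact h2.trans_le (measureReal_mono (Set.inter_subset_inter_right _ fun ω hω =>
    X_of_visits hrs hω))

lemma HasIntensity.pos_step (hQ : HasIntensity Q k) (hk : ContinuousRates G k) {r s : ℝ}
    (hr : 0 ≤ r) (hrs : r < s) (hs : s < 1) {z z' : V} (h : G.Adj z z') (hkr : 0 < k r z z')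
    {D : Set (PathSpace G)} (hD : MeasurableSet[sigmaX G (Set.Icc 0 r)] D)
    (hDz : ∀ ω ∈ D, X r ω = z) (hpos : 0 < Q.real D) : 0 < Q.real (D ∩ {ω | X s ω = z'}) := by
  have h1 := hQ.hasDerivWithinAt_real hk hr (hrs.trans hs) hD hDz z'
  rw [rate_of_adj h] at h1
  have h0 : Q.real (D ∩ {ω | X r ω = z'}) = 0 := by
    have : D ∩ {ω | X r ω = z'} = ∅ := by
      ext ω
      simp only [Set.mem_inter_iff, Set.mem_ofPred_eq, Set.mem_empty_iff_false, iff_false, not_and]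
      exact fun g1 g2 => h.ne ((hDz ω g1).symm.trans g2)
    rw [this, measureReal_empty]
  have h2 := (hasDerivWithinAt_iff_tendsto_slope' Set.self_notMem_Ioi).1 h1.Ioi_of_Ici
  have h3 : ∀ᶠ q in 𝓝[>] r, 0 < Q.real (D ∩ {ω | X q ω = z'}) := by
    filter_upwards [h2.eventually_const_lt (mul_pos hpos hkr), self_mem_nhdsWithin] with q hq hq'
    rw [slope_def_field, h0, sub_zero] at hq
    exact (div_pos_iff_of_pos_right (sub_pos.2 hq')).1 hq
  obtain ⟨q, hq, hq'⟩ := (h3.and (Ioo_mem_nhdsGT hrs)).exists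
  have h4 := hQ.pos_stay hk (hr.trans hq'.1.le) hq'.2.le hs
    ((sigmaX_mono (Set.Icc_subset_Icc_right hq'.1.le) _ hD).inter
      (measurableSet_X_eq (Set.right_mem_Icc.2 (hr.trans hq'.1.le)) z')) (fun ω hω => hω.2) hq
  exact h4.trans_le (measureReal_mono fun ω hω => ⟨hω.1.1, hω.2⟩)

lemma HasIntensity.pos_of_walk (hQ : HasIntensity Q k) (hk : ContinuousRates G k) {z z' : V}
    (p : G.Walk z z') : ∀ {r s : ℝ}, 0 ≤ r → r < s → s < 1 →
    (∀ q, r ≤ q → q < s → ∀ a b, G.Adj a b → 0 < k q a b) → ∀ {D : Set (PathSpace G)},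
    MeasurableSet[sigmaX G (Set.Icc 0 r)] D → (∀ ω ∈ D, X r ω = z) → 0 < Q.real D →
    0 < Q.real (D ∩ {ω | X s ω = z'}) := by
  induction p with
  | nil => exact fun hr hrs hs _ _ hD hDz hpos => hQ.pos_stay hk hr hrs.le hs hD hDz hpos
  | cons h p ih =>
    intro r s hr hrs hs hkpos D hD hDz hpos
    have h1 : r < (r + s) / 2 := by linarith
    have h2 : (r + s) / 2 < s := by linarith
    have h3 := hQ.pos_step hk hr h1 (h2.trans hs) h (hkpos r le_rfl hrs _ _ h) hD hDz hpos
    have h4 := ih (hr.trans h1.le) h2 hs (fun q hq => hkpos q (h1.le.trans hq))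
      ((sigmaX_mono (Set.Icc_subset_Icc_right h1.le) _ hD).inter
        (measurableSet_X_eq (Set.right_mem_Icc.2 (hr.trans h1.le)) _)) (fun ω hω => hω.2) h3
    exact h4.trans_le (measureReal_mono fun ω hω => ⟨hω.1.1, hω.2⟩)

lemma IsReferenceIntensity.continuousRates (hj : IsReferenceIntensity G j) :
    ContinuousRates G j :=
  fun z z' h => (hj.contDiffOn z z' h).continuousOn.mono Set.Ico_subset_Icc_self

/-- A walk with a reference intensity reaches all states in any time, the final time `1`
included. -/
lemma IsReferenceIntensity.real_inter_pos (hj : IsReferenceIntensity G j) (hR : HasIntensity R j)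
    (hconn : G.Connected) {r s : ℝ} (hr : 0 ≤ r) (hrs : r < s) (hs : s ≤ 1) {z : V} (z' : V)
    {D : Set (PathSpace G)} (hD : MeasurableSet[sigmaX G (Set.Icc 0 r)] D)
    (hDz : ∀ ω ∈ D, X r ω = z) (hpos : 0 < R.real D) : 0 < R.real (D ∩ {ω | X s ω = z'}) := by
  have hk := hj.continuousRates
  obtain ⟨p⟩ := hconn.preconnected z z'
  have hlt : ∀ s', r < s' → s' < 1 → 0 < R.real (D ∩ {ω | X s' ω = z'}) := fun s' h1 h2 =>
    hR.pos_of_walk hk p hr h1 h2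
      (fun q hq hq' a b => hj.pos q ⟨hr.trans hq, (hq'.trans h2).le⟩ a b) hD hDz hpos
  rcases hs.lt_or_eq with hs | rfl
  · exact hlt s hrs hs
  set m := (r + 1) / 2 with hm
  have h1 : r < m := by linarith
  have h2 : m < 1 := by linarith
  have hm0 : 0 ≤ m := hr.trans h1.le
  have hcont : ContinuousOn (fun q => rate G j q z' z') (Set.Icc m 1) := by
    simp only [rate_self, totalRate]
    refine (continuousOn_finsetSum _ fun b hb => ?_).neg
    exact (hj.contDiffOn z' b ((G.mem_neighborFinset _ _).1 hb)).continuousOn.mono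
      (Set.Icc_subset_Icc_left hm0)
  obtain ⟨A, -, hA⟩ := exists_primitive h2.le hcont
  set E := D ∩ {ω | X m ω = z'} with hE
  have hmE : MeasurableSet[sigmaX G (Set.Icc 0 m)] E :=
    (sigmaX_mono (Set.Icc_subset_Icc_right h1.le) _ hD).inter
      (measurableSet_X_eq (Set.right_mem_Icc.2 hm0) _)
  have hE1 : Tendsto (fun q => R.real (E ∩ {ω | X q ω = z'})) (𝓝[<] 1)
      (𝓝 (R.real (E ∩ {ω | X 1 ω = z'}))) := tendsto_real_X_one E (sigmaX_le _ _ hmE) z'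
  have hA1 : Tendsto (fun q => R.real E * Real.exp (A q - A m)) (𝓝[<] 1)
      (𝓝 (R.real E * Real.exp (A 1 - A m))) := by
    have := (hA 1 (Set.right_mem_Icc.2 h2.le)).continuousAt.tendsto
    exact ((((this.sub_const (A m)).rexp).const_mul _).mono_left nhdsWithin_le_nhds)
  have h3 : R.real E * Real.exp (A 1 - A m) ≤ R.real (E ∩ {ω | X 1 ω = z'}) := by
    refine le_of_tendsto_of_tendsto hA1 hE1 ?_
    filter_upwards [Ioo_mem_nhdsLT h2] with q hq
    rw [← hR.real_stay hk hm0 hq.1.le hq.2 (fun p hp => hA p ⟨hp.1, hp.2.trans hq.2.le⟩) hmE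
      (fun ω hω => hω.2)]
    exact measureReal_mono (Set.inter_subset_inter_right _ fun ω hω => X_of_visits hq.1.le hω)
  have h4 : 0 < R.real E := hlt m h1 h2
  calc 0 < R.real E * Real.exp (A 1 - A m) := by positivity
    _ ≤ _ := h3
    _ ≤ R.real (D ∩ {ω | X 1 ω = z'}) := measureReal_mono fun ω hω => ⟨hω.1.1, hω.2⟩

/-! ### Short-time expansion of the jump time along an arc -/

lemma isLittleO_pow_nhdsGT {m n : ℕ} (h : m < n) :
    (fun x : ℝ => x ^ n) =o[𝓝[>] 0] fun x => x ^ m :=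
  (isLittleO_pow_pow (𝕜 := ℝ) h).mono nhdsWithin_le_nhds

/-- The value at the midpoint of a function that vanishes at `t`, relatively to its value at
the end, up to second order. -/
lemma isLittleO_midpoint_ratio {g : ℝ → ℝ} {t g₀ χ : ℝ} (hg₀ : g₀ ≠ 0)
    (hg : (fun s => g s - (g₀ * (s - t) + g₀ * χ / 2 * (s - t) ^ 2)) =o[𝓝[≥] t]
      fun s => (s - t) ^ 2) :
    (fun h => g (t + h / 2) / g (t + h) - (1 / 2 - h / 8 * χ)) =o[𝓝[>] 0] fun h : ℝ => h := by
  have hhalf : Tendsto (fun h : ℝ => h / 2) (𝓝[>] 0) (𝓝[>] 0) := by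
    refine tendsto_nhdsWithin_iff.2 ⟨?_, ?_⟩
    · have : Tendsto (fun h : ℝ => h / 2) (𝓝 0) (𝓝 (0 / 2)) := tendsto_id.div_const 2
      rw [zero_div] at this
      exact this.mono_left nhdsWithin_le_nhds
    · filter_upwards [self_mem_nhdsWithin] with h hh
      exact half_pos (a := h) hh
  have e1 := hg.comp_tendsto (tendsto_add_nhdsGT t)
  have e2 := e1.comp_tendsto hhalf
  simp only [Function.comp_def, add_sub_cancel_left] at e1 e2
  have e2' : (fun h => g (t + h / 2) - (g₀ * (h / 2) + g₀ * χ / 2 * (h / 2) ^ 2)) =o[𝓝[>] 0]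
      fun h : ℝ => h ^ 2 := by
    refine e2.trans_isBigO (IsBigO.of_bound 1 (Eventually.of_forall fun h => ?_))
    simp only [norm_pow, norm_div, Real.norm_eq_abs, one_mul, sq_abs, div_pow]
    norm_num
    nlinarith [sq_nonneg h]
  have hb : Tendsto (fun h : ℝ => 1 / 2 - h / 8 * χ) (𝓝[>] 0) (𝓝 (1 / 2)) := by
    have : Tendsto (fun h : ℝ => 1 / 2 - h / 8 * χ) (𝓝 0) (𝓝 (1 / 2 - 0 / 8 * χ)) :=
      Continuous.tendsto (by fun_prop) 0
    simp only [zero_div, zero_mul, sub_zero] at this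
    exact this.mono_left nhdsWithin_le_nhds
  have e3 : (fun h => g (t + h / 2) - (1 / 2 - h / 8 * χ) * g (t + h)) =o[𝓝[>] 0]
      fun h : ℝ => h ^ 2 := by
    have h1 : (fun h => (1 / 2 - h / 8 * χ) * (g (t + h) - (g₀ * h + g₀ * χ / 2 * h ^ 2)))
        =o[𝓝[>] 0] fun h : ℝ => h ^ 2 := by
      simpa using (hb.isBigO_one ℝ).mul_isLittleO e1
    have h2 : (fun h : ℝ => g₀ * χ ^ 2 / 16 * h ^ 3) =o[𝓝[>] 0] fun h : ℝ => h ^ 2 :=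
      (isLittleO_pow_nhdsGT (by norm_num)).const_mul_left _
    refine ((e2'.sub h1).add h2).congr_left fun h => ?_
    ring
  have e4 : Tendsto (fun h => g (t + h) / h) (𝓝[>] 0) (𝓝 g₀) := by
    have h1 : (fun h => g (t + h) - g₀ * h) =o[𝓝[>] 0] fun h : ℝ => h := by
      have h2 : (fun h : ℝ => h ^ 2) =o[𝓝[>] 0] fun h : ℝ => h := by
        simpa using isLittleO_pow_nhdsGT (m := 1) (n := 2) (by norm_num)
      refine ((e1.trans h2).add (h2.const_mul_left (g₀ * χ / 2))).congr_left fun h => ?_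
      ring
    have h3 := (isLittleO_iff_tendsto' (by
      filter_upwards [self_mem_nhdsWithin] with h hh h0
      exact absurd h0 (ne_of_gt hh))).1 h1
    have h4 := h3.add_const g₀
    rw [zero_add] at h4
    refine h4.congr' ?_
    filter_upwards [self_mem_nhdsWithin] with h hh
    have : h ≠ 0 := ne_of_gt hh
    field_simp
    ring
  have e5 : (fun h => (g (t + h) / h)⁻¹) =O[𝓝[>] 0] fun _ => (1 : ℝ) :=
    (e4.inv₀ hg₀).isBigO_one ℝ
  have e6 : (fun h : ℝ => h⁻¹ * (g (t + h / 2) - (1 / 2 - h / 8 * χ) * g (t + h))) =o[𝓝[>] 0]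
      fun h : ℝ => h⁻¹ * h ^ 2 := (isBigO_refl _ _).mul_isLittleO e3
  refine (e5.mul_isLittleO e6).congr' ?_ ?_
  · filter_upwards [self_mem_nhdsWithin, e4.eventually_ne hg₀] with h hh h0
    have h1 : h ≠ 0 := ne_of_gt hh
    have h2 : g (t + h) ≠ 0 := fun h3 => h0 (by rw [h3, zero_div])
    field_simp
  · filter_upwards [self_mem_nhdsWithin] with h hh
    have h1 : h ≠ 0 := ne_of_gt hh
    field_simp

/-- The expansion along an arc holds for a walk with intensity `k`, with the characteristic
of `k`: up to a factor, the probability that the jump occurs before `s` is the integral of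
the function `w` below, whose logarithmic derivative at `t` is the characteristic. -/
lemma HasIntensity.arcExpansion (hQ : HasIntensity Q k) (hk : ContinuousRates G k) {t : ℝ}
    (ht : 0 ≤ t) (ht1 : t < 1) {z z' : V} (hadj : G.Adj z z') {κ' : ℝ}
    (hκ : HasDerivAt (fun s => k s z z') κ' t) (hκ0 : k t z z' ≠ 0)
    (hpos : Q.real {ω | X t ω = z} ≠ 0) : ArcExpansion Q k t z z' := by
  have hS : t < (t + 1) / 2 := by linarith
  have hS1 : (t + 1) / 2 < 1 := by linarith
  have hsub : Set.Icc t ((t + 1) / 2) ⊆ Set.Ico 0 1 :=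
    fun q hq => ⟨ht.trans hq.1, hq.2.trans_lt hS1⟩
  obtain ⟨L, hL0, hL⟩ := exists_primitive hS.le ((hk.rate z z).mono hsub)
  obtain ⟨A, hA0, hA⟩ := exists_primitive hS.le ((hk.rate z' z').mono hsub)
  have hcA : ContinuousOn A (Set.Icc t ((t + 1) / 2)) :=
    fun q hq => (hA q hq).continuousAt.continuousWithinAt
  set B : Set (PathSpace G) := {ω | X t ω = z} with hB
  have hmB : MeasurableSet[sigmaX G (Set.Icc 0 t)] B :=
    measurableSet_X_eq (Set.right_mem_Icc.2 ht) _
  have hBv : ∀ s, B ∩ visits G t [z', z] s = visits G t [z', z] s := fun s =>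
    Set.inter_eq_right.2 fun ω hω => by
      obtain ⟨-, q, h1, -, h3, -⟩ := hω
      exact h3 t le_rfl h1
  set D := fun s => Q.real (visits G t [z', z] s) with hD
  set g := fun s => D s * Real.exp (-A s) with hg
  set w := fun s => Q.real B * Real.exp (L s) * k s z z' * Real.exp (-A s) with hw
  set χ := arcChar G k t z z' with hχ
  have hderiv : ∀ s ∈ Set.Ico t ((t + 1) / 2), HasDerivWithinAt g (w s) (Set.Ici s) s := by
    intro s hs
    have h1 := hQ.hasDerivWithinAt_visits_cons hk ht hs.1 (hs.2.trans hS1) hmB hadj.ne.symm []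
    simp only [hBv] at h1
    rw [hQ.real_stay hk ht hs.1 (hs.2.trans hS1) (fun q hq => hL q ⟨hq.1, hq.2.trans hs.2.le⟩) hmB
      (fun ω hω => hω), hL0, sub_zero, rate_of_adj hadj] at h1
    have h2 := (hA s (Set.Ico_subset_Icc_self hs)).neg.exp.hasDerivWithinAt (s := Set.Ici s)
    refine (h1.mul h2).congr_deriv ?_
    simp only [hw, Pi.neg_apply]
    ring
  have hcD : ContinuousOn D (Set.Icc t ((t + 1) / 2)) := by
    have := hQ.continuousOn_visits hk ht hS1 B [z', z]
    simpa only [hBv] using this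
  have hcg : ContinuousOn g (Set.Icc t ((t + 1) / 2)) := hcD.mul (hcA.neg.rexp)
  have hg0 : g t = 0 := by simp [hg, hD, visits_self]
  have hwt : w t = Q.real B * k t z z' := by simp [hw, hL0, hA0]
  have hg₀ : w t ≠ 0 := by rw [hwt]; exact mul_ne_zero hpos hκ0
  have hwd : HasDerivAt w (w t * χ) t := by
    have htm := Set.left_mem_Icc.2 hS.le
    have h1 := (((hL t htm).exp.const_mul (Q.real B)).mul hκ).mul (hA t htm).neg.exp
    refine h1.congr_deriv ?_
    have h2 : deriv (fun s => Real.log (k s z z')) t = κ' / k t z z' := (hκ.log hκ0).deriv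
    simp only [hwt, hχ, arcChar, h2, hL0, hA0, rate_self, Real.exp_zero, neg_zero, Pi.neg_apply,
      Pi.mul_apply]
    field_simp
    ring
  have hexp : (fun s => g s - (w t * (s - t) + w t * χ / 2 * (s - t) ^ 2)) =o[𝓝[≥] t]
      fun s => (s - t) ^ 2 := by
    have h1 := isLittleO_sub_of_hasDerivWithinAt (f := fun s => g s - w t * (s - t))
      (f' := fun s => w s - w t) (c := w t * χ) (n := 1) hS (hcg.sub (by fun_prop)) (by simp [hg0])
      (fun s hs => by
        have h2 := (((hasDerivAt_id s).sub_const t).const_mul (w t)).hasDerivWithinAt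
          (s := Set.Ici s)
        refine ((hderiv s hs).sub h2).congr_deriv ?_
        ring)
      (by
        have h3 := (hasDerivAt_iff_isLittleO.1 hwd).mono (nhdsWithin_le_nhds (s := Set.Ici t))
        refine h3.congr (fun s => ?_) (fun s => ?_)
        · simp only [smul_eq_mul]; ring
        · ring)
    refine h1.congr_left fun s => ?_
    push_cast
    ring
  refine (isLittleO_midpoint_ratio hg₀ hexp).congr' ?_ EventuallyEq.rfl
  filter_upwards [Ioo_mem_nhdsGT (show 0 < (t + 1) / 2 - t by linarith)] with h hh
  have h0 : 0 < h := hh.1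
  have hs1 : t + h < 1 := by linarith [hh.2]
  have hm : MeasurableSet (visits G t [z', z] (t + h)) := sigmaX_le _ _
    (measurableSet_visits ht (I := Set.Icc 0 1) (Set.Icc_subset_Icc ht hs1.le) (by linarith) hs1.le)
  have hmm : MeasurableSet[sigmaX G (Set.Icc 0 (t + h / 2))] (visits G t [z', z] (t + h / 2)) :=
    measurableSet_visits ht (Set.Icc_subset_Icc_left ht) (by linarith) (by linarith)
  rw [setOf_lt_jumpTime_two ht (by linarith) hs1.le hadj.ne, measureReal_cond hm,
    visits_inter_jumpTime_one ht (by linarith) (by linarith) hs1.le,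
    hQ.real_stay hk (by linarith) (by linarith) hs1
      (fun q hq => hA q ⟨by linarith [hq.1], by linarith [hq.2, hh.2]⟩) hmm
      (fun ω hω => X_of_visits (by linarith) hω)]
  simp only [hg, hD]
  rw [Real.exp_sub, Real.exp_neg, Real.exp_neg]
  congr 1
  have h2 : Real.exp (A (t + h)) ≠ 0 := (Real.exp_pos _).ne'
  have h3 : Real.exp (A (t + h / 2)) ≠ 0 := (Real.exp_pos _).ne'
  field_simp

/-! ### The expansions only depend on the short-time bridges -/

/-- Right after time `t`, the bridges of `P` and `R` from `a` to `b` are defined and agree. -/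
def SameShortBridges (P R : Measure (PathSpace G)) (t : ℝ) (a b : V) : Prop :=
  ∀ᶠ h : ℝ in 𝓝[>] 0, P.real {ω | X t ω = a ∧ X (t + h) ω = b} ≠ 0 ∧
    R.real {ω | X t ω = a ∧ X (t + h) ω = b} ≠ 0 ∧
    ∀ B, MeasurableSet[sigmaX G (Set.Icc t (t + h))] B →
      R.real {ω | X t ω = a ∧ X (t + h) ω = b} *
          P.real (B ∩ {ω | X t ω = a ∧ X (t + h) ω = b}) =
        R.real (B ∩ {ω | X t ω = a ∧ X (t + h) ω = b}) *
          P.real {ω | X t ω = a ∧ X (t + h) ω = b}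

lemma SameShortBridges.walkExpansion {t : ℝ} (ht : 0 ≤ t) (ht1 : t < 1) {c : ClosedWalk G}
    (h : SameShortBridges P R t c.1 c.1) (hR : WalkExpansion R j t c) : WalkExpansion P j t c := by
  refine hR.congr' ?_ EventuallyEq.rfl
  filter_upwards [h, Ioo_mem_nhdsGT (show 0 < 1 - t by linarith)] with h hh h1
  obtain ⟨hP0, hR0, heq⟩ := hh
  have hm : MeasurableSet {ω : PathSpace G | X t ω = c.1 ∧ X (t + h) ω = c.1} :=
    (measurableSet_X_eq' t _).inter (measurableSet_X_eq' _ _)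
  have h2 := heq _ (measurableSet_followsWalk ht h1.1 (by linarith [h1.2]) c)
  rw [measureReal_cond hm, measureReal_cond hm, Set.inter_comm _ (followsWalk t h c)]
  congr 1
  field_simp
  linarith

lemma SameShortBridges.arcExpansion {t : ℝ} (ht : 0 ≤ t) (ht1 : t < 1) {z z' : V}
    (hne : z ≠ z') (h : SameShortBridges P R t z z') (hR : ArcExpansion R j t z z') :
    ArcExpansion P j t z z' := by
  refine hR.congr' ?_ EventuallyEq.rfl
  filter_upwards [h, Ioo_mem_nhdsGT (show 0 < 1 - t by linarith)] with h hh h1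
  obtain ⟨hP0, hR0, heq⟩ := hh
  have h0 : 0 < h := h1.1
  have hs : t + h ≤ 1 := by linarith [h1.2]
  have hts : t ≤ t + h := by linarith
  have hm : MeasurableSet[sigmaX G (Set.Icc t (t + h))] (visits G t [z', z] (t + h)) :=
    measurableSet_visits ht subset_rfl hts hs
  have hm2 : MeasurableSet[sigmaX G (Set.Icc t (t + h))]
      (visits G t [z', z] (t + h / 2) ∩ visits G (t + h / 2) [z'] (t + h)) :=
    (measurableSet_visits ht (Set.Icc_subset_Icc_right (by linarith)) (by linarith)
      (by linarith)).inter
    (measurableSet_visits (by linarith) (Set.Icc_subset_Icc_left (by linarith)) (by linarith) hs)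
  have hv := setOf_lt_jumpTime_two (G := G) ht hts hs hne
  have hsub : visits G t [z', z] (t + h) ⊆ {ω | X t ω = z ∧ X (t + h) ω = z'} := by
    rw [← hv]
    exact fun ω hω => ⟨hω.1, hω.2.1⟩
  have hsub2 : visits G t [z', z] (t + h / 2) ∩ visits G (t + h / 2) [z'] (t + h) ⊆
      {ω | X t ω = z ∧ X (t + h) ω = z'} := by
    rw [← visits_inter_jumpTime_one ht (by linarith) (by linarith) hs]
    exact Set.inter_subset_left.trans hsub
  have e1 := heq _ hm
  have e2 := heq _ hm2
  rw [Set.inter_eq_left.2 hsub] at e1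
  rw [Set.inter_eq_left.2 hsub2] at e2
  have hm' := sigmaX_le (Set.Icc t (t + h)) _ hm
  rw [hv, measureReal_cond hm', measureReal_cond hm',
    visits_inter_jumpTime_one ht (by linarith) (by linarith) hs]
  congr 1
  set p := P.real {ω | X t ω = z ∧ X (t + h) ω = z'}
  set r := R.real {ω | X t ω = z ∧ X (t + h) ω = z'}
  have f1 : R.real (visits G t [z', z] (t + h)) =
      r / p * P.real (visits G t [z', z] (t + h)) := by
    rw [div_mul_eq_mul_div, eq_div_iff hP0, e1]
  have f2 : R.real (visits G t [z', z] (t + h / 2) ∩ visits G (t + h / 2) [z'] (t + h)) =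
      r / p * P.real (visits G t [z', z] (t + h / 2) ∩ visits G (t + h / 2) [z'] (t + h)) := by
    rw [div_mul_eq_mul_div, eq_div_iff hP0, e2]
  rw [f1, f2]
  rcases eq_or_ne (P.real (visits G t [z', z] (t + h))) 0 with h3 | h3
  · simp [h3]
  · field_simp

end RandomWalk

namespace RandomWalk

variable {V : Type*} {G : SimpleGraph V}
variable [Countable V] [MeasurableSpace V] [DiscreteMeasurableSpace V]
variable {P Q R : Measure (PathSpace G)} [IsProbabilityMeasure P] [IsProbabilityMeasure Q]
  [IsProbabilityMeasure R]

/-! ### Bridges -/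

lemma measurableSet_endpoints (x y : V) : MeasurableSet (endpoints G x y) :=
  (measurableSet_X_eq' 0 x).inter (measurableSet_X_eq' 1 y)

lemma real_bridge (x y : V) (E : Set (PathSpace G)) :
    (bridge R x y).real E = (R.real (endpoints G x y))⁻¹ * R.real (endpoints G x y ∩ E) :=
  measureReal_cond (measurableSet_endpoints x y) E

lemma isProbabilityMeasure_bridge {x y : V} (h : R (endpoints G x y) ≠ 0) :
    IsProbabilityMeasure (bridge R x y) :=
  cond_isProbabilityMeasure h

variable [G.LocallyFinite] {k j : ℝ → V → V → ℝ}

/-! ### Walks whose laws satisfy the forward equation -/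

/-- A walk has the intensity `k` as soon as the forward equation holds. -/
lemma hasIntensity_of_hasDerivWithinAt (hk : ContinuousRates G k)
    (hc : ∀ u : V →₀ ℝ, ∀ S < 1, ∀ D : Set (PathSpace G), MeasurableSet D →
      ContinuousOn (fun s => ∫ ω in D, u (X s ω) ∂Q) (Set.Icc 0 S))
    (hd : ∀ u : V →₀ ℝ, ∀ s : ℝ, 0 ≤ s → s < 1 → ∀ D : Set (PathSpace G),
      MeasurableSet[sigmaX G (Set.Icc 0 s)] D →
      HasDerivWithinAt (fun s' => ∫ ω in D, u (X s' ω) ∂Q)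
        (∫ ω in D, generator G k s u (X s ω) ∂Q) (Set.Ici s) s) :
    HasIntensity Q k := by
  intro u
  have hX : ∀ t : ℝ, 0 ≤ t → StronglyMeasurable[sigmaX G (Set.Icc 0 t)]
      fun ω : PathSpace G => u (X t ω) := fun t ht => by
    have h1 : Measurable[sigmaX G (Set.Icc 0 t)] (X (G := G) t) := fun U _ =>
      measurableSet_X_mem (Set.right_mem_Icc.2 ht) U
    have h2 : Measurable fun z => u z := .of_discrete
    exact (h2.comp h1).stronglyMeasurable
  have hi : ∀ t : ℝ, 0 ≤ t → t < 1 → Integrable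
      (fun ω : PathSpace G => u (X t ω) - ∫ s in (0 : ℝ)..t, generator G k s u (X s ω)) Q :=
    fun t h0 h1 => (integrable_comp_X u t).sub (hk.integrable_integral u le_rfl h0 h1)
  have had : ∀ t : ℝ, 0 ≤ t → t < 1 → StronglyMeasurable[sigmaX G (Set.Icc 0 t)]
      (fun ω : PathSpace G => u (X t ω) - ∫ s in (0 : ℝ)..t, generator G k s u (X s ω)) :=
    fun t h0 h1 => (hX t h0).sub (hk.stronglyMeasurable_integral u le_rfl h0 h1)
  refine ⟨fun t => had t t.2.1 t.2.2, fun s t hst => ?_⟩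
  obtain ⟨s, hs0, hs1⟩ := s
  obtain ⟨t, ht0, ht1⟩ := t
  have hst : s ≤ t := hst
  symm
  refine ae_eq_condExp_of_forall_setIntegral_eq (sigmaX_le _) (hi t ht0 ht1)
    (fun D _ _ => (hi s hs0 hs1).integrableOn) (fun D hD _ => ?_)
    (had s hs0 hs1).aestronglyMeasurable
  have h1 := (integrable_comp_X (Q := Q) u s).integrableOn (s := D)
  have h2 := (integrable_comp_X (Q := Q) u t).integrableOn (s := D)
  have h3 := (hk.integrable_integral (Q := Q) u le_rfl hs0 hs1).integrableOn (s := D)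
  have h4 := (hk.integrable_integral (Q := Q) u le_rfl ht0 ht1).integrableOn (s := D)
  dsimp only
  rw [MeasureTheory.integral_sub h1 h3, MeasureTheory.integral_sub h2 h4]
  have hsub : ∀ r r', s ≤ r → r ≤ r' → r' < 1 →
      ∫ ω in D, (∫ q in s..r', generator G k q u (X q ω)) ∂Q =
        ∫ ω in D, (∫ q in s..r, generator G k q u (X q ω)) ∂Q +
        ∫ ω in D, (∫ q in r..r', generator G k q u (X q ω)) ∂Q := by
    intro r r' h5 h6 h7
    rw [← integral_add (hk.integrable_integral u hs0 h5 (h6.trans_lt h7)).integrableOn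
      (hk.integrable_integral u (hs0.trans h5) h6 h7).integrableOn]
    congr 1 with ω
    rw [intervalIntegral.integral_add_adjacent_intervals
      (hk.intervalIntegrable u ω hs0 h5 (h6.trans_lt h7))
      (hk.intervalIntegrable u ω (hs0.trans h5) h6 h7)]
  obtain ⟨c, hc0, hcb⟩ := hk.exists_bound u ht1
  have key := eq_of_has_deriv_right_eq (a := s) (b := t)
    (f := fun s' => ∫ ω in D, u (X s' ω) ∂Q)
    (g := fun s' => ∫ ω in D, u (X s ω) ∂Q +
      ∫ ω in D, (∫ r in s..s', generator G k r u (X r ω)) ∂Q)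
    (f' := fun r => ∫ ω in D, generator G k r u (X r ω) ∂Q)
    (fun r hr => hd u r (hs0.trans hr.1) (hr.2.trans ht1) D
      (sigmaX_mono (Set.Icc_subset_Icc_right hr.1) _ hD))
    (fun r hr => by
      have h6 := ((hk.hasDerivWithinAt_setIntegral (Q := Q) u (hs0.trans hr.1) (hr.2.trans ht1)
        D).const_add (∫ ω in D, (∫ q in s..r, generator G k q u (X q ω)) ∂Q)).const_add
        (∫ ω in D, u (X s ω) ∂Q)
      refine h6.congr_of_eventuallyEq ?_ (by simp)
      filter_upwards [Ico_mem_nhdsGE (hr.2.trans ht1)] with r' hr'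
      rw [hsub r r' hr.1 hr'.1 hr'.2])
    ((hc u t ht1 D (sigmaX_le _ _ hD)).mono (Set.Icc_subset_Icc_left hs0))
    (continuousOn_const.add (continuousOn_of_abs_sub_le (C := c * Q.real D)
      fun r r' h5 h6 h7 => by
        rw [hsub r r' h5 h6 (h7.trans_lt ht1), add_sub_cancel_left, ← Real.norm_eq_abs]
        refine (norm_setIntegral_le_of_norm_le_const (measure_lt_top Q D) fun ω _ =>
          ContinuousRates.abs_integral_le hcb (hs0.trans h5) h6 h7 ω).trans (le_of_eq ?_)
        ring))
    (by simp) t (Set.right_mem_Icc.2 hst)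
  rw [key]
  have h5 := MeasureTheory.integral_sub h4 h3
  simp_rw [hk.integral_sub u _ hs0 hst ht1] at h5
  rw [h5]
  ring

/-! ### The bridges of a walk with an intensity -/

lemma continuousOn_Ico_of_Icc {f : ℝ → ℝ} (h : ∀ S < 1, ContinuousOn f (Set.Icc 0 S)) :
    ContinuousOn f (Set.Ico 0 1) := by
  intro t ht
  refine (h ((t + 1) / 2) (by linarith [ht.2]) t ⟨ht.1, by linarith [ht.2]⟩).mono_of_mem_nhdsWithin
    ?_
  filter_upwards [self_mem_nhdsWithin, mem_nhdsWithin_of_mem_nhds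
    (Iio_mem_nhds (show t < (t + 1) / 2 by linarith [ht.2]))] with s hs hs'
  exact ⟨hs.1, le_of_lt hs'⟩

/-- A function with a continuous right derivative is continuously differentiable. -/
lemma hasDerivWithinAt_Ico_of_Ici {f f' : ℝ → ℝ} (hf : ContinuousOn f (Set.Ico 0 1))
    (hf' : ContinuousOn f' (Set.Ico 0 1))
    (h : ∀ s ∈ Set.Ico (0 : ℝ) 1, HasDerivWithinAt f (f' s) (Set.Ici s) s) {s : ℝ}
    (hs : s ∈ Set.Ico (0 : ℝ) 1) : HasDerivWithinAt f (f' s) (Set.Ico 0 1) s := by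
  have h1 : s < (s + 1) / 2 := by linarith [hs.2]
  have h2 : (s + 1) / 2 < 1 := by linarith [hs.2]
  have hsub : Set.Icc 0 ((s + 1) / 2) ⊆ Set.Ico 0 1 := Set.Icc_subset_Ico_right h2
  obtain ⟨A, hA0, hA⟩ := exists_primitive (hs.1.trans h1.le) (hf'.mono hsub)
  have key := eq_of_has_deriv_right_eq (a := 0) (b := (s + 1) / 2) (f := f)
    (g := fun r => f 0 + A r) (f' := f') (fun r hr => h r (hsub (Set.Ico_subset_Icc_self hr)))
    (fun r hr => ((hA r (Set.Ico_subset_Icc_self hr)).const_add (f 0)).hasDerivWithinAt)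
    (hf.mono hsub) (continuousOn_const.add fun r hr => (hA r hr).continuousAt.continuousWithinAt)
    (by simp [hA0])
  have hs' : s ∈ Set.Icc 0 ((s + 1) / 2) := ⟨hs.1, h1.le⟩
  have h3 : HasDerivWithinAt f (f' s) (Set.Icc 0 ((s + 1) / 2)) s :=
    (((hA s hs').const_add (f 0)).hasDerivWithinAt).congr (fun r hr => key r hr) (key s hs')
  refine h3.mono_of_mem_nhdsWithin ?_
  filter_upwards [self_mem_nhdsWithin, mem_nhdsWithin_of_mem_nhds (Iio_mem_nhds h1)] with r hr hr'
  exact ⟨hr.1, le_of_lt hr'⟩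

lemma contDiffOn_Ico_of_Ici {f f' : ℝ → ℝ} (hf : ContinuousOn f (Set.Ico 0 1))
    (hf' : ContinuousOn f' (Set.Ico 0 1))
    (h : ∀ s ∈ Set.Ico (0 : ℝ) 1, HasDerivWithinAt f (f' s) (Set.Ici s) s) :
    ContDiffOn ℝ 1 f (Set.Ico 0 1) := by
  rw [contDiffOn_one_iff_derivWithin (uniqueDiffOn_Ico 0 1)]
  refine ⟨fun s hs => (hasDerivWithinAt_Ico_of_Ici hf hf' h hs).differentiableWithinAt, ?_⟩
  exact hf'.congr fun s hs =>
    (hasDerivWithinAt_Ico_of_Ici hf hf' h hs).derivWithin (uniqueDiffOn_Ico 0 1 s hs)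

lemma sum_real_add_real_notMem (W : Finset V) (s : ℝ) {D : Set (PathSpace G)}
    (hD : MeasurableSet D) :
    ∑ b ∈ W, R.real (D ∩ {ω | X s ω = b}) + R.real (D \ {ω | X s ω ∈ (W : Set V)}) = R.real D := by
  rw [← measureReal_inter_add_sdiff (μ := R) (s := D) (measurableSet_X_mem' s (W : Set V))]
  congr 1
  rw [← measureReal_biUnion_finset]
  · congr 1
    ext ω
    simp
  · intro a _ b _ hab
    refine Set.disjoint_left.2 fun ω h1 h2 => hab (h1.2.symm.trans h2.2)
  · exact fun b _ => hD.inter (measurableSet_X_eq' s b)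

/-- The probability under `R` to be in `y` at time `1`, when starting from `z` at time `t`. The
bridges ending in `y` are the transforms of `R` by this space-time harmonic function. -/
def arrival (R : Measure (PathSpace G)) (y : V) (t : ℝ) (z : V) : ℝ :=
  R.real {ω | X t ω = z ∧ X 1 ω = y} / R.real {ω | X t ω = z}

lemma IsReferenceIntensity.real_X_pos (hj : IsReferenceIntensity G j) (hR : HasIntensity R j)
    (hconn : G.Connected) (hR₀ : ∀ x, R {ω | X 0 ω = x} ≠ 0) {t : ℝ} (ht : t ∈ Set.Icc (0 : ℝ) 1)
    (z : V) : 0 < R.real {ω | X t ω = z} := by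
  have h0 : 0 < R.real {ω | X 0 ω = z} :=
    ENNReal.toReal_pos (hR₀ z) (measure_ne_top _ _)
  rcases ht.1.eq_or_lt with rfl | h
  · exact h0
  · exact (hj.real_inter_pos hR hconn le_rfl h ht.2 z
      (measurableSet_X_eq (Set.right_mem_Icc.2 le_rfl) z) (fun _ hω => hω) h0).trans_le
      (measureReal_mono Set.inter_subset_right)

lemma IsReferenceIntensity.real_X_X_pos (hj : IsReferenceIntensity G j) (hR : HasIntensity R j)
    (hconn : G.Connected) (hR₀ : ∀ x, R {ω | X 0 ω = x} ≠ 0) {t s : ℝ} (ht : 0 ≤ t)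
    (hts : t < s) (hs : s ≤ 1) (z z' : V) : 0 < R.real {ω | X t ω = z ∧ X s ω = z'} :=
  hj.real_inter_pos hR hconn ht hts hs z' (measurableSet_X_eq (Set.right_mem_Icc.2 ht) z)
    (fun _ hω => hω) (hj.real_X_pos hR hconn hR₀ ⟨ht, hts.le.trans hs⟩ z)

lemma IsReferenceIntensity.arrival_pos (hj : IsReferenceIntensity G j) (hR : HasIntensity R j)
    (hconn : G.Connected) (hR₀ : ∀ x, R {ω | X 0 ω = x} ≠ 0) {t : ℝ} (ht : t ∈ Set.Ico (0 : ℝ) 1)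
    (y z : V) : 0 < arrival R y t z :=
  div_pos (hj.real_X_X_pos hR hconn hR₀ ht.1 ht.2 le_rfl z y)
    (hj.real_X_pos hR hconn hR₀ (Set.Ico_subset_Icc_self ht) z)

lemma arrival_nonneg (y : V) (t : ℝ) (z : V) : 0 ≤ arrival R y t z :=
  div_nonneg measureReal_nonneg measureReal_nonneg

lemma HasIntensity.real_inter_X_one (hR : HasIntensity R j) (hj : ContinuousRates G j) {t : ℝ}
    (ht : t ∈ Set.Icc (0 : ℝ) 1) {b : V} (hb : R.real {ω | X t ω = b} ≠ 0)
    {B : Set (PathSpace G)} (hB : MeasurableSet[sigmaX G (Set.Icc 0 t)] B)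
    (hBb : ∀ ω ∈ B, X t ω = b) (y : V) :
    R.real (B ∩ {ω | X 1 ω = y}) = R.real B * arrival R y t b := by
  have h := hR.markov hj ht hB hBb (D := {ω | X 1 ω = y})
    (measurableSet_X_eq (Set.right_mem_Icc.2 ht.2) y)
  rw [Set.inter_comm _ B, Set.inter_comm _ {ω | X t ω = b}] at h
  rw [arrival, mul_div_assoc', eq_div_iff hb, mul_comm, h]
  rfl

lemma IsReferenceIntensity.continuousOn_arrival (hj : IsReferenceIntensity G j)
    (hR : HasIntensity R j) (hconn : G.Connected) (hR₀ : ∀ x, R {ω | X 0 ω = x} ≠ 0) (y z : V) :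
    ContinuousOn (fun t => arrival R y t z) (Set.Ico 0 1) := by
  refine ContinuousOn.div (continuousOn_Ico_of_Icc fun S hS => ?_)
    (continuousOn_Ico_of_Icc fun S hS => ?_)
    fun t ht => (hj.real_X_pos hR hconn hR₀ (Set.Ico_subset_Icc_self ht) z).ne'
  · refine (hR.continuousOn_real hj.continuousRates hS {ω | X 1 ω = y} z).congr fun t _ => ?_
    exact congrArg R.real (Set.inter_comm {ω | X t ω = z} {ω | X 1 ω = y})
  · simpa using hR.continuousOn_real hj.continuousRates hS Set.univ z

/-- The backward equation. -/
lemma IsReferenceIntensity.hasDerivWithinAt_arrival (hj : IsReferenceIntensity G j)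
    (hR : HasIntensity R j) (hconn : G.Connected) (hR₀ : ∀ x, R {ω | X 0 ω = x} ≠ 0) (y z : V)
    {t : ℝ} (ht : t ∈ Set.Ico (0 : ℝ) 1) :
    HasDerivWithinAt (fun s => arrival R y s z) (-generator G j t (arrival R y t) z)
      (Set.Ici t) t := by
  classical
  have hk := hj.continuousRates
  have hzN : z ∉ G.neighborFinset z := by simp
  set N := G.neighborFinset z with hN
  set B : Set (PathSpace G) := {ω | X t ω = z} with hB
  have hmB : MeasurableSet[sigmaX G (Set.Icc 0 t)] B :=
    measurableSet_X_eq (Set.right_mem_Icc.2 ht.1) z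
  have hp : 0 < R.real B := hj.real_X_pos hR hconn hR₀ (Set.Ico_subset_Icc_self ht) z
  set p := R.real B with hpdef
  set q := fun s b => R.real (B ∩ {ω | X s ω = b}) with hq
  set e := fun s => R.real (B \ {ω | X s ω ∈ ((insert z N : Finset V) : Set V)}) with he
  set r := fun s => R.real ((B ∩ {ω | X 1 ω = y}) \
    {ω | X s ω ∈ ((insert z N : Finset V) : Set V)}) with hr
  have hre : ∀ s, r s ≤ e s := fun s => measureReal_mono
    (Set.sdiff_subset_sdiff_left Set.inter_subset_left)
  have hr0 : ∀ s, 0 ≤ r s := fun s => measureReal_nonneg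
  have hslope : ∀ b, Tendsto (fun s => (q s b - q t b) / (s - t)) (𝓝[>] t)
      (𝓝 (p * rate G j t z b)) := by
    intro b
    have h1 := hR.hasDerivWithinAt_real hk ht.1 ht.2 hmB (fun _ hω => hω) b
    have h2 := (hasDerivWithinAt_iff_tendsto_slope' Set.self_notMem_Ioi).1 h1.Ioi_of_Ici
    simpa only [slope_fun_def_field] using h2
  have hqt : ∀ b, b ≠ z → q t b = 0 := by
    intro b hb
    have : B ∩ {ω | X t ω = b} = ∅ := by
      ext ω
      simp only [hB, Set.mem_inter_iff, Set.mem_ofPred_eq, Set.mem_empty_iff_false, iff_false,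
        not_and]
      exact fun h1 h2 => hb (h2.symm.trans h1)
    simp only [hq, this, measureReal_empty]
  have hqz : q t z = p := by simp [hq, hB, hpdef]
  have hsum : ∀ s, q s z + ∑ b ∈ N, q s b + e s = p := fun s => by
    rw [← Finset.sum_insert hzN]
    exact sum_real_add_real_notMem _ s (sigmaX_le _ _ hmB)
  -- the probability to be neither in `z` nor in a neighbor of `z` is of order higher than one
  have hrate : rate G j t z z + ∑ b ∈ N, rate G j t z b = 0 := by
    rw [rate_self, totalRate, Finset.sum_congr rfl fun b hb =>
      rate_of_adj ((G.mem_neighborFinset _ _).1 hb)]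
    ring
  have helim : Tendsto (fun s => e s / (s - t)) (𝓝[>] t) (𝓝 0) := by
    have h1 := ((hslope z).add (tendsto_finsetSum N fun b _ => hslope b)).neg
    rw [← Finset.mul_sum, ← mul_add, hrate, mul_zero, neg_zero] at h1
    refine h1.congr fun s => ?_
    rw [← Finset.sum_div, ← add_div, ← neg_div]
    congr 1
    rw [Finset.sum_sub_distrib, hqz, Finset.sum_eq_zero (f := fun b => q t b) fun b hb =>
      hqt b fun h => hzN (h ▸ hb)]
    linarith [hsum s]
  have hφ : ∀ b, Tendsto (fun s => arrival R y s b) (𝓝[>] t) (𝓝 (arrival R y t b)) := fun b =>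
    (continuousWithinAt_Ici (hj.continuousOn_arrival hR hconn hR₀ y b) ht.1 ht.2).mono
      Set.Ioi_subset_Ici_self
  -- decomposition according to the state at time `s`
  have hdec : ∀ s, t ≤ s → s < 1 → p * arrival R y t z =
      q s z * arrival R y s z + ∑ b ∈ N, q s b * arrival R y s b + r s := by
    intro s hs hs1
    have hs' : s ∈ Set.Icc (0 : ℝ) 1 := ⟨ht.1.trans hs, hs1.le⟩
    have hpos := fun b => (hj.real_X_pos hR hconn hR₀ hs' b).ne'
    rw [← hR.real_inter_X_one hk (Set.Ico_subset_Icc_self ht) hp.ne' hmB (fun _ hω => hω) y,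
      ← Finset.sum_insert (f := fun b => q s b * arrival R y s b) hzN,
      ← sum_real_add_real_notMem (insert z N) s
        ((sigmaX_le _ _ hmB).inter (measurableSet_X_eq' 1 y))]
    congr 1
    refine Finset.sum_congr rfl fun b _ => ?_
    rw [← hR.real_inter_X_one hk hs' (hpos b) ((sigmaX_mono (Set.Icc_subset_Icc_right hs) _
      hmB).inter (measurableSet_X_eq (Set.right_mem_Icc.2 hs'.1) b)) (fun ω hω => hω.2) y]
    congr 1
    ext ω
    simp only [Set.mem_inter_iff]
    tauto
  have hlim : Tendsto (fun s => p⁻¹ * (∑ b ∈ N, (q s b - q t b) / (s - t) *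
      (arrival R y s z - arrival R y s b) + (e s / (s - t) * arrival R y s z - r s / (s - t))))
      (𝓝[>] t) (𝓝 (p⁻¹ * (∑ b ∈ N, p * rate G j t z b * (arrival R y t z - arrival R y t b) +
        (0 * arrival R y t z - 0)))) := by
    have hrlim : Tendsto (fun s => r s / (s - t)) (𝓝[>] t) (𝓝 0) := by
      refine tendsto_of_tendsto_of_tendsto_of_le_of_le' tendsto_const_nhds helim ?_ ?_ <;>
      filter_upwards [self_mem_nhdsWithin] with s hs
      · exact div_nonneg (hr0 s) (sub_nonneg.2 (le_of_lt hs))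
      · exact div_le_div_of_nonneg_right (hre s) (sub_nonneg.2 (le_of_lt hs))
    exact ((tendsto_finsetSum N fun b _ => (hslope b).mul ((hφ z).sub (hφ b))).add
      ((helim.mul (hφ z)).sub hrlim)).const_mul _
  refine HasDerivWithinAt.Ici_of_Ioi ?_
  rw [hasDerivWithinAt_iff_tendsto_slope' Set.self_notMem_Ioi]
  convert hlim.congr' ?_ using 2
  · rw [zero_mul, sub_zero, add_zero, generator, ← Finset.sum_neg_distrib, Finset.mul_sum]
    refine Finset.sum_congr rfl fun b hb => ?_
    rw [rate_of_adj ((G.mem_neighborFinset _ _).1 hb)]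
    field_simp
    ring
  · filter_upwards [Ioo_mem_nhdsGT ht.2] with s hs
    have hne : s - t ≠ 0 := (sub_pos.2 hs.1).ne'
    rw [slope_def_field]
    have h1 : ∑ b ∈ N, (q s b - q t b) / (s - t) * (arrival R y s z - arrival R y s b) =
        (s - t)⁻¹ * ((∑ b ∈ N, q s b) * arrival R y s z - ∑ b ∈ N, q s b * arrival R y s b) := by
      rw [Finset.sum_mul, ← Finset.sum_sub_distrib, Finset.mul_sum]
      refine Finset.sum_congr rfl fun b hb => ?_
      rw [hqt b fun h => hzN (h ▸ hb)]
      field_simp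
      ring
    have h2 := hdec s hs.1.le hs.2
    have h3 : arrival R y t z = p⁻¹ * (p * arrival R y t z) := by field_simp
    rw [h1, h3, h2, ← hsum s]
    have h4 : q s z + ∑ b ∈ N, q s b + e s ≠ 0 := by rw [hsum s]; exact hp.ne'
    field_simp
    ring

/-- The intensity of the bridges of `R` ending in `y`. -/
def bridgeRate (R : Measure (PathSpace G)) (j : ℝ → V → V → ℝ) (y : V) (t : ℝ) (z z' : V) : ℝ :=
  j t z z' * arrival R y t z' / arrival R y t z

lemma IsReferenceIntensity.contDiffOn_bridgeRate (hj : IsReferenceIntensity G j)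
    (hR : HasIntensity R j) (hconn : G.Connected) (hR₀ : ∀ x, R {ω | X 0 ω = x} ≠ 0) (y : V)
    {z z' : V} (h : G.Adj z z') :
    ContDiffOn ℝ 1 (fun t => bridgeRate R j y t z z') (Set.Ico 0 1) := by
  have hφ : ∀ z, ContDiffOn ℝ 1 (fun t => arrival R y t z) (Set.Ico 0 1) := fun z => by
    refine contDiffOn_Ico_of_Ici (hj.continuousOn_arrival hR hconn hR₀ y z) ?_
      fun s hs => hj.hasDerivWithinAt_arrival hR hconn hR₀ y z hs
    refine (continuousOn_finsetSum _ fun b hb => ?_).neg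
    exact (hj.continuousRates z b ((G.mem_neighborFinset _ _).1 hb)).mul
      ((hj.continuousOn_arrival hR hconn hR₀ y b).sub (hj.continuousOn_arrival hR hconn hR₀ y z))
  exact (((hj.contDiffOn z z' h).mono Set.Ico_subset_Icc_self).mul (hφ z')).div (hφ z)
    fun t ht => (hj.arrival_pos hR hconn hR₀ ht y z).ne'

lemma bridgeRate_nonneg (hj : IsReferenceIntensity G j) {t : ℝ} (ht : t ∈ Set.Icc (0 : ℝ) 1)
    (y : V) {z z' : V} (h : G.Adj z z') : 0 ≤ bridgeRate R j y t z z' :=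
  div_nonneg (mul_nonneg (hj.pos t ht z z' h).le (arrival_nonneg y t z')) (arrival_nonneg y t z)

/-- The entries of the generators of `R` and of its bridges: the derivative on the diagonal
is that of the backward equation. -/
lemma IsReferenceIntensity.rate_bridgeRate (hj : IsReferenceIntensity G j)
    (hR : HasIntensity R j) (hconn : G.Connected) (hR₀ : ∀ x, R {ω | X 0 ω = x} ≠ 0) (y : V)
    {t : ℝ} (ht : t ∈ Set.Ico (0 : ℝ) 1) [DecidableEq V] (w b : V) :
    rate G (bridgeRate R j y) t w b * arrival R y t w = rate G j t w b * arrival R y t b +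
      if w = b then -generator G j t (arrival R y t) b else 0 := by
  have hne := fun z => (hj.arrival_pos hR hconn hR₀ ht y z).ne'
  by_cases h : w = b
  · subst h
    rw [if_pos rfl, rate_self, rate_self, totalRate, totalRate, generator, neg_mul, neg_mul,
      ← neg_add, Finset.sum_mul, Finset.sum_mul, ← Finset.sum_add_distrib]
    congr 1
    refine Finset.sum_congr rfl fun z _ => ?_
    rw [bridgeRate]
    have := hne w
    field_simp
    ring
  · rw [if_neg h, add_zero]
    by_cases h' : G.Adj w b
    · rw [rate_of_adj h', rate_of_adj h', bridgeRate]
      have := hne w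
      field_simp
    · rw [rate_of_not_adj h h', rate_of_not_adj h h', zero_mul, zero_mul]

lemma IsReferenceIntensity.hasIntensity_bridge (hj : IsReferenceIntensity G j)
    (hR : HasIntensity R j) (hconn : G.Connected) (hR₀ : ∀ x, R {ω | X 0 ω = x} ≠ 0) {x y : V}
    (hxy : R (endpoints G x y) ≠ 0) : HasIntensity (bridge R x y) (bridgeRate R j y) := by
  classical
  have hk := hj.continuousRates
  have hkb : ContinuousRates G (bridgeRate R j y) := fun z z' h =>
    (hj.contDiffOn_bridgeRate hR hconn hR₀ y h).continuousOn
  have := isProbabilityMeasure_bridge hxy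
  have hu : ∀ (u : V →₀ ℝ) (s : ℝ) (D : Set (PathSpace G)),
      ∫ ω in D, u (X s ω) ∂(bridge R x y) =
        ∑ b ∈ u.support, u b * (bridge R x y).real (D ∩ {ω | X s ω = b}) := fun u s D =>
    setIntegral_comp_X (fun z hz => by simpa using hz) s D
  refine hasIntensity_of_hasDerivWithinAt hkb (fun u S hS D hD => ?_) fun u s hs0 hs1 D hD => ?_
  · simp only [hu, real_bridge]
    refine continuousOn_finsetSum _ fun b _ => continuousOn_const.mul (continuousOn_const.mul ?_)
    simpa only [Set.inter_assoc] using hR.continuousOn_real hk hS (endpoints G x y ∩ D) b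
  set c := (R.real (endpoints G x y))⁻¹ with hc
  set D' := {ω : PathSpace G | X 0 ω = x} ∩ D with hD'
  have hmD' : MeasurableSet[sigmaX G (Set.Icc 0 s)] D' :=
    (measurableSet_X_eq (Set.left_mem_Icc.2 hs0) x).inter hD
  -- the bridge in terms of `R` and `arrival`
  have hreal : ∀ s' ∈ Set.Ico s 1, ∀ b, (bridge R x y).real (D ∩ {ω | X s' ω = b}) =
      c * (R.real (D' ∩ {ω | X s' ω = b}) * arrival R y s' b) := by
    intro s' hs' b
    have hs'1 : s' ∈ Set.Icc (0 : ℝ) 1 := ⟨hs0.trans hs'.1, hs'.2.le⟩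
    rw [real_bridge, ← hR.real_inter_X_one hk hs'1 (hj.real_X_pos hR hconn hR₀ hs'1 b).ne'
      ((sigmaX_mono (Set.Icc_subset_Icc_right hs'.1) _ hmD').inter
        (measurableSet_X_eq (Set.right_mem_Icc.2 hs'1.1) b)) (fun ω hω => hω.2) y]
    congr 2
    ext ω
    simp only [hD', endpoints, Set.mem_inter_iff, Set.mem_ofPred_eq]
    tauto
  set W := u.support ∪ u.support.biUnion fun z => G.neighborFinset z with hW
  have hWrate : ∀ (k' : ℝ → V → V → ℝ), ∀ b ∈ u.support, ∀ w ∉ W, rate G k' s w b = 0 := by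
    intro k' b hb w hw
    simp only [hW, Finset.mem_union, Finset.mem_biUnion, not_or, not_exists, not_and] at hw
    refine rate_of_not_adj (fun h => hw.1 (h ▸ hb)) fun h => hw.2 b hb ?_
    exact (G.mem_neighborFinset _ _).2 h.symm
  have hd : HasDerivWithinAt (fun s' => ∑ b ∈ u.support,
      u b * (c * (R.real (D' ∩ {ω | X s' ω = b}) * arrival R y s' b)))
      (∑ b ∈ u.support, u b * (c * ((∑ w ∈ W, rate G j s w b * R.real (D' ∩ {ω | X s ω = w})) *
        arrival R y s b + R.real (D' ∩ {ω | X s ω = b}) * -generator G j s (arrival R y s) b)))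
      (Set.Ici s) s := by
    refine HasDerivWithinAt.fun_sum fun b hb => ?_
    have h1 := hR.hasDerivWithinAt hk (Finsupp.single b 1) hs0 hs1 hmD'
    simp only [← real_inter_X_eq] at h1
    rw [setIntegral_comp_X (F := W) (f := generator G j s (Finsupp.single b (1 : ℝ)))
      (fun w hw => hWrate j b hb w hw)] at h1
    exact ((h1.mul (hj.hasDerivWithinAt_arrival hR hconn hR₀ y b ⟨hs0, hs1⟩)).const_mul
      c).const_mul (u b)
  refine (hd.congr_of_eventuallyEq ?_ ?_).congr_deriv ?_
  · filter_upwards [Ico_mem_nhdsGE hs1] with s' hs'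
    rw [hu]
    exact Finset.sum_congr rfl fun b _ => by rw [hreal s' hs' b]
  · rw [hu]
    exact Finset.sum_congr rfl fun b _ => by rw [hreal s ⟨le_rfl, hs1⟩ b]
  · rw [setIntegral_comp_X (F := W)]
    · simp only [generator_eq_sum (k := bridgeRate R j y), hreal s ⟨le_rfl, hs1⟩, Finset.sum_mul]
      rw [Finset.sum_comm]
      refine Finset.sum_congr rfl fun b hb => ?_
      have hbW : b ∈ W := Finset.mem_union_left _ hb
      have h1 : ∀ w, u b * rate G (bridgeRate R j y) s w b *
          (c * (R.real (D' ∩ {ω | X s ω = w}) * arrival R y s w)) =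
          u b * (c * (rate G j s w b * R.real (D' ∩ {ω | X s ω = w}) * arrival R y s b)) +
          (if w = b then u b * (c * (R.real (D' ∩ {ω | X s ω = b}) *
            -generator G j s (arrival R y s) b)) else 0) := fun w => by
        have h2 := hj.rate_bridgeRate hR hconn hR₀ y ⟨hs0, hs1⟩ w b
        split_ifs at h2 ⊢ with h
        · subst h
          linear_combination u w * c * R.real (D' ∩ {ω | X s ω = w}) * h2
        · linear_combination u b * c * R.real (D' ∩ {ω | X s ω = w}) * h2
      rw [Finset.sum_congr rfl fun w _ => h1 w, Finset.sum_add_distrib, Finset.sum_ite_eq' W b,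
        if_pos hbW, mul_add, mul_add, Finset.mul_sum, Finset.mul_sum]
    · intro w hw
      rw [generator_eq_sum]
      exact Finset.sum_eq_zero fun b hb => by rw [hWrate _ b hb w hw, mul_zero]

end RandomWalk

namespace RandomWalk

/-! ### Mixtures of bridges -/

section

variable {V : Type*} {G : SimpleGraph V}
variable [Countable V] [MeasurableSpace V] [DiscreteMeasurableSpace V]
variable {P R : Measure (PathSpace G)} [IsProbabilityMeasure P] [IsProbabilityMeasure R]

lemma measurableSet_sigmaX_Icc {E : Set (PathSpace G)} (hE : MeasurableSet E) :
    MeasurableSet[sigmaX G (Set.Icc 0 1)] E := by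
  have h : (Subtype.instMeasurableSpace : MeasurableSpace (PathSpace G)) ≤
      sigmaX G (Set.Icc 0 1) := by
    rw [Subtype.instMeasurableSpace, MeasurableSpace.pi, MeasurableSpace.comap_iSup]
    refine iSup_le fun a => ?_
    rw [MeasurableSpace.comap_comp]
    refine le_trans (le_of_eq ?_) (le_iSup₂_of_le (a : ℝ) a.2 le_rfl)
    congr 1
    ext ω
    simp [X, Set.projIcc_val]
  exact h E hE

lemma hasSum_mixture {π : PMF (V × V)}
    (hP : P = Measure.sum fun p : V × V => π p • bridge R p.1 p.2)
    {E : Set (PathSpace G)} (hE : MeasurableSet E) :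
    HasSum (fun p : V × V => (π p).toReal * (bridge R p.1 p.2).real E) (P.real E) := by
  have h1 : P E = ∑' p : V × V, π p * bridge R p.1 p.2 E := by
    rw [hP, Measure.sum_apply _ hE]
    rfl
  have h2 : ∑' p : V × V, π p * bridge R p.1 p.2 E ≠ ⊤ := h1 ▸ measure_ne_top P E
  have h3 := ENNReal.hasSum_toReal h2
  rw [← ENNReal.tsum_toReal_eq fun p => ENNReal.ne_top_of_tsum_ne_top h2 p, ← h1] at h3
  simp only [ENNReal.toReal_mul] at h3
  exact h3

/-- The conditioning by the endpoints does not alter the bridges. -/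
lemma SameBridges.bridge (h : SameBridges P R) (x y : V) :
    SameBridges (RandomWalk.bridge P x y) R := by
  intro u v hu huv hv B C hB hC a b
  have hmD : MeasurableSet[sigmaX G (Set.Icc 0 u ∪ Set.Icc v 1)] (endpoints G x y ∩ C) :=
    ((measurableSet_X_eq (Or.inl (Set.left_mem_Icc.2 hu)) x).inter
      (measurableSet_X_eq (Or.inr (Set.right_mem_Icc.2 hv)) y)).inter hC
  have h1 := h u v hu huv hv B _ hB hmD a b
  rw [Set.inter_assoc, Set.inter_assoc] at h1
  rw [real_bridge, real_bridge]
  linear_combination (P.real (endpoints G x y))⁻¹ * h1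

lemma SameBridges.of_mixture (hR : SameBridges R R) {π : PMF (V × V)}
    (hP : P = Measure.sum fun p : V × V => π p • RandomWalk.bridge R p.1 p.2) :
    SameBridges P R := by
  intro u v hu huv hv B C hB hC a b
  have hmC := sigmaX_le _ _ hC
  have hmab : MeasurableSet {ω : PathSpace G | X u ω = a ∧ X v ω = b} :=
    (measurableSet_X_eq' u a).inter (measurableSet_X_eq' v b)
  have h1 := (hasSum_mixture hP (hmC.inter ((sigmaX_le _ _ hB).inter hmab))).mul_left
    (R.real {ω | X u ω = a ∧ X v ω = b})
  have h2 := (hasSum_mixture hP (hmC.inter hmab)).mul_left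
    (R.real (B ∩ {ω | X u ω = a ∧ X v ω = b}))
  refine h1.unique (h2.congr_fun fun p => ?_)
  linear_combination (π p).toReal * hR.bridge p.1 p.2 u v hu huv hv B C hB hC a b

lemma SameBridges.eq_mul (h : SameBridges P R) {u v : ℝ} (hu : 0 ≤ u) (huv : u ≤ v) (hv : v ≤ 1)
    {B : Set (PathSpace G)} (hB : MeasurableSet[sigmaX G (Set.Icc u v)] B) (a b : V) :
    R.real {ω | X u ω = a ∧ X v ω = b} * P.real (B ∩ {ω | X u ω = a ∧ X v ω = b}) =
      R.real (B ∩ {ω | X u ω = a ∧ X v ω = b}) * P.real {ω | X u ω = a ∧ X v ω = b} := by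
  simpa using h u v hu huv hv B Set.univ hB MeasurableSet.univ a b

lemma SameBridges.self (h : SameBridges P R) (hPR : P ≪ R) : SameBridges P P := by
  intro u v hu huv hv B C hB hC a b
  set ab := {ω : PathSpace G | X u ω = a ∧ X v ω = b}
  by_cases h0 : R.real ab = 0
  · have h1 : P.real ab = 0 := by
      rw [measureReal_eq_zero_iff] at h0 ⊢
      exact hPR h0
    have h2 : P.real (B ∩ ab) = 0 :=
      le_antisymm ((measureReal_mono Set.inter_subset_right).trans h1.le) measureReal_nonneg
    rw [h1, h2, zero_mul, zero_mul]
  · refine mul_left_cancel₀ h0 ?_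
    have h1 := h u v hu huv hv B C hB hC a b
    have h2 := h.eq_mul hu huv hv hB a b
    linear_combination P.real ab * h1 - P.real (C ∩ ab) * h2

lemma SameBridges.bridge_eq (h : SameBridges P R) {x y : V} (hP : P (endpoints G x y) ≠ 0)
    (hR : R (endpoints G x y) ≠ 0) : RandomWalk.bridge P x y = RandomWalk.bridge R x y := by
  have := isProbabilityMeasure_bridge hP
  have := isProbabilityMeasure_bridge hR
  refine Measure.ext fun E hE => ?_
  have h1 := h.eq_mul le_rfl zero_le_one le_rfl (measurableSet_sigmaX_Icc hE) x y
  change R.real (endpoints G x y) * P.real (E ∩ endpoints G x y) =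
    R.real (E ∩ endpoints G x y) * P.real (endpoints G x y) at h1
  have h2 : P.real (endpoints G x y) ≠ 0 := by rwa [Ne, measureReal_eq_zero_iff]
  have h3 : R.real (endpoints G x y) ≠ 0 := by rwa [Ne, measureReal_eq_zero_iff]
  rw [← measureReal_eq_measureReal_iff, real_bridge, real_bridge, Set.inter_comm _ E]
  field_simp
  linarith

lemma absolutelyContinuous_mixture {π : PMF (V × V)}
    (hP : P = Measure.sum fun p : V × V => π p • bridge R p.1 p.2) : P ≪ R := by
  rw [hP]
  refine Measure.absolutelyContinuous_sum_left fun p => ?_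
  exact Measure.AbsolutelyContinuous.smul_left cond_absolutelyContinuous _

end

section

variable {V : Type*} {G : SimpleGraph V} [G.LocallyFinite] {k j : ℝ → V → V → ℝ}
variable [Countable V] [MeasurableSpace V] [DiscreteMeasurableSpace V]
variable {P R : Measure (PathSpace G)} [IsProbabilityMeasure P] [IsProbabilityMeasure R]

/-- In a mixture of bridges of `R`, all transitions have a positive probability. -/
lemma IsReferenceIntensity.mixture_pos (hj : IsReferenceIntensity G j) (hR : HasIntensity R j)
    (hconn : G.Connected) (hR₀ : ∀ x, R {ω | X 0 ω = x} ≠ 0) {π : PMF (V × V)}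
    (hP : P = Measure.sum fun p : V × V => π p • bridge R p.1 p.2) {t s : ℝ} (ht : 0 ≤ t)
    (hts : t < s) (hs : s < 1) (a b : V) (ht0 : t = 0 → P {ω | X 0 ω = a} ≠ 0) :
    P.real {ω | X t ω = a ∧ X s ω = b} ≠ 0 := by
  have key : ∃ p, π p ≠ 0 ∧
      0 < R.real (endpoints G p.1 p.2 ∩ {ω | X t ω = a ∧ X s ω = b}) := by
    rcases ht.eq_or_lt with rfl | h
    · have h1 : ∃ p, π p ≠ 0 ∧ p.1 = a := by
        by_contra! hcon
        refine ht0 rfl ?_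
        rw [hP, Measure.sum_apply _ (measurableSet_X_eq' 0 a), ENNReal.tsum_eq_zero]
        intro p
        by_cases hp : π p = 0
        · simp [hp]
        · have h2 : endpoints G p.1 p.2 ∩ {ω | X 0 ω = a} = ∅ := by
            ext ω
            simp only [endpoints, Set.mem_inter_iff, Set.mem_ofPred_eq, Set.mem_empty_iff_false,
              iff_false]
            exact fun h3 => hcon p hp (h3.1.1.symm.trans h3.2)
          simp [bridge, cond_apply (measurableSet_endpoints p.1 p.2), h2]
      obtain ⟨p, hp, rfl⟩ := h1
      refine ⟨p, hp, ?_⟩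
      have h2 := hj.real_X_X_pos hR hconn hR₀ le_rfl hts hs.le p.1 b
      have h3 := hj.real_inter_pos hR hconn hts.le hs le_rfl p.2
        (D := {ω | X 0 ω = p.1 ∧ X s ω = b}) ((measurableSet_X_eq (Set.left_mem_Icc.2 hts.le) _).inter
          (measurableSet_X_eq (Set.right_mem_Icc.2 hts.le) _)) (fun _ hω => hω.2) h2
      refine h3.trans_le (measureReal_mono ?_)
      exact fun ω hω => ⟨⟨hω.1.1, hω.2⟩, hω.1⟩
    · obtain ⟨p, hp⟩ := π.support_nonempty
      refine ⟨p, hp, ?_⟩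
      have h1 := hj.real_X_X_pos hR hconn hR₀ le_rfl h (hts.trans hs).le p.1 a
      have h2 := hj.real_inter_pos hR hconn ht hts hs.le b
        (D := {ω | X 0 ω = p.1 ∧ X t ω = a}) ((measurableSet_X_eq (Set.left_mem_Icc.2 ht) _).inter
          (measurableSet_X_eq (Set.right_mem_Icc.2 ht) _)) (fun _ hω => hω.2) h1
      have hs0 := ht.trans hts.le
      have h3 := hj.real_inter_pos hR hconn hs0 hs le_rfl p.2
        (D := {ω | X 0 ω = p.1 ∧ X t ω = a} ∩ {ω | X s ω = b})
        (((measurableSet_X_eq (Set.left_mem_Icc.2 hs0) _).inter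
          (measurableSet_X_eq (I := Set.Icc 0 s) ⟨ht, hts.le⟩ _)).inter
          (measurableSet_X_eq (Set.right_mem_Icc.2 hs0) _)) (fun _ hω => hω.2) h2
      refine h3.trans_le (measureReal_mono ?_)
      exact fun ω hω => ⟨⟨hω.1.1.1, hω.2⟩, hω.1.1.2, hω.1.2⟩
  obtain ⟨p, hp, hpos⟩ := key
  have h1 := hasSum_mixture hP ((measurableSet_X_eq' t a).inter (measurableSet_X_eq' s b))
  have h2 := le_hasSum h1 p fun q _ => mul_nonneg ENNReal.toReal_nonneg measureReal_nonneg
  have h3 : 0 < (π p).toReal := ENNReal.toReal_pos hp (π.apply_ne_top p)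
  have h4 : 0 < R.real (endpoints G p.1 p.2) :=
    hpos.trans_le (measureReal_mono Set.inter_subset_left)
  refine (lt_of_lt_of_le ?_ h2).ne'
  rw [real_bridge]
  exact mul_pos h3 (mul_pos (inv_pos.2 h4) hpos)

lemma IsReferenceIntensity.sameShortBridges_mixture (hj : IsReferenceIntensity G j)
    (hR : HasIntensity R j) (hconn : G.Connected) (hR₀ : ∀ x, R {ω | X 0 ω = x} ≠ 0)
    {π : PMF (V × V)} (hP : P = Measure.sum fun p : V × V => π p • bridge R p.1 p.2) {t : ℝ}
    (ht : t ∈ Set.Ico (0 : ℝ) 1) (a b : V) (ht0 : t = 0 → P {ω | X 0 ω = a} ≠ 0) :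
    SameShortBridges P R t a b := by
  have h := (hR.sameBridges hj.continuousRates).of_mixture hP
  filter_upwards [Ioo_mem_nhdsGT (show 0 < 1 - t by linarith [ht.2])] with h' hh
  have h1 : t < t + h' := by linarith [hh.1]
  have h2 : t + h' < 1 := by linarith [hh.2]
  refine ⟨hj.mixture_pos hR hconn hR₀ hP ht.1 h1 h2 a b ht0,
    (hj.real_X_X_pos hR hconn hR₀ ht.1 h1 h2.le a b).ne',
    fun B hB => h.eq_mul ht.1 h1.le h2.le hB a b⟩

lemma IsReferenceIntensity.hasDerivAt (hj : IsReferenceIntensity G j) {z z' : V} (h : G.Adj z z')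
    {t : ℝ} (ht : t ∈ Set.Ioo (0 : ℝ) 1) :
    HasDerivAt (fun s => j s z z') (deriv (fun s => j s z z') t) t :=
  (((hj.contDiffOn z z' h).differentiableOn one_ne_zero t
    (Set.Ioo_subset_Icc_self ht)).differentiableAt (Icc_mem_nhds ht.1 ht.2)).hasDerivAt

lemma IsReferenceIntensity.walkExpansion (hj : IsReferenceIntensity G j) (hR : HasIntensity R j)
    (hconn : G.Connected) (hR₀ : ∀ x, R {ω | X 0 ω = x} ≠ 0) {t : ℝ}
    (ht : t ∈ Set.Ico (0 : ℝ) 1) (c : ClosedWalk G) : WalkExpansion R j t c :=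
  hR.walkExpansion hj.continuousRates ht.1 ht.2 c
    (hj.real_X_pos hR hconn hR₀ (Set.Ico_subset_Icc_self ht) c.1).ne'

lemma IsReferenceIntensity.arcExpansion (hj : IsReferenceIntensity G j) (hR : HasIntensity R j)
    (hconn : G.Connected) (hR₀ : ∀ x, R {ω | X 0 ω = x} ≠ 0) {t : ℝ}
    (ht : t ∈ Set.Ioo (0 : ℝ) 1) {z z' : V} (h : G.Adj z z') : ArcExpansion R j t z z' :=
  hR.arcExpansion hj.continuousRates ht.1.le ht.2 h (hj.hasDerivAt h ht)
    (hj.pos t (Set.Ioo_subset_Icc_self ht) z z' h).ne'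
    (hj.real_X_pos hR hconn hR₀ (Set.Ioo_subset_Icc_self ht) z).ne'

end

/-! ### Existence of bases of closed walks -/

lemma exists_isTreeBasis {V : Type*} [Countable V] {G T : SimpleGraph V} (hle : T ≤ G)
    (hT : T.IsTree) : ∃ C : Set (ClosedWalk G), IsTreeBasis hle hT C := by
  obtain ⟨e, he⟩ := exists_injective_nat V
  refine ⟨_, {c | ∃ (x y : V) (h : G.Adj x y), ¬ T.Adj x y ∧ e x < e y ∧
    c = treeClosedWalk hle hT h}, rfl, ?_, ?_⟩
  · rintro c ⟨x, y, h, h1, -, h2⟩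
    exact ⟨x, y, h, h1, h2⟩
  · -- the starting arc of `treeClosedWalk` can be read off
    have hmem : ∀ {x y : V} (h : G.Adj x y), (∃ (x' y' : V) (h' : G.Adj x' y'), ¬ T.Adj x' y' ∧
        e x' < e y' ∧ treeClosedWalk hle hT h = treeClosedWalk hle hT h') → e x < e y := by
      rintro x y h ⟨x', y', h', -, hlt, heq⟩
      have h1 : x = x' := congrArg Sigma.fst heq
      have h2 := congrArg (fun c : ClosedWalk G => c.2.getVert 1) heq
      simp only [treeClosedWalk, SimpleGraph.Walk.getVert_cons_succ,
        SimpleGraph.Walk.getVert_zero] at h2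
      rwa [h1, h2]
    intro x y h hxy
    have hyx : ¬ T.Adj y x := fun h' => hxy h'.symm
    have hne : e x ≠ e y := fun h' => h.ne (he h')
    rcases hne.lt_or_gt with h1 | h1
    · exact Or.inl ⟨⟨x, y, h, hxy, h1, rfl⟩, fun h2 => absurd (hmem h.symm h2) h1.asymm⟩
    · exact Or.inr ⟨⟨y, x, h.symm, hyx, h1, rfl⟩, fun h2 => absurd (hmem h h2) h1.asymm⟩

end RandomWalk

namespace RandomWalk

/-! ### Potentials on a graph with a spanning tree -/

section Potential

variable {V : Type*} {G T : SimpleGraph V}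

/-- The sum of `φ` over the arcs of a walk. -/
def walkSum {H : SimpleGraph V} (φ : V → V → ℝ) {u v : V} (p : H.Walk u v) : ℝ :=
  ∑ i ∈ Finset.range p.length, φ (p.getVert i) (p.getVert (i + 1))

lemma walkSum_nil {H : SimpleGraph V} (φ : V → V → ℝ) (u : V) :
    walkSum φ (SimpleGraph.Walk.nil : H.Walk u u) = 0 := by
  simp [walkSum]

lemma walkSum_cons {H : SimpleGraph V} (φ : V → V → ℝ) {u v w : V} (h : H.Adj u v)
    (p : H.Walk v w) : walkSum φ (.cons h p) = φ u v + walkSum φ p := by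
  rw [walkSum, SimpleGraph.Walk.length_cons, Finset.sum_range_succ', add_comm]
  simp [walkSum, SimpleGraph.Walk.getVert_cons_succ]

lemma walkSum_mapLe (hle : T ≤ G) (φ : V → V → ℝ) {u v : V} (p : T.Walk u v) :
    walkSum φ (p.mapLe hle) = walkSum φ p := by
  induction p with
  | nil => rw [walkSum_nil]; exact walkSum_nil φ _
  | cons h p ih =>
    rw [walkSum_cons, ← ih]
    exact walkSum_cons φ (hle h) (p.mapLe hle)

/-- Minus the sum of `φ` over the simple walk of the tree `T` from `z` to `o`. -/
def treePotential (hT : T.IsTree) (o : V) (φ : V → V → ℝ) (z : V) : ℝ :=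
  -walkSum φ (hT.existsUnique_path z o).choose

lemma treePotential_sub (hT : T.IsTree) (o : V) {φ : V → V → ℝ} {z z' : V} (h : T.Adj z z')
    (hφ : φ z z' + φ z' z = 0) :
    φ z z' = treePotential hT o φ z' - treePotential hT o φ z := by
  classical
  have hpath := fun u v => (hT.existsUnique_path u v).choose_spec.1
  have huniq := fun u v => (hT.existsUnique_path u v).choose_spec.2
  simp only [treePotential]
  by_cases hz : z ∈ (hT.existsUnique_path z' o).choose.support
  · -- the walk from `z'` passes through `z`, and it goes there by the arc `z' → z`
    set p := (hT.existsUnique_path z' o).choose with hp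
    have h1 : p.dropUntil z hz = (hT.existsUnique_path z o).choose :=
      huniq z o _ ((hpath z' o).dropUntil hz)
    have h2 : p.takeUntil z hz = .cons h.symm .nil :=
      (huniq z' z _ ((hpath z' o).takeUntil hz)).trans
        (huniq z' z _ (by simp [h.ne.symm])).symm
    have h3 : p = .cons h.symm (hT.existsUnique_path z o).choose := by
      refine (SimpleGraph.Walk.take_spec p hz).symm.trans ?_
      rw [h1, h2]
      simp
    rw [h3, walkSum_cons]
    linarith
  · have h1 := huniq z o (.cons h (hT.existsUnique_path z' o).choose)
      ((hpath z' o).cons hz)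
    rw [← h1, walkSum_cons]
    ring

lemma walkSum_eq_sub {φ : V → V → ℝ} {ψ : V → ℝ} (hψ : ∀ z z', T.Adj z z' → φ z z' = ψ z' - ψ z)
    {u v : V} (p : T.Walk u v) : walkSum φ p = ψ v - ψ u := by
  induction p with
  | nil => rw [walkSum_nil, sub_self]
  | cons h p ih => rw [walkSum_cons, ih, hψ _ _ h]; ring

/-- A function on the arcs whose sums over the closed walks of a basis vanish derives from a
potential. -/
lemma IsTreeBasis.eq_sub {hle : T ≤ G} {hT : T.IsTree} {C : Set (ClosedWalk G)}
    (hC : IsTreeBasis hle hT C) (o : V) {φ : V → V → ℝ} (hφ : ∀ c ∈ C, walkSum φ c.2 = 0)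
    {z z' : V} (h : G.Adj z z') : φ z z' = treePotential hT o φ z' - treePotential hT o φ z := by
  obtain ⟨C₀, rfl, -, hC₀⟩ := hC
  have hanti : ∀ {x y : V}, G.Adj x y → φ x y + φ y x = 0 := by
    intro x y h
    have h1 := hφ ⟨x, .cons h (.cons h.symm .nil)⟩ (Or.inr ⟨x, y, h, rfl⟩)
    rwa [walkSum_cons, walkSum_cons, walkSum_nil, add_zero] at h1
  have htree : ∀ x y, T.Adj x y → φ x y = treePotential hT o φ y - treePotential hT o φ x :=
    fun x y h => treePotential_sub hT o h (hanti (hle h))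
  have hclosed : ∀ {x y : V} (h : G.Adj x y), treeClosedWalk hle hT h ∈ C₀ →
      φ x y = treePotential hT o φ y - treePotential hT o φ x := by
    intro x y h hmem
    have h1 := hφ _ (Or.inl hmem)
    rw [treeClosedWalk, walkSum_cons, walkSum_mapLe, walkSum_eq_sub htree] at h1
    linarith
  by_cases hzz : T.Adj z z'
  · exact htree z z' hzz
  · rcases hC₀ z z' h hzz with h1 | h1
    · exact hclosed h h1.1
    · have h2 := hclosed h.symm h1.1
      linarith [hanti h]

lemma walkSum_log {k j : ℝ → V → V → ℝ} {t : ℝ} (c : ClosedWalk G)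
    (hk : ∀ z z', G.Adj z z' → 0 < k t z z') (hj : ∀ z z', G.Adj z z' → 0 < j t z z')
    (h : walkChar k t c = walkChar j t c) :
    walkSum (fun z z' => Real.log (k t z z') - Real.log (j t z z')) c.2 = 0 := by
  have hadj : ∀ i ∈ Finset.range c.2.length, G.Adj (c.2.getVert i) (c.2.getVert (i + 1)) :=
    fun i hi => c.2.adj_getVert_succ (Finset.mem_range.1 hi)
  have h1 := congrArg Real.log h
  rw [walkChar, walkChar, Real.log_prod fun i hi => (hk _ _ (hadj i hi)).ne',
    Real.log_prod fun i hi => (hj _ _ (hadj i hi)).ne'] at h1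
  rw [walkSum, Finset.sum_sub_distrib, h1, sub_self]

end Potential

/-! ### Walks with the same characteristics have the same bridges -/

section Identification

variable {V : Type*} {G T : SimpleGraph V} [G.LocallyFinite] {k j : ℝ → V → V → ℝ}
variable [Countable V] [MeasurableSpace V] [DiscreteMeasurableSpace V]
variable {P Q R : Measure (PathSpace G)} [IsProbabilityMeasure P] [IsProbabilityMeasure Q]
  [IsProbabilityMeasure R]

/-- The intensities `k` and `j` have the same characteristics, along the arcs of a tree and a
basis of closed walks. -/
structure SameCharacteristics {hle : T ≤ G} {hT : T.IsTree} {C : Set (ClosedWalk G)}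
    (hC : IsTreeBasis hle hT C) (k j : ℝ → V → V → ℝ) : Prop where
  pos : ∀ t ∈ Set.Ioo (0 : ℝ) 1, ∀ z z', G.Adj z z' → 0 < k t z z'
  arc : ∀ t ∈ Set.Ioo (0 : ℝ) 1, ∀ z z', T.Adj z z' → arcChar G k t z z' = arcChar G j t z z'
  walk : ∀ t ∈ Set.Ioo (0 : ℝ) 1, ∀ c ∈ C, walkChar k t c = walkChar j t c

lemma hasDerivAt_walkSum {H : SimpleGraph V} {φ : ℝ → V → V → ℝ} {t : ℝ}
    (hφ : ∀ z z', H.Adj z z' → DifferentiableAt ℝ (fun s => φ s z z') t) {u v : V}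
    (p : H.Walk u v) : DifferentiableAt ℝ (fun s => walkSum (φ s) p) t :=
  DifferentiableAt.fun_sum fun _ hi => hφ _ _ (p.adj_getVert_succ (Finset.mem_range.1 hi))

/-- Two intensities with the same characteristics are related by a space-time transform. The
equality of the closed walk characteristics provides the potential `ψ` of `log (k / j)`, and that
of the arc characteristics shows that `∂ₜ ψ` differs from `j̄ - k̄` by a function of time only. -/
lemma SameCharacteristics.exists_transform {hle : T ≤ G} {hT : T.IsTree}
    {C : Set (ClosedWalk G)} {hC : IsTreeBasis hle hT C} (h : SameCharacteristics hC k j)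
    (hk : ∀ z z', G.Adj z z' → ContDiffOn ℝ 1 (fun t => k t z z') (Set.Ico 0 1))
    (hj : IsReferenceIntensity G j) (o : V) {t₀ S : ℝ} (ht₀ : 0 < t₀) (htS : t₀ ≤ S) (hS : S < 1) :
    ∃ g g' : ℝ → V → ℝ, (∀ s z, 0 < g s z) ∧
      (∀ z, ∀ s ∈ Set.Icc t₀ S, HasDerivAt (fun r => g r z) (g' s z) s) ∧
      (∀ w b, w ≠ b → ∀ s ∈ Set.Icc t₀ S, rate G k s w b * g s w = rate G j s w b * g s b) ∧
      ∀ b, ∀ s ∈ Set.Icc t₀ S, rate G k s b b * g s b = rate G j s b b * g s b + g' s b := by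
  have hkc : ContinuousRates G k := fun z z' h => (hk z z' h).continuousOn
  have hI : ∀ {s : ℝ}, s ∈ Set.Icc t₀ S → s ∈ Set.Ioo (0 : ℝ) 1 := fun hs =>
    ⟨ht₀.trans_le hs.1, hs.2.trans_lt hS⟩
  set φ : ℝ → V → V → ℝ := fun t z z' => Real.log (k t z z') - Real.log (j t z z') with hφ
  set ψ : ℝ → V → ℝ := fun t => treePotential hT o (φ t) with hψ
  have hjpos : ∀ t ∈ Set.Ioo (0 : ℝ) 1, ∀ z z', G.Adj z z' → 0 < j t z z' := fun t ht =>
    hj.pos t (Set.Ioo_subset_Icc_self ht)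
  have hkd : ∀ t ∈ Set.Ioo (0 : ℝ) 1, ∀ z z', G.Adj z z' →
      DifferentiableAt ℝ (fun s => Real.log (k s z z')) t := fun t ht z z' h' =>
    DifferentiableAt.log (((hk z z' h').differentiableOn one_ne_zero t
      (Set.Ioo_subset_Ico_self ht)).differentiableAt (Ico_mem_nhds ht.1 ht.2))
      (h.pos t ht z z' h').ne'
  have hjd : ∀ t ∈ Set.Ioo (0 : ℝ) 1, ∀ z z', G.Adj z z' →
      DifferentiableAt ℝ (fun s => Real.log (j s z z')) t := fun t ht z z' h' =>
    (hj.hasDerivAt h' ht).differentiableAt.log (hjpos t ht z z' h').ne'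
  have hψd : ∀ t ∈ Set.Ioo (0 : ℝ) 1, ∀ z, DifferentiableAt ℝ (fun s => ψ s z) t :=
    fun t ht z => (hasDerivAt_walkSum (fun z z' h' => (hkd t ht z z' (hle h')).sub
      (hjd t ht z z' (hle h'))) (hT.existsUnique_path z o).choose).neg
  have hsub : ∀ t ∈ Set.Ioo (0 : ℝ) 1, ∀ z z', G.Adj z z' → φ t z z' = ψ t z' - ψ t z :=
    fun t ht z z' h' => hC.eq_sub o
      (fun c hc => walkSum_log c (h.pos t ht) (hjpos t ht) (h.walk t ht c hc)) h'
  set δ : ℝ → V → ℝ := fun t z => totalRate G k t z - totalRate G j t z with hδ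
  -- along the arcs of the tree, `∂ₜ ψ + δ` is constant
  have hstep : ∀ t ∈ Set.Ioo (0 : ℝ) 1, ∀ z z', T.Adj z z' →
      deriv (fun s => ψ s z) t + δ t z = deriv (fun s => ψ s z') t + δ t z' := by
    intro t ht z z' h'
    have h1 : (fun s => Real.log (k s z z') - Real.log (j s z z')) =ᶠ[𝓝 t]
        fun s => ψ s z' - ψ s z := by
      filter_upwards [Ioo_mem_nhds ht.1 ht.2] with s hs
      exact hsub s hs z z' (hle h')
    have h2 := h1.deriv_eq
    rw [deriv_fun_sub (hkd t ht z z' (hle h')) (hjd t ht z z' (hle h')),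
      deriv_fun_sub (hψd t ht z') (hψd t ht z)] at h2
    have h3 := h.arc t ht z z' h'
    simp only [arcChar] at h3
    simp only [hδ]
    linarith
  have hconst : ∀ t ∈ Set.Ioo (0 : ℝ) 1, ∀ z,
      deriv (fun s => ψ s z) t + δ t z = δ t o := by
    intro t ht z
    have hwalk : ∀ {u v : V}, T.Walk u v →
        deriv (fun s => ψ s u) t + δ t u = deriv (fun s => ψ s v) t + δ t v := by
      intro u v p
      induction p with
      | nil => rfl
      | cons h' p ih => rw [hstep t ht _ _ h', ih]
    obtain ⟨p⟩ := hT.connected.preconnected z o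
    have h1 := hwalk p
    have h2 : (fun s => ψ s o) = fun _ => 0 := by
      ext s
      have h3 : (SimpleGraph.Walk.nil : T.Walk o o) = (hT.existsUnique_path o o).choose :=
        (hT.existsUnique_path o o).choose_spec.2 _ SimpleGraph.Walk.IsPath.nil
      simp only [hψ, treePotential]
      rw [← h3, walkSum_nil, neg_zero]
    rw [h1, h2, deriv_const, zero_add]
  obtain ⟨A, -, hA⟩ := exists_primitive (a := fun s => δ s o) htS
    (((hkc.totalRate o).sub (hj.continuousRates.totalRate o)).mono fun s hs =>
      Set.Ioo_subset_Ico_self (hI hs))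
  refine ⟨fun s z => Real.exp (ψ s z - A s),
    fun s z => Real.exp (ψ s z - A s) * (deriv (fun r => ψ r z) s - δ s o),
    fun s z => Real.exp_pos _, fun z s hs => ?_, fun w b hwb s hs => ?_, fun b s hs => ?_⟩
  · exact ((hψd s (hI hs) z).hasDerivAt.sub (hA s hs)).exp
  · by_cases h' : G.Adj w b
    · rw [rate_of_adj h', rate_of_adj h']
      have h1 := hsub s (hI hs) w b h'
      have hkp := h.pos s (hI hs) w b h'
      have hjp := hjpos s (hI hs) w b h'
      have h2 : k s w b = j s w b * Real.exp (ψ s b - ψ s w) := by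
        rw [← h1, hφ, Real.exp_sub, Real.exp_log hkp, Real.exp_log hjp]
        field_simp
      rw [h2, mul_assoc, ← Real.exp_add]
      congr 2
      ring
    · rw [rate_of_not_adj hwb h', rate_of_not_adj hwb h', zero_mul, zero_mul]
  · have h1 := hconst s (hI hs) b
    simp only [hδ] at h1 ⊢
    rw [rate_self, rate_self]
    linear_combination -Real.exp (ψ s b - A s) * h1

/-- The bridges of `Q` over `[t₀, S]`, `0 < t₀ < S < 1`, are those of `R`. -/
lemma SameCharacteristics.real_mul_eq {hle : T ≤ G} {hT : T.IsTree}
    {C : Set (ClosedWalk G)} {hC : IsTreeBasis hle hT C} (h : SameCharacteristics hC k j)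
    (hQ : HasIntensity Q k)
    (hk : ∀ z z', G.Adj z z' → ContDiffOn ℝ 1 (fun t => k t z z') (Set.Ico 0 1))
    (hj : IsReferenceIntensity G j) (hR : HasIntensity R j) (hconn : G.Connected)
    (hR₀ : ∀ x, R {ω | X 0 ω = x} ≠ 0) {t₀ S : ℝ} (ht₀ : 0 < t₀) (htS : t₀ ≤ S) (hS : S < 1)
    {E : Set (PathSpace G)} (hE : MeasurableSet[sigmaX G (Set.Icc t₀ S)] E) (a b : V) :
    R.real {ω | X t₀ ω = a ∧ X S ω = b} * Q.real (E ∩ {ω | X t₀ ω = a ∧ X S ω = b}) =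
      R.real (E ∩ {ω | X t₀ ω = a ∧ X S ω = b}) * Q.real {ω | X t₀ ω = a ∧ X S ω = b} := by
  obtain ⟨g, g', hpos, hg, hoff, hdiag⟩ := h.exists_transform hk hj a ht₀ htS hS
  have hratio := transitionRatio_of_rates hQ (fun z z' h => (hk z z' h).continuousOn) hR
    hj.continuousRates (I := Set.Icc t₀ S) (fun s hs => ⟨ht₀.le.trans hs.1, hs.2.trans_lt hS⟩)
    Set.ordConnected_Icc hg hoff hdiag
  have hm : MeasurableSet[sigmaX G (Set.Icc 0 t₀)] {ω | X t₀ ω = a} :=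
    measurableSet_X_eq (Set.right_mem_Icc.2 ht₀.le) a
  have key := fun (E : Set (PathSpace G)) (hE : MeasurableSet[sigmaX G (Set.Icc t₀ S)] E) =>
    hratio.sigmaX (fun s _ z => hpos s z) ht₀.le htS hS.le hm hm (fun _ hω => hω)
      (fun _ hω => hω) hE b
  have h1 := key E hE
  have h2 := key Set.univ MeasurableSet.univ
  rw [Set.univ_inter] at h2
  have hp : R.real {ω | X t₀ ω = a} ≠ 0 :=
    (hj.real_X_pos hR hconn hR₀ ⟨ht₀.le, htS.trans hS.le⟩ a).ne'
  refine mul_left_cancel₀ (mul_ne_zero (hpos t₀ a).ne' hp) ?_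
  have e : {ω : PathSpace G | X t₀ ω = a ∧ X S ω = b} = {ω | X t₀ ω = a} ∩ {ω | X S ω = b} := rfl
  rw [e]
  linear_combination R.real ({ω | X t₀ ω = a} ∩ {ω | X S ω = b}) * h1 -
    R.real (E ∩ ({ω | X t₀ ω = a} ∩ {ω | X S ω = b})) * h2

lemma SameCharacteristics.eq_bridge {hle : T ≤ G} {hT : T.IsTree}
    {C : Set (ClosedWalk G)} {hC : IsTreeBasis hle hT C} (h : SameCharacteristics hC k j)
    (hQ : HasIntensity Q k)
    (hk : ∀ z z', G.Adj z z' → ContDiffOn ℝ 1 (fun t => k t z z') (Set.Ico 0 1))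
    (hj : IsReferenceIntensity G j) (hR : HasIntensity R j) (hconn : G.Connected)
    (hR₀ : ∀ x, R {ω | X 0 ω = x} ≠ 0) {x y : V} (hxy : Q.real (endpoints G x y) = 1) :
    Q = bridge R x y := by
  classical
  have hRxy : R.real (endpoints G x y) ≠ 0 :=
    (hj.real_X_X_pos hR hconn hR₀ le_rfl zero_lt_one le_rfl x y).ne'
  have hep : endpoints G x y = {ω | X 1 ω = y} ∩ {ω | X 0 ω = x} := by
    ext ω; exact and_comm
  -- events of finitely many times within `(0, 1)`
  have hinner : ∀ (U : ℝ → Set V) (F : Finset ℝ), (∀ i ∈ F, i ∈ Set.Ioo (0 : ℝ) 1) →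
      R.real (endpoints G x y) * Q.real ((⋂ i ∈ F, {ω | X i ω ∈ U i}) ∩ endpoints G x y) =
        Q.real (endpoints G x y) * R.real ((⋂ i ∈ F, {ω | X i ω ∈ U i}) ∩ endpoints G x y) := by
    intro U F hF
    set E : Set (PathSpace G) := ⋂ i ∈ F, {ω | X i ω ∈ U i} with hE
    have hmE : MeasurableSet E := Finset.measurableSet_biInter _ fun i _ =>
      measurableSet_X_mem' i (U i)
    have hm : ∀ s b, MeasurableSet {ω : PathSpace G | X s ω = b} := measurableSet_X_eq'
    have e1 : ∀ t s : ℝ, ∀ D : Set (PathSpace G), D ∩ {ω | X t ω = x ∧ X s ω = y} =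
        (D ∩ {ω | X s ω = y}) ∩ {ω | X t ω = x} := by
      intro t s D; ext ω
      simp only [Set.mem_inter_iff, Set.mem_ofPred_eq]
      tauto
    have e2 : ∀ t s : ℝ, ∀ D : Set (PathSpace G), D ∩ {ω | X t ω = x ∧ X s ω = y} =
        (D ∩ {ω | X t ω = x}) ∩ {ω | X s ω = y} := by
      intro t s D; ext ω
      simp only [Set.mem_inter_iff, Set.mem_ofPred_eq]
      tauto
    have hlim0 : ∀ (μ : Measure (PathSpace G)) [IsProbabilityMeasure μ] (D : Set (PathSpace G)),
        MeasurableSet D → ∀ s, Tendsto (fun t => μ.real (D ∩ {ω | X t ω = x ∧ X s ω = y})) (𝓝[>] 0)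
          (𝓝 (μ.real (D ∩ {ω | X 0 ω = x ∧ X s ω = y}))) := by
      intro μ _ D hD s
      simp only [e1]
      exact tendsto_real_X_zero _ (hD.inter (hm s y)) x
    have hlim1 : ∀ (μ : Measure (PathSpace G)) [IsProbabilityMeasure μ] (D : Set (PathSpace G)),
        MeasurableSet D → ∀ t, Tendsto (fun s => μ.real (D ∩ {ω | X t ω = x ∧ X s ω = y})) (𝓝[<] 1)
          (𝓝 (μ.real (D ∩ {ω | X t ω = x ∧ X 1 ω = y}))) := by
      intro μ _ D hD t
      simp only [e2]
      exact tendsto_real_X_one _ (hD.inter (hm t x)) y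
    have hev0 : ∀ᶠ t in 𝓝[>] (0 : ℝ), ∀ i ∈ F, t ≤ i := by
      rw [Finset.eventually_all]
      intro i hi
      filter_upwards [Ioo_mem_nhdsGT (hF i hi).1] with t ht
      exact ht.2.le
    have hev1 : ∀ᶠ s in 𝓝[<] (1 : ℝ), ∀ i ∈ F, i ≤ s := by
      rw [Finset.eventually_all]
      intro i hi
      filter_upwards [Ioo_mem_nhdsLT (hF i hi).2] with s hs
      exact hs.1.le
    have hstep : ∀ᶠ s in 𝓝[<] (1 : ℝ),
        R.real (Set.univ ∩ {ω | X 0 ω = x ∧ X s ω = y}) *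
          Q.real (E ∩ {ω | X 0 ω = x ∧ X s ω = y}) =
        R.real (E ∩ {ω | X 0 ω = x ∧ X s ω = y}) *
          Q.real (Set.univ ∩ {ω | X 0 ω = x ∧ X s ω = y}) := by
      filter_upwards [hev1, Ioo_mem_nhdsLT zero_lt_one] with s hs hs01
      refine tendsto_nhds_unique_of_eventuallyEq
        ((hlim0 R _ MeasurableSet.univ s).mul (hlim0 Q E hmE s))
        ((hlim0 R E hmE s).mul (hlim0 Q _ MeasurableSet.univ s)) ?_
      filter_upwards [hev0, Ioo_mem_nhdsGT hs01.1] with t ht ht0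
      rw [Set.univ_inter]
      refine h.real_mul_eq hQ hk hj hR hconn hR₀ ht0.1 ht0.2.le hs01.2 ?_ x y
      exact Finset.measurableSet_biInter _ fun i hi =>
        measurableSet_X_mem (I := Set.Icc t s) ⟨ht i hi, hs i hi⟩ (U i)
    have h1 := tendsto_nhds_unique_of_eventuallyEq
      ((hlim1 R _ MeasurableSet.univ 0).mul (hlim1 Q E hmE 0))
      ((hlim1 R E hmE 0).mul (hlim1 Q _ MeasurableSet.univ 0)) hstep
    rw [Set.univ_inter] at h1
    rw [mul_comm (Q.real (endpoints G x y))]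
    exact h1
  have hall : ∀ E : Set (PathSpace G), MeasurableSet E →
      R.real (endpoints G x y) * Q.real (E ∩ endpoints G x y) =
        Q.real (endpoints G x y) * R.real (E ∩ endpoints G x y) := by
    intro E hE
    refine mul_measureReal_eq_of_piSystem (sigmaX_le (Set.Icc 0 1))
      (generateFrom_piiUnionInter_measurableSet _ _).symm (isPiSystem_comap_X _)
      measureReal_nonneg measureReal_nonneg (mul_comm _ _) (fun E hE => ?_)
      (measurableSet_sigmaX_Icc hE)
    obtain ⟨F, U, hF, rfl⟩ := piiUnionInter_comap_X hE
    -- the conditions at the times `0` and `1` hold everywhere or nowhere on the event `endpoints`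
    by_cases hgood : ∀ i ∈ F, (i = 0 → x ∈ U i) ∧ (i = 1 → y ∈ U i)
    · have h1 : (⋂ i ∈ F, {ω : PathSpace G | X i ω ∈ U i}) ∩ endpoints G x y =
          (⋂ i ∈ F.filter (· ∈ Set.Ioo (0 : ℝ) 1), {ω | X i ω ∈ U i}) ∩ endpoints G x y := by
        ext ω
        simp only [Set.mem_inter_iff, Set.mem_iInter, Finset.mem_filter, endpoints,
          Set.mem_ofPred_eq]
        refine ⟨fun h1 => ⟨fun i hi => h1.1 i hi.1, h1.2⟩, fun h1 => ⟨fun i hi => ?_, h1.2⟩⟩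
        by_cases hi0 : i = 0
        · have := (hgood i hi).1 hi0
          rw [hi0] at this ⊢
          rwa [h1.2.1]
        by_cases hi1 : i = 1
        · have := (hgood i hi).2 hi1
          rw [hi1] at this ⊢
          rwa [h1.2.2]
        exact h1.1 i ⟨hi, lt_of_le_of_ne (hF hi).1 (Ne.symm hi0), lt_of_le_of_ne (hF hi).2 hi1⟩
      rw [h1]
      exact hinner U _ fun i hi => (Finset.mem_filter.1 hi).2
    · have h1 : (⋂ i ∈ F, {ω : PathSpace G | X i ω ∈ U i}) ∩ endpoints G x y = ∅ := by
        ext ω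
        simp only [Set.mem_inter_iff, Set.mem_iInter, endpoints, Set.mem_ofPred_eq,
          Set.mem_empty_iff_false, iff_false]
        rintro ⟨h1, h2, h3⟩
        refine hgood fun i hi => ⟨?_, ?_⟩
        · rintro rfl
          exact h2 ▸ h1 0 hi
        · rintro rfl
          exact h3 ▸ h1 1 hi
      rw [h1, measureReal_empty, measureReal_empty, mul_zero, mul_zero]
  have := isProbabilityMeasure_bridge (R := R) (x := x) (y := y) fun h0 => hRxy (by
    rw [measureReal_def, h0, ENNReal.toReal_zero])
  refine Measure.ext fun E hE => ?_
  have h1 := hall E hE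
  rw [hxy, one_mul] at h1
  have h2 : Q.real (E ∩ endpoints G x y) = Q.real E := by
    have h3 : Q (endpoints G x y)ᶜ = 0 := by
      rw [prob_compl_eq_zero_iff (measurableSet_endpoints x y)]
      rwa [measureReal_def, ENNReal.toReal_eq_one_iff] at hxy
    rw [measureReal_def, measureReal_def, measure_inter_conull h3]
  rw [h2] at h1
  rw [← measureReal_eq_measureReal_iff, real_bridge, Set.inter_comm _ E]
  field_simp
  linarith

end Identification

end RandomWalk

namespace RandomWalk

/-! ### Identification of the characteristics from the expansions -/

variable {V : Type*} {G T : SimpleGraph V} [G.LocallyFinite] {k j : ℝ → V → V → ℝ}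
variable [Countable V] [MeasurableSpace V] [DiscreteMeasurableSpace V]
variable {P Q R : Measure (PathSpace G)} [IsProbabilityMeasure P] [IsProbabilityMeasure Q]
  [IsProbabilityMeasure R]

/-- The short-time expansions of `P` determine the characteristics of the intensity of its
bridges `Q`. The expansions along the walks `z → z' → z` are used first: they show, one arc
after the other, that the intensity of `Q` is positive and that `Q` visits all states. -/
lemma HasIntensity.sameCharacteristics (hQ : HasIntensity Q k)
    (hk0 : ∀ t ∈ Set.Ico (0 : ℝ) 1, ∀ z z', G.Adj z z' → 0 ≤ k t z z')
    (hk : ∀ z z', G.Adj z z' → ContDiffOn ℝ 1 (fun t => k t z z') (Set.Ico 0 1))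
    (hj : IsReferenceIntensity G j) (hconn : G.Connected) {x : V}
    (hx : 0 < Q.real {ω | X 0 ω = x}) (hQP : SameBridges Q P) (hac : Q ≪ P) {hle : T ≤ G}
    {hT : T.IsTree} {C : Set (ClosedWalk G)} (hC : IsTreeBasis hle hT C)
    (harc : ∀ t ∈ Set.Ioo (0 : ℝ) 1, ∀ z z', T.Adj z z' → ArcExpansion P j t z z')
    (hwalk : ∀ t ∈ Set.Ioo (0 : ℝ) 1, ∀ c ∈ C, WalkExpansion P j t c) :
    SameCharacteristics hC k j := by
  have hkc : ContinuousRates G k := fun z z' h => (hk z z' h).continuousOn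
  have hmX : ∀ t : ℝ, 0 ≤ t → ∀ z, MeasurableSet[sigmaX G (Set.Icc 0 t)] {ω | X t ω = z} :=
    fun t ht z => measurableSet_X_eq (Set.right_mem_Icc.2 ht) z
  have hshort : ∀ t ∈ Set.Ioo (0 : ℝ) 1, ∀ a b,
      (∀ s, t < s → s < 1 → 0 < Q.real {ω | X t ω = a ∧ X s ω = b}) →
      SameShortBridges Q P t a b := by
    intro t ht a b hpos
    filter_upwards [Ioo_mem_nhdsGT (show 0 < 1 - t by linarith [ht.2])] with h hh
    have h1 : t < t + h := by linarith [hh.1]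
    have h2 : t + h < 1 := by linarith [hh.2]
    have h3 := hpos (t + h) h1 h2
    refine ⟨h3.ne', fun h4 => h3.ne' ?_, fun B hB => hQP.eq_mul ht.1.le h1.le h2.le hB a b⟩
    rw [measureReal_eq_zero_iff] at h4 ⊢
    exact hac h4
  have hchar : ∀ t ∈ Set.Ioo (0 : ℝ) 1, ∀ c ∈ C, 0 < Q.real {ω | X t ω = c.1} →
      walkChar k t c = walkChar j t c := by
    intro t ht c hc hpos
    have h1 := hshort t ht c.1 c.1 fun s hs hs1 =>
      hQ.pos_stay hkc ht.1.le hs.le hs1 (hmX t ht.1.le c.1) (fun _ hω => hω) hpos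
    exact (hQ.walkExpansion hkc ht.1.le ht.2 c hpos.ne').walkChar_eq
      (h1.walkExpansion ht.1.le ht.2 (hwalk t ht c hc))
  have hkpos : ∀ t ∈ Set.Ioo (0 : ℝ) 1, ∀ z z', G.Adj z z' → 0 < Q.real {ω | X t ω = z} →
      0 < k t z z' := by
    intro t ht z z' h hpos
    have hmem : (⟨z, .cons h (.cons h.symm .nil)⟩ : ClosedWalk G) ∈ C := by
      obtain ⟨C₀, rfl, -, -⟩ := hC
      exact Or.inr ⟨z, z', h, rfl⟩
    have h1 := hchar t ht _ hmem hpos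
    have h2 : ∀ k' : ℝ → V → V → ℝ, walkChar k' t
        (⟨z, .cons h (.cons h.symm .nil)⟩ : ClosedWalk G) = k' t z z' * k' t z' z := by
      intro k'
      simp [walkChar, Finset.prod_range_succ, SimpleGraph.Walk.getVert_cons_succ]
    rw [h2, h2] at h1
    have ht' := Set.Ioo_subset_Icc_self ht
    refine lt_of_le_of_ne (hk0 t (Set.Ioo_subset_Ico_self ht) z z' h) fun h3 => ?_
    rw [← h3, zero_mul] at h1
    exact absurd h1 (mul_pos (hj.pos t ht' z z' h) (hj.pos t ht' z' z h.symm)).ne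
  have hvisit : ∀ {z z' : V}, G.Walk z z' → (∀ t ∈ Set.Ioo (0 : ℝ) 1, 0 < Q.real {ω | X t ω = z}) →
      ∀ t ∈ Set.Ioo (0 : ℝ) 1, 0 < Q.real {ω | X t ω = z'} := by
    intro z z' p
    induction p with
    | nil => exact fun h => h
    | cons h p ih =>
      refine fun hz => ih fun t ht => ?_
      have h1 : t / 2 ∈ Set.Ioo (0 : ℝ) 1 := ⟨by linarith [ht.1], by linarith [ht.2, ht.1]⟩
      exact (hQ.pos_step hkc h1.1.le (by linarith [ht.1]) ht.2 h (hkpos _ h1 _ _ h (hz _ h1))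
        (hmX _ h1.1.le _) (fun _ hω => hω) (hz _ h1)).trans_le
        (measureReal_mono Set.inter_subset_right)
  have hpos : ∀ t ∈ Set.Ioo (0 : ℝ) 1, ∀ z, 0 < Q.real {ω | X t ω = z} := by
    intro t ht z
    obtain ⟨p⟩ := hconn.preconnected x z
    refine hvisit p (fun s hs => ?_) t ht
    exact (hQ.pos_stay hkc le_rfl hs.1.le hs.2 (hmX 0 le_rfl x) (fun _ hω => hω) hx).trans_le
      (measureReal_mono Set.inter_subset_right)
  have hkpos' := fun t ht z z' h => hkpos t ht z z' h (hpos t ht z)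
  refine ⟨hkpos', fun t ht z z' h => ?_, fun t ht c hc => hchar t ht c hc (hpos t ht c.1)⟩
  have hG := hle h
  have h1 := hshort t ht z z' fun s hs hs1 => hQ.pos_step hkc ht.1.le hs hs1 hG
    (hkpos' t ht z z' hG) (hmX t ht.1.le z) (fun _ hω => hω) (hpos t ht z)
  have hd := (((hk z z' hG).differentiableOn one_ne_zero t
    (Set.Ioo_subset_Ico_self ht)).differentiableAt (Ico_mem_nhds ht.1 ht.2)).hasDerivAt
  exact (hQ.arcExpansion hkc ht.1.le ht.2 hG hd (hkpos' t ht z z' hG).ne'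
    (hpos t ht z).ne').arcChar_eq (h1.arcExpansion ht.1.le ht.2 hG.ne (harc t ht z z' h))

lemma mem_reciprocalClass_of_bridge_eq (h : ∀ x y, P (endpoints G x y) ≠ 0 →
    R (endpoints G x y) ≠ 0 ∧ bridge P x y = bridge R x y) : P ∈ reciprocalClass R := by
  have hmX : Measurable fun ω : PathSpace G => (X 0 ω, X 1 ω) :=
    (measurable_X 0).prodMk (measurable_X 1)
  have : IsProbabilityMeasure (P.map fun ω : PathSpace G => (X 0 ω, X 1 ω)) :=
    Measure.isProbabilityMeasure_map hmX.aemeasurable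
  have hπ : ∀ p : V × V, (P.map fun ω : PathSpace G => (X 0 ω, X 1 ω)).toPMF p =
      P (endpoints G p.1 p.2) := by
    intro p
    rw [Measure.toPMF_apply, Measure.map_apply hmX (measurableSet_singleton p)]
    congr 1
    ext ω
    simp [endpoints, Prod.ext_iff]
  refine ⟨(P.map fun ω : PathSpace G => (X 0 ω, X 1 ω)).toPMF, fun p hp => ?_, ?_⟩
  · rw [PMF.mem_support_iff, hπ] at hp
    exact (h p.1 p.2 hp).1
  · refine Measure.ext fun E hE => ?_
    rw [Measure.sum_apply _ hE]
    have h1 : E = ⋃ p : V × V, endpoints G p.1 p.2 ∩ E := by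
      ext ω
      simp [endpoints]
    conv_lhs => rw [h1]
    rw [measure_iUnion]
    · refine tsum_congr fun p => ?_
      rw [Measure.smul_apply, hπ, smul_eq_mul]
      by_cases hp : P (endpoints G p.1 p.2) = 0
      · rw [hp, zero_mul]
        exact measure_mono_null Set.inter_subset_left hp
      · rw [← (h p.1 p.2 hp).2, bridge, mul_comm,
          cond_mul_eq_inter (measurableSet_endpoints p.1 p.2)]
    · intro p q hpq
      refine Set.disjoint_left.2 fun ω h2 h3 => hpq (Prod.ext ?_ ?_)
      · exact h2.1.1.symm.trans h3.1.1
      · exact h2.1.2.symm.trans h3.1.2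
    · exact fun p => (measurableSet_endpoints p.1 p.2).inter hE

end RandomWalk

end

theorem corollary2p8 {V : Type*} [Countable V] [MeasurableSpace V] [DiscreteMeasurableSpace V]
    (G : SimpleGraph V) [G.LocallyFinite] (hconn : G.Connected)
    (hdeg : ∃ d : ℕ, ∀ z : V, G.degree z ≤ d)
    (j : ℝ → V → V → ℝ) (hj : IsReferenceIntensity G j)
    (R : Measure (PathSpace G)) [IsProbabilityMeasure R]
    (hR : HasIntensity R j) (hR₀ : ∀ x : V, R {ω | X 0 ω = x} ≠ 0)
    (P : Measure (PathSpace G)) [IsProbabilityMeasure P] :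
    P ∈ reciprocalClass R ↔
      (IsReciprocal P ∧
        ∀ x y : V, P (endpoints G x y) ≠ 0 →
          bridge P x y ≪ bridge R x y ∧
          ∃ k : ℝ → V → V → ℝ,
            (∀ t ∈ Set.Ico (0 : ℝ) 1, ∀ z z', G.Adj z z' → 0 ≤ k t z z') ∧
            (∀ z z', G.Adj z z' → ContDiffOn ℝ 1 (fun t => k t z z') (Set.Ico 0 1)) ∧
            HasIntensity (bridge P x y) k) ∧
      ∃ (T : SimpleGraph V) (hle : T ≤ G) (hT : T.IsTree),
        (∀ t ∈ Set.Ioo (0 : ℝ) 1, ∀ z z', T.Adj z z' → ArcExpansion P j t z z') ∧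
        ∃ C : Set (ClosedWalk G), IsTreeBasis hle hT C ∧
          ∀ t ∈ Set.Ico (0 : ℝ) 1, ∀ c ∈ C,
            (t = 0 → P {ω | X 0 ω = c.1} ≠ 0) → WalkExpansion P j t c := by
  have hRR := hR.sameBridges hj.continuousRates
  constructor
  · rintro ⟨π, -, hP⟩
    have hPR : P ≪ R := absolutelyContinuous_mixture hP
    have hsame : SameBridges P R := hRR.of_mixture hP
    refine ⟨⟨isReciprocal_iff_sameBridges.2 (hsame.self hPR), fun x y hxy => ?_⟩, ?_⟩
    · have hRxy : R (endpoints G x y) ≠ 0 := fun h => hxy (hPR h)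
      rw [hsame.bridge_eq hxy hRxy]
      exact ⟨Measure.AbsolutelyContinuous.rfl, bridgeRate R j y,
        fun t ht z z' h => bridgeRate_nonneg hj (Set.Ico_subset_Icc_self ht) y h,
        fun z z' h => hj.contDiffOn_bridgeRate hR hconn hR₀ y h,
        hj.hasIntensity_bridge hR hconn hR₀ hRxy⟩
    · obtain ⟨T, hle, hT⟩ := hconn.exists_isTree_le
      obtain ⟨C, hC⟩ := exists_isTreeBasis hle hT
      refine ⟨T, hle, hT, fun t ht z z' h => ?_, C, hC, fun t ht c _ h0 => ?_⟩
      · exact (hj.sameShortBridges_mixture hR hconn hR₀ hP (Set.Ioo_subset_Ico_self ht) z z'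
          fun h0 => absurd h0 ht.1.ne').arcExpansion ht.1.le ht.2 (hle h).ne
          (hj.arcExpansion hR hconn hR₀ ht (hle h))
      · refine (hj.sameShortBridges_mixture hR hconn hR₀ hP ht c.1 c.1 fun h1 => ?_).walkExpansion
          ht.1 ht.2 (hj.walkExpansion hR hconn hR₀ ht c)
        exact h0 h1
  · rintro ⟨⟨hrec, hbridge⟩, T, hle, hT, harc, C, hC, hwalk⟩
    have hPP := isReciprocal_iff_sameBridges.1 hrec
    refine mem_reciprocalClass_of_bridge_eq fun x y hxy => ?_
    obtain ⟨-, k, hk0, hk, hint⟩ := hbridge x y hxy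
    have := isProbabilityMeasure_bridge hxy
    have hxy' : P.real (endpoints G x y) ≠ 0 := by rwa [Ne, measureReal_eq_zero_iff]
    have h1 : (bridge P x y).real (endpoints G x y) = 1 := by
      rw [real_bridge, Set.inter_self, inv_mul_cancel₀ hxy']
    have h0 : 0 < (bridge P x y).real {ω | X 0 ω = x} :=
      (zero_lt_one.trans_eq h1.symm).trans_le (measureReal_mono fun _ h => h.1)
    have hchar := hint.sameCharacteristics hk0 hk hj hconn h0 (hPP.bridge x y)
      cond_absolutelyContinuous hC harc
      fun t ht c hc => hwalk t (Set.Ioo_subset_Ico_self ht) c hc fun h => absurd h ht.1.ne'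
    refine ⟨fun hRxy => ?_, hchar.eq_bridge hint hk hj hR hconn hR₀ h1⟩
    exact (hj.real_X_X_pos hR hconn hR₀ le_rfl zero_lt_one le_rfl x y).ne'
      ((measureReal_eq_zero_iff).2 hRxy)
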